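/- For $d\ge 0$ let $\mathcal Z(d)\subset\mathbb Q S(d)$ be the center of the group algebra of the symmetric group. For a partition $\mu$ with size $|\mu|$ and length $\ell(\mu)$, let $C_\mu\in\mathcal Z(|\mu|)$ be the sum of all permutations of cycle type $\mu$; the $C_\mu$, over all partitions $\mu$ (including $\emptyset$), form a basis of $\bigoplus_{d\ge0}\mathcal Z(d)$. Let $\mathcal P$ be the set of all partitions, and let $\phi:\bigoplus_{d\ge 0}\mathcal Z(d)\to\mathbb Q^{\mathcal P}$ be the linear map with $\phi(C_\mu)=\mathbf f_\mu$, $$\mathbf f_\mu(\lambda)=\binom{|\lambda|}{|\mu|}\,|C_\mu|\,\frac{\chi^\lambda_\mu}{\dim\lambda},$$ where $|C_\mu|$ is the number of permutations of cycle type $\mu$ in $S(|\mu|)$, $\dim\lambda$ is the dimension of the irreducible representation of $S(|\lambda|)$ indexed by $\lambda$, and $\chi^\lambda_\mu$ is its character at a permutation of cycle type $\mu$, viewed in $S(|\lambda|)$ via $S(|\mu|)\subset S(|\lambda|)$ (and $\mathbf f_\mu(\lambda)=0$ if $|\mu|>|\lambda|$). For $k\ge 1$ let $$\mathbf p_k(\lambda)=\sum_{i=1}^\infty\left[(\lambda_i-i+\tfrac12)^k-(-i+\tfrac12)^k\right]+(1-2^{-k})\,\zeta(-k).$$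 Proposition. For every $k\ge1$ there is a unique element $\overline{(k)}\in\bigoplus_{d\ge 0}\mathcal Z(d)$ with $\phi\big(\overline{(k)}\big)=\frac1k\,\mathbf p_k$ (the completed cycle). Its coefficients in the expansion $\overline{(k)}=\sum_\mu\rho_{k,\mu}\,C_\mu$ are as follows. Put $d=|\mu|$. If $k+1=|\mu|+\ell(\mu)+2g$ for an integer $g\ge 0$, then $$\rho_{k,\mu}=(k-1)!\,\frac{\prod_i\mu_i}{d!}\,[z^{2g}]\;\mathcal S(z)^{d-1}\prod_i\mathcal S(\mu_i z),\qquad \mathcal S(z)=\frac{\sinh(z/2)}{z/2},$$ where $[z^{2g}]$ denotes the coefficient of $z^{2g}$ in the power series. If $k+1-|\mu|-\ell(\mu)$ is negative or odd, then $\rho_{k,\mu}=0$. -/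

import Mathlib

/-!
Partitions are Young diagrams `μ : YoungDiagram`: the parts are the row lengths
(`μ.rowLens` lists the nonzero ones, `μ.rowLen i` is the part of index `i`, counted from `0`),
the size is `μ.card`, and the number of nonzero parts is `μ.colLen 0`.
-/

noncomputable section

namespace CompletedCycles

open Equiv

/-- The rational group algebra of the symmetric group `S(d)`. -/
abbrev GroupAlg (d : ℕ) : Type := MonoidAlgebra ℚ (Perm (Fin d))

/-- The class algebra `Z(d)`: the center of the group algebra of `S(d)`. -/
abbrev ClassAlg (d : ℕ) : Subalgebra ℚ (GroupAlg d) := Subalgebra.center ℚ (GroupAlg d)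

/-- The direct sum of all class algebras `Z(d)`, `d ≥ 0`. -/
abbrev TotalClassAlg : Type := DirectSum ℕ fun d => ClassAlg d

/-! ### Conjugacy classes -/

/-- `σ` has cycle type `μ`; fixed points count as cycles of length one. -/
def HasType {d : ℕ} (σ : Perm (Fin d)) (μ : YoungDiagram) : Prop :=
  σ.partition.parts = (μ.rowLens : Multiset ℕ)

theorem rowLens_sum (μ : YoungDiagram) : μ.rowLens.sum = μ.card := by
  have h1 : μ.rowLens.sum = ∑ i ∈ Finset.range (μ.colLen 0), μ.rowLen i := by
    rw [YoungDiagram.rowLens, Finset.sum_range, ← List.sum_ofFn]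
    congr 1
    apply List.ext_getElem <;> simp
  have h2 : ∀ c ∈ μ.cells, c.1 ∈ Finset.range (μ.colLen 0) := by
    rintro ⟨i, j⟩ hc
    rw [Finset.mem_range, ← YoungDiagram.mem_iff_lt_colLen]
    exact μ.up_left_mem le_rfl (Nat.zero_le _) hc
  rw [h1, YoungDiagram.card, Finset.card_eq_sum_card_fiberwise h2]
  refine Finset.sum_congr rfl fun i _ => ?_
  rw [YoungDiagram.rowLen_eq_card]
  rfl

theorem HasType.card_eq {d : ℕ} {σ : Perm (Fin d)} {μ : YoungDiagram} (h : HasType σ μ) :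
    μ.card = d := by
  have h1 := σ.partition.parts_sum
  rw [HasType] at h
  rw [h, Multiset.sum_coe, rowLens_sum, Fintype.card_fin] at h1
  exact h1

theorem rowLens_perm_injective {μ ν : YoungDiagram}
    (h : (μ.rowLens : Multiset ℕ) = (ν.rowLens : Multiset ℕ)) : μ = ν := by
  apply YoungDiagram.equivListRowLens.injective
  apply Subtype.ext
  exact (Multiset.coe_eq_coe.1 h).eq_of_sortedGE μ.rowLens_sorted ν.rowLens_sorted

theorem HasType.unique {d : ℕ} {σ : Perm (Fin d)} {μ ν : YoungDiagram}
    (h : HasType σ μ) (h' : HasType σ ν) : μ = ν :=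
  rowLens_perm_injective (h.symm.trans h')

theorem exists_type {d : ℕ} (σ : Perm (Fin d)) : ∃ μ, HasType σ μ := by
  refine ⟨YoungDiagram.ofRowLens (σ.partition.parts.sort (· ≥ ·))
    (Multiset.pairwise_sort _ _).sortedGE, ?_⟩
  rw [HasType, YoungDiagram.rowLens_ofRowLens_eq_self, Multiset.sort_eq]
  intro x hx
  exact σ.partition.parts_pos ((Multiset.mem_sort _).1 hx)

theorem exists_hasType (μ : YoungDiagram) : ∃ σ : Perm (Fin μ.card), HasType σ μ := by
  let p : (Fintype.card (Fin μ.card)).Partition :=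
    { parts := μ.rowLens
      parts_pos := fun hi => μ.pos_of_mem_rowLens _ hi
      parts_sum := by rw [Multiset.sum_coe, rowLens_sum, Fintype.card_fin] }
  obtain ⟨σ, hσ⟩ := (Equiv.Perm.exists_with_cycleType_iff (Fin μ.card)
    (m := p.parts.filter fun n => 2 ≤ n)).2 ⟨by
      calc (p.parts.filter fun n => 2 ≤ n).sum ≤ p.parts.sum :=
            (by
              conv_rhs => rw [← Multiset.filter_add_not (fun n => 2 ≤ n) p.parts, Multiset.sum_add]
              exact Nat.le_add_right _ _)
        _ = _ := p.parts_sum, fun a ha => (Multiset.mem_filter.1 ha).2⟩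
  refine ⟨σ, ?_⟩
  have h1 : p.parts.filter (fun n => ¬ 2 ≤ n) =
      Multiset.replicate (p.parts.filter fun n => ¬ 2 ≤ n).card 1 := by
    refine Multiset.eq_replicate_card.2 fun b hb => ?_
    have hb' := Multiset.mem_filter.1 hb
    have := p.parts_pos hb'.1
    omega
  have h2 : (p.parts.filter fun n => 2 ≤ n).sum + (p.parts.filter fun n => ¬ 2 ≤ n).card =
      Fintype.card (Fin μ.card) := by
    have h3 := p.parts_sum
    rw [← Multiset.filter_add_not (fun n => 2 ≤ n) p.parts, Multiset.sum_add, h1,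
      Multiset.sum_replicate, smul_eq_mul, mul_one] at h3
    exact h3
  have h4 : Fintype.card (Fin μ.card) - σ.support.card =
      (p.parts.filter fun n => ¬ 2 ≤ n).card := by
    rw [← Perm.sum_cycleType, hσ]
    omega
  rw [HasType, Perm.parts_partition, h4, hσ, ← h1, Multiset.filter_add_not]

/-- A permutation of cycle type `μ`. -/
def rep (μ : YoungDiagram) : Perm (Fin μ.card) := (exists_hasType μ).choose

theorem rep_hasType (μ : YoungDiagram) : HasType (rep μ) μ := (exists_hasType μ).choose_spec

theorem HasType.isConj {d : ℕ} {σ τ : Perm (Fin d)} {μ : YoungDiagram}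
    (h : HasType σ μ) (h' : HasType τ μ) : IsConj σ τ :=
  Perm.partition_eq_of_isConj.2 (Nat.Partition.ext (h.trans h'.symm))

theorem HasType.of_isConj {d : ℕ} {σ τ : Perm (Fin d)} {μ : YoungDiagram}
    (h : HasType σ μ) (hc : IsConj σ τ) : HasType τ μ := by
  rw [HasType, ← Perm.partition_eq_of_isConj.1 hc]
  exact h

open Classical in
/-- The set of permutations in `S(d)` of cycle type `μ`; it is empty unless `|μ| = d`. -/
def conjClass (d : ℕ) (μ : YoungDiagram) : Finset (Perm (Fin d)) :=
  Finset.univ.filter fun σ => HasType σ μ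

theorem mem_conjClass {d : ℕ} {μ : YoungDiagram} {σ : Perm (Fin d)} :
    σ ∈ conjClass d μ ↔ HasType σ μ := by
  simp [conjClass]

/-- The sum in the group algebra of all permutations of cycle type `μ`. -/
def classSumAux (d : ℕ) (μ : YoungDiagram) : GroupAlg d :=
  ∑ σ ∈ conjClass d μ, MonoidAlgebra.single σ 1

open Classical in
theorem coeff_classSumAux (d : ℕ) (μ : YoungDiagram) (σ : Perm (Fin d)) :
    (classSumAux d μ).coeff σ = if HasType σ μ then 1 else 0 := by
  simp [classSumAux, Finsupp.single_apply, mem_conjClass]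

theorem mem_classAlg_iff {d : ℕ} (z : GroupAlg d) :
    z ∈ ClassAlg d ↔ ∀ σ τ : Perm (Fin d), z.coeff (τ * σ * τ⁻¹) = z.coeff σ := by
  rw [Subalgebra.mem_center_iff]
  constructor
  · intro h σ τ
    have h1 := congrArg (fun w : GroupAlg d => w.coeff (τ * σ)) (h (MonoidAlgebra.single τ 1))
    simpa using h1.symm
  · intro h b
    induction b using MonoidAlgebra.induction_linear with
    | zero => simp
    | add x y hx hy => rw [add_mul, mul_add, hx, hy]
    | single τ r =>
      ext σ
      have h1 := h (τ⁻¹ * σ) τ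
      rw [MonoidAlgebra.coeff_single_mul_apply, MonoidAlgebra.coeff_mul_single_apply, ← h1,
        mul_inv_cancel_left, mul_comm]

/-- The conjugacy class `C_μ` as an element of the class algebra `Z(d)`, `d = |μ|`. -/
def classSum (d : ℕ) (μ : YoungDiagram) : ClassAlg d :=
  ⟨classSumAux d μ, by
    classical
    rw [mem_classAlg_iff]
    intro σ τ
    rw [coeff_classSumAux, coeff_classSumAux]
    congr 1
    have hc : IsConj σ (τ * σ * τ⁻¹) := isConj_iff.2 ⟨τ, rfl⟩
    exact propext ⟨fun h => h.of_isConj hc.symm, fun h => h.of_isConj hc⟩⟩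

/-- `C_μ` as an element of the direct sum of the class algebras. -/
def C (μ : YoungDiagram) : TotalClassAlg :=
  DirectSum.of (fun d => ClassAlg d) μ.card (classSum μ.card μ)

open Classical in
theorem coeff_C (μ ν : YoungDiagram) :
    ((C ν μ.card : ClassAlg μ.card) : GroupAlg μ.card).coeff (rep μ) = if ν = μ then 1 else 0 := by
  have key : ∀ (d e : ℕ) (σ : Perm (Fin e)), HasType σ μ → ν.card = d →
      ((DirectSum.of (fun d => ClassAlg d) d (classSum d ν) e : ClassAlg e) : GroupAlg e).coeff σ =
        if ν = μ then 1 else 0 := by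
    intro d e σ hσ hd
    by_cases hde : d = e
    · subst hde
      rw [DirectSum.of_eq_same]
      refine (coeff_classSumAux d ν σ).trans ?_
      congr 1
      exact propext ⟨fun h => h.unique hσ, fun h => h ▸ hσ⟩
    · rw [DirectSum.of_eq_of_ne _ _ _ (Ne.symm hde), if_neg]
      · rfl
      · rintro rfl
        exact hde (hd.symm.trans hσ.card_eq)
  exact key _ _ _ (rep_hasType μ) rfl

/-- The coefficient of `C_μ`, read off at a permutation of cycle type `μ`. -/
def coefAt (μ : YoungDiagram) : TotalClassAlg →+ ℚ where
  toFun x := ((x μ.card : ClassAlg μ.card) : GroupAlg μ.card).coeff (rep μ)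
  map_zero' := rfl
  map_add' _ _ := rfl

theorem C_linearIndependent : LinearIndependent ℚ C := by
  classical
  intro a b hab
  have hcoef : ∀ (a : YoungDiagram →₀ ℚ) (μ : YoungDiagram),
      coefAt μ (Finsupp.linearCombination ℚ C a) = a μ := by
    intro a μ
    rw [Finsupp.linearCombination_apply, Finsupp.sum, map_sum]
    have h1 : ∀ ν, coefAt μ (a ν • C ν) = a ν * if ν = μ then 1 else 0 := fun ν =>
      congrArg (a ν * ·) (coeff_C μ ν)
    simp only [h1]
    simp [eq_comm]
  ext μ
  rw [← hcoef a μ, hab, hcoef b μ]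

theorem C_span : ⊤ ≤ Submodule.span ℚ (Set.range C) := by
  classical
  intro x _
  induction x using DirectSum.induction_on with
  | zero => exact Submodule.zero_mem _
  | add x y hx hy => exact Submodule.add_mem _ (hx trivial) (hy trivial)
  | of d z =>
    choose ty hty using fun σ : Perm (Fin d) => exists_type σ
    have hz := (mem_classAlg_iff (z : GroupAlg d)).1 z.2
    let val : YoungDiagram → ℚ := fun μ =>
      if h : ∃ σ : Perm (Fin d), HasType σ μ then (z : GroupAlg d).coeff h.choose else 0
    have hval : ∀ σ, val (ty σ) = (z : GroupAlg d).coeff σ := by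
      intro σ
      have hex : ∃ τ : Perm (Fin d), HasType τ (ty σ) := ⟨σ, hty σ⟩
      have h1 : val (ty σ) = (z : GroupAlg d).coeff hex.choose := dif_pos hex
      obtain ⟨τ, hτ⟩ := isConj_iff.1 ((hty σ).isConj hex.choose_spec)
      rw [h1, ← hτ, hz]
    have hsum : z = ∑ μ ∈ Finset.univ.image ty, val μ • classSum d μ := by
      apply Subtype.ext
      ext σ
      simp only [AddSubmonoidClass.coe_finsetSum, Subalgebra.coe_smul, MonoidAlgebra.coeff_sum,
        MonoidAlgebra.coeff_smul, Finsupp.finsetSum_apply, Finsupp.smul_apply]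
      rw [Finset.sum_eq_single (ty σ)]
      · have h1 : ((classSum d (ty σ) : ClassAlg d) : GroupAlg d).coeff σ = 1 := by
          refine (coeff_classSumAux d _ σ).trans (if_pos (hty σ))
        rw [h1, hval, smul_eq_mul, mul_one]
      · intro μ _ hμ
        have h1 : ((classSum d μ : ClassAlg d) : GroupAlg d).coeff σ = 0 :=
          (coeff_classSumAux d _ σ).trans (if_neg fun h => hμ (h.unique (hty σ)))
        rw [h1, smul_zero]
      · intro h
        exact absurd (Finset.mem_image_of_mem ty (Finset.mem_univ σ)) h
    have hof : DirectSum.of (fun d => ClassAlg d) d z =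
        ∑ μ ∈ Finset.univ.image ty, val μ • DirectSum.lof ℚ ℕ (fun d => ClassAlg d) d
          (classSum d μ) := by
      conv_lhs => rw [hsum]
      rw [← DirectSum.lof_eq_of ℚ, map_sum]
      simp only [map_smul]
    rw [hof]
    refine Submodule.sum_mem _ fun μ hμ => Submodule.smul_mem _ _ (Submodule.subset_span ⟨μ, ?_⟩)
    obtain ⟨σ, _, rfl⟩ := Finset.mem_image.1 hμ
    have hd := (hty σ).card_eq
    have key : ∀ e, e = d → ∀ μ, DirectSum.of (fun d => ClassAlg d) e (classSum e μ) =
        DirectSum.lof ℚ ℕ (fun d => ClassAlg d) d (classSum d μ) := by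
      rintro e rfl μ
      rfl
    exact key _ hd _

/-- The elements `C_μ`, over all partitions `μ`, form a basis of the sum of the class algebras. -/
def classBasis : Module.Basis YoungDiagram ℚ TotalClassAlg :=
  Module.Basis.mk C_linearIndependent C_span

theorem classBasis_apply (μ : YoungDiagram) : classBasis μ = C μ :=
  Module.Basis.mk_apply _ _ _

/-! ### Irreducible representations of the symmetric groups -/

/-- A tableau of shape `μ`: a numbering of the cells. -/
def tableau (μ : YoungDiagram) : Fin μ.card ≃ μ.cells := μ.cells.equivFin.symm

open Classical in
/-- Permutations of the entries of the tableau that preserve every row. -/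
def rowStabilizer (μ : YoungDiagram) : Finset (Perm (Fin μ.card)) :=
  Finset.univ.filter fun σ => ∀ i, (tableau μ (σ i)).1.1 = (tableau μ i).1.1

open Classical in
/-- Permutations of the entries of the tableau that preserve every column. -/
def colStabilizer (μ : YoungDiagram) : Finset (Perm (Fin μ.card)) :=
  Finset.univ.filter fun σ => ∀ i, (tableau μ (σ i)).1.2 = (tableau μ i).1.2

/-- The Young symmetrizer of the tableau. -/
def youngSymmetrizer (μ : YoungDiagram) : GroupAlg μ.card :=
  (∑ p ∈ rowStabilizer μ, MonoidAlgebra.single p 1) *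
    ∑ q ∈ colStabilizer μ, MonoidAlgebra.single q ((Perm.sign q : ℤ) : ℚ)

/-- The irreducible (Specht) module of `S(d)`, `d = |μ|`, indexed by `μ`: the left ideal of the
group algebra generated by the Young symmetrizer. -/
abbrev specht (μ : YoungDiagram) : Submodule (GroupAlg μ.card) (GroupAlg μ.card) :=
  Submodule.span (GroupAlg μ.card) {youngSymmetrizer μ}

/-- The irreducible representation of `S(d)`, `d = |μ|`, on the Specht module. -/
def spechtRep (μ : YoungDiagram) : Representation ℚ (Perm (Fin μ.card)) (specht μ) :=
  ((Algebra.lsmul ℚ ℚ (specht μ) : GroupAlg μ.card →ₐ[ℚ] Module.End ℚ (specht μ)) :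
    GroupAlg μ.card →* Module.End ℚ (specht μ)).comp (MonoidAlgebra.of ℚ (Perm (Fin μ.card)))

/-- The dimension of the irreducible representation indexed by `μ`. -/
def dim (μ : YoungDiagram) : ℕ := Module.finrank ℚ (specht μ)

/-- The value `χ^lam_η` of the irreducible character indexed by `lam` on a permutation of cycle
type `η`, viewed in `S(|lam|)` through the inclusion `S(|η|) ⊆ S(|lam|)`; it is put to `0` for
`|η| > |lam|`. -/
def chi (lam η : YoungDiagram) : ℚ :=
  if h : η.card ≤ lam.card then
    (spechtRep lam).character ((rep η).viaFintypeEmbedding (Fin.castLEEmb h))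
  else 0

/-- The normalized character `f_η(lam) = binom(|lam|, |η|) |C_η| χ^lam_η / dim lam`. -/
def f (η lam : YoungDiagram) : ℚ :=
  (lam.card.choose η.card : ℚ) * ((conjClass η.card η).card : ℚ) * (chi lam η / (dim lam : ℚ))

/-- The extended Fourier transform: the linear map with `C_μ ↦ f_μ`. -/
def phi : TotalClassAlg →ₗ[ℚ] (YoungDiagram → ℚ) := classBasis.constr ℚ f

/-! ### Shifted symmetric power sums -/

theorem exists_rat_zeta (k : ℕ) : ∃ q : ℚ, (q : ℂ) = riemannZeta (-(k : ℂ)) :=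
  ⟨(-1) ^ k * bernoulli (k + 1) / (k + 1), by
    rw [riemannZeta_neg_nat_eq_bernoulli]; push_cast; rfl⟩

/-- The rational number `ζ(-k)`. -/
def zetaNeg (k : ℕ) : ℚ := (exists_rat_zeta k).choose

theorem zetaNeg_spec (k : ℕ) : (zetaNeg k : ℂ) = riemannZeta (-(k : ℂ)) :=
  (exists_rat_zeta k).choose_spec

/-- The shifted symmetric power sum
`p_k(lam) = ∑_{i ≥ 1} [(lam_i - i + 1/2)^k - (-i + 1/2)^k] + (1 - 2^{-k}) ζ(-k)`.
The summands with `i > ℓ(lam)` vanish, and `lam_i` is `lam.rowLen (i - 1)`. -/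
def p (k : ℕ) (lam : YoungDiagram) : ℚ :=
  ∑ i ∈ Finset.Icc 1 (lam.colLen 0),
    (((lam.rowLen (i - 1) : ℚ) - (i : ℚ) + 1 / 2) ^ k - (-(i : ℚ) + 1 / 2) ^ k) +
  (1 - 1 / 2 ^ k) * zetaNeg k

/-! ### The series `S` -/

/-- The series `S(z) = sinh(z/2) / (z/2) = ∑_m z^{2m} / (2^{2m} (2m+1)!)`. -/
def S : PowerSeries ℚ :=
  PowerSeries.mk fun n => if Even n then 1 / (2 ^ n * ((n + 1).factorial : ℚ)) else 0

/-- The series `S(z)^{d-1} ∏ S(μ_i z)` with `d = |μ|`; the exponent is `-1` for `μ = ∅`. -/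
def rhoSeries (μ : YoungDiagram) : PowerSeries ℚ :=
  S ^ μ.card * S⁻¹ * (μ.rowLens.map fun m => PowerSeries.rescale (m : ℚ) S).prod

end CompletedCycles

end

/-!
The value `f_η(lam)` is the central character, on the Specht module of `lam`, of the sum of all
pairs `(A, σ)` with `A ⊆ {1, …, d}` and `σ` a permutation of `A` of cycle type `η`, where
`d = |lam|` (`f_eq_centralChar`). Central characters are computed by letting a central element `z`
act on the Young symmetrizer `c`: von Neumann's lemma gives `z c = κ c` for a scalar `κ`, and the
trace of `z` on the Specht module is `κ` times the dimension.

The function `p_k` comes from the Jucys–Murphy elements `X_j = ∑_{i < j} (i j)`. The power sums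
`∑_j X_j ^ m` are central, and act on the Specht module by the power sums `∑ (j - i) ^ m` of the
contents of the cells `(i, j)` of `lam` (`centralChar_jmPowerSum`). Telescoping along the
rows expresses `p_k(lam)`, up to its constant term, through these power sums (`p_eq`): without
the constant terms, `∑_k p_k(lam) z ^ k / k!` is `ς(z) ∑ e ^ (z (j - i))`, where
`ς(z) = e ^ (z/2) - e ^ (-z/2)`.

On the side of permutations, `X_j ^ m` is expanded over the pairs `(A, σ)` (`jucysMurphy_pow`).
The coefficient of `(A, σ)` in `∑_j e ^ (z X_j)` turns out to be
`ς(z) ^ (|A| - 2) / |A|! ∏ ς(c z)`, the product being over the lengths `c` of the cycles of `σ`.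
Multiplication by one more transposition cuts a cycle or joins two (`cycleProd_cut`,
`cycleProd_join`), so the claim amounts to a differential equation for these weights
(`derivative_weightSeries`), which is an instance of the addition theorem of `sinh`. Reading off
the coefficient of `z ^ k` gives the stated coefficients, since `ς(z) = z S(z)`; the empty
partition contributes the series `1 / ς(z)`, whose coefficients are Bernoulli numbers and match
the values of the zeta function (`phi_completedCycle`).

For uniqueness (`phi_injective`), the content power sums separate the diagrams with `d` cells, so
the central characters of `Z(d)` give all functions on these diagrams, and the square matrix
`f_η(lam)` with `|η| = |lam| = d` is invertible. As `f_η(lam) = 0` for `|η| > |lam|`, the map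
`phi` is triangular with invertible diagonal blocks.
-/

set_option linter.unusedSectionVars false

noncomputable section

namespace CompletedCycles

open Equiv

/-! ### Group algebras of permutations -/

section PermAlg

variable {α : Type*} [Fintype α] [DecidableEq α]

/-- The rational group algebra of the permutations of `α`. -/
abbrev PermAlg (α : Type*) : Type _ := MonoidAlgebra ℚ (Perm α)

theorem coeff_mul_eq_sum (x y : PermAlg α) (g : Perm α) :
    (x * y).coeff g = ∑ h, x.coeff h * y.coeff (h⁻¹ * g) := by
  rw [MonoidAlgebra.coeff_mul_apply_left, Finsupp.sum_fintype]
  simp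

theorem eq_sum_single (x : PermAlg α) : x = ∑ σ, MonoidAlgebra.single σ (x.coeff σ) := by
  ext τ
  simp [MonoidAlgebra.coeff_sum]

/-- The anti-automorphism of the group algebra given by inversion of permutations. -/
def rev (x : PermAlg α) : PermAlg α := ∑ σ, MonoidAlgebra.single σ (x.coeff σ⁻¹)

@[simp]
theorem coeff_rev (x : PermAlg α) (σ : Perm α) : (rev x).coeff σ = x.coeff σ⁻¹ := by
  simp [rev, MonoidAlgebra.coeff_sum, Finsupp.single_apply]

theorem rev_mul (x y : PermAlg α) : rev (x * y) = rev y * rev x := by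
  ext g
  simp only [coeff_rev, coeff_mul_eq_sum, mul_inv_rev, inv_inv]
  refine Fintype.sum_equiv (Equiv.mulLeft g) _ _ fun k => ?_
  simp [mul_comm]

/-- The standard trace form of the group algebra is positive definite. -/
theorem mul_rev_ne_zero {x : PermAlg α} (hx : x ≠ 0) : x * rev x ≠ 0 := by
  intro h
  apply hx
  have h1 : (x * rev x).coeff 1 = 0 := by rw [h]; rfl
  rw [coeff_mul_eq_sum] at h1
  ext σ
  have h2 := (Finset.sum_eq_zero_iff_of_nonneg (fun h _ => by
    simpa using mul_self_nonneg (x.coeff h))).1 h1 σ (Finset.mem_univ _)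
  simpa using h2

/-- The sum of a subgroup, twisted by a multiplicative character. -/
def charSum (K : Subgroup (Perm α)) (ε : Perm α →* ℚ) : PermAlg α :=
  open Classical in ∑ σ with σ ∈ K, MonoidAlgebra.single σ (ε σ)

open Classical in
theorem coeff_charSum (K : Subgroup (Perm α)) (ε : Perm α →* ℚ) (σ : Perm α) :
    (charSum K ε).coeff σ = if σ ∈ K then ε σ else 0 := by
  simp [charSum, MonoidAlgebra.coeff_sum, Finsupp.single_apply]

theorem hom_inv_mul (ε : Perm α →* ℚ) (σ : Perm α) : ε σ⁻¹ * ε σ = 1 := by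
  rw [← map_mul, inv_mul_cancel, map_one]

theorem single_mul_charSum {K : Subgroup (Perm α)} (ε : Perm α →* ℚ) {σ : Perm α} (h : σ ∈ K) :
    MonoidAlgebra.single σ (ε σ) * charSum K ε = charSum K ε := by
  classical
  ext τ
  rw [MonoidAlgebra.coeff_single_mul_apply, coeff_charSum, coeff_charSum]
  simp only [K.mul_mem_cancel_left (K.inv_mem h)]
  split_ifs
  · rw [← map_mul, mul_inv_cancel_left]
  · simp

theorem charSum_mul_single {K : Subgroup (Perm α)} (ε : Perm α →* ℚ) {σ : Perm α} (h : σ ∈ K) :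
    charSum K ε * MonoidAlgebra.single σ (ε σ) = charSum K ε := by
  classical
  ext τ
  rw [MonoidAlgebra.coeff_mul_single_apply, coeff_charSum, coeff_charSum]
  simp only [K.mul_mem_cancel_right (K.inv_mem h)]
  split_ifs
  · rw [← map_mul, inv_mul_cancel_right]
  · simp

theorem charSum_mul_charSum {K' K : Subgroup (Perm α)} (h : K' ≤ K) (ε : Perm α →* ℚ) :
    charSum K' ε * charSum K ε = (Nat.card K' : ℚ) • charSum K ε := by
  classical
  conv_lhs => rw [charSum, Finset.sum_mul]
  rw [Finset.sum_congr rfl fun σ hσ => single_mul_charSum ε (h (Finset.mem_filter.1 hσ).2),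
    Finset.sum_const, Nat.card_eq_fintype_card, Fintype.card_subtype, Nat.cast_smul_eq_nsmul]

theorem charSum_mul_charSum' {K' K : Subgroup (Perm α)} (h : K' ≤ K) (ε : Perm α →* ℚ) :
    charSum K ε * charSum K' ε = (Nat.card K' : ℚ) • charSum K ε := by
  classical
  conv_lhs => rw [charSum.eq_def K', Finset.mul_sum]
  rw [Finset.sum_congr rfl fun σ hσ => charSum_mul_single ε (h (Finset.mem_filter.1 hσ).2),
    Finset.sum_const, Nat.card_eq_fintype_card, Fintype.card_subtype, Nat.cast_smul_eq_nsmul]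

theorem card_subgroup_ne_zero (K : Subgroup (Perm α)) : (Nat.card K : ℚ) ≠ 0 :=
  Nat.cast_ne_zero.2 Nat.card_pos.ne'

theorem commute_charSum {K : Subgroup (Perm α)} {z : PermAlg α}
    (h : ∀ σ ∈ K, Commute z (MonoidAlgebra.single σ 1)) (ε : Perm α →* ℚ) :
    Commute z (charSum K ε) := by
  classical
  refine Commute.sum_right _ _ _ fun σ hσ => ?_
  have h1 : (MonoidAlgebra.single σ (ε σ) : PermAlg α) = ε σ • MonoidAlgebra.single σ 1 := by simp
  rw [h1]
  exact (h σ (Finset.mem_filter.1 hσ).2).smul_right _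

/-- The sign character with rational values. -/
def signHom (α : Type*) [Fintype α] [DecidableEq α] : Perm α →* ℚ :=
  (Int.castRingHom ℚ : ℤ →* ℚ).comp ((Units.coeHom ℤ).comp Perm.sign)

@[simp]
theorem signHom_apply (σ : Perm α) : signHom α σ = ((Perm.sign σ : ℤ) : ℚ) := rfl

theorem rev_charSum (K : Subgroup (Perm α)) {ε : Perm α →* ℚ} (hε : ∀ σ, ε σ⁻¹ = ε σ) :
    rev (charSum K ε) = charSum K ε := by
  classical
  ext σ
  rw [coeff_rev, coeff_charSum, coeff_charSum, hε]
  simp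

/-! ### Young symmetrizers of tableaux -/

/-- The permutations that fix every point outside `A`. -/
def supportedIn (A : Finset α) : Subgroup (Perm α) where
  carrier := {σ | ∀ x ∉ A, σ x = x}
  one_mem' _ _ := rfl
  mul_mem' := fun {σ τ} hσ hτ x hx => by rw [Perm.mul_apply, hτ x hx, hσ x hx]
  inv_mem' := fun {σ} hσ x hx => by rw [Perm.inv_eq_iff_eq, hσ x hx]

theorem supportedIn_mono {A B : Finset α} (h : A ⊆ B) : supportedIn A ≤ supportedIn B :=
  fun _ hσ x hx => hσ x fun hA => hx (h hA)

theorem apply_mem_iff {A : Finset α} {σ : Perm α} (h : σ ∈ supportedIn A) (x : α) :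
    σ x ∈ A ↔ x ∈ A := by
  constructor
  · intro hx
    by_contra hx'
    rw [h x hx'] at hx
    exact hx' hx
  · intro hx
    by_contra hx'
    have h1 : σ (σ x) = σ x := h _ hx'
    rw [σ.injective h1] at hx'
    exact hx' hx

theorem swap_mem_supportedIn {A : Finset α} {x y : α} (hx : x ∈ A) (hy : y ∈ A) :
    swap x y ∈ supportedIn A := by
  intro z hz
  exact swap_apply_of_ne_of_ne (fun h => hz (h ▸ hx)) fun h => hz (h ▸ hy)

/-- The permutations of the elements of `A` that preserve every fiber of `g`. -/
def fiberGroup (g : α → ℕ) (A : Finset α) : Subgroup (Perm α) where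
  carrier := {σ | σ ∈ supportedIn A ∧ ∀ x, g (σ x) = g x}
  one_mem' := ⟨one_mem _, fun _ => rfl⟩
  mul_mem' := fun {σ τ} hσ hτ => ⟨mul_mem hσ.1 hτ.1, fun x => by
    rw [Perm.mul_apply, hσ.2, hτ.2]⟩
  inv_mem' := fun {σ} hσ => ⟨inv_mem hσ.1, fun x => by
    rw [← hσ.2 (σ⁻¹ x), ← Perm.mul_apply, mul_inv_cancel, Perm.one_apply]⟩

theorem mem_fiberGroup {g : α → ℕ} {A : Finset α} {σ : Perm α} :
    σ ∈ fiberGroup g A ↔ σ ∈ supportedIn A ∧ ∀ x, g (σ x) = g x := Iff.rfl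

theorem fiberGroup_le (g : α → ℕ) (A : Finset α) : fiberGroup g A ≤ supportedIn A :=
  fun _ h => h.1

theorem fiberGroup_mono (g : α → ℕ) {A B : Finset α} (h : A ⊆ B) :
    fiberGroup g A ≤ fiberGroup g B :=
  fun _ hσ => ⟨supportedIn_mono h hσ.1, hσ.2⟩

theorem swap_mem_fiberGroup {g : α → ℕ} {A : Finset α} {x y : α} (hx : x ∈ A) (hy : y ∈ A)
    (h : g x = g y) : swap x y ∈ fiberGroup g A := by
  refine ⟨swap_mem_supportedIn hx hy, fun z => ?_⟩
  rcases eq_or_ne z x with rfl | hzx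
  · rw [swap_apply_left, h]
  rcases eq_or_ne z y with rfl | hzy
  · rw [swap_apply_right, h]
  rw [swap_apply_of_ne_of_ne hzx hzy]

/-- The placement `pos` of the elements of `A` in the cells of the quarter plane is a tableau:
it is injective, and the cells that are used form a lower set. -/
structure IsTableau (pos : α → ℕ × ℕ) (A : Finset α) : Prop where
  injOn : Set.InjOn pos A
  lower : ∀ x ∈ A, ∀ c ≤ pos x, ∃ y ∈ A, pos y = c

/-- The sum of the row stabilizer of the tableau on `A`. -/
def rowSum (pos : α → ℕ × ℕ) (A : Finset α) : PermAlg α :=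
  charSum (fiberGroup (fun x => (pos x).1) A) 1

/-- The signed sum of the column stabilizer of the tableau on `A`. -/
def colSum (pos : α → ℕ × ℕ) (A : Finset α) : PermAlg α :=
  charSum (fiberGroup (fun x => (pos x).2) A) (signHom α)

/-- The Young symmetrizer of the tableau on `A`. -/
def symmetrizer (pos : α → ℕ × ℕ) (A : Finset α) : PermAlg α := rowSum pos A * colSum pos A

theorem IsTableau.eq_one {pos : α → ℕ × ℕ} {A : Finset α} (hA : IsTableau pos A) {σ : Perm α}
    (hr : σ ∈ fiberGroup (fun x => (pos x).1) A) (hc : σ ∈ fiberGroup (fun x => (pos x).2) A) :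
    σ = 1 := by
  ext x
  by_cases hx : x ∈ A
  · exact hA.injOn ((apply_mem_iff hr.1 x).2 hx) hx (Prod.ext (hr.2 x) (hc.2 x))
  · exact hr.1 x hx

theorem IsTableau.coeff_symmetrizer_one {pos : α → ℕ × ℕ} {A : Finset α} (hA : IsTableau pos A) :
    (symmetrizer pos A).coeff 1 = 1 := by
  classical
  rw [symmetrizer, rowSum, colSum, coeff_mul_eq_sum, Finset.sum_eq_single 1]
  · simp [coeff_charSum, one_mem]
  · intro σ _ hσ
    rw [coeff_charSum, coeff_charSum]
    split_ifs with h1 h2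
    · rw [mul_one, inv_mem_iff] at h2
      exact absurd (hA.eq_one h1 h2) hσ
    · simp
    · simp
    · simp
  · simp

theorem IsTableau.symmetrizer_ne_zero {pos : α → ℕ × ℕ} {A : Finset α} (hA : IsTableau pos A) :
    symmetrizer pos A ≠ 0 := by
  intro h
  have h1 := hA.coeff_symmetrizer_one
  rw [h] at h1
  exact zero_ne_one h1

theorem rowSum_mul_self (pos : α → ℕ × ℕ) (A : Finset α) :
    rowSum pos A * rowSum pos A =
      (Nat.card (fiberGroup (fun x => (pos x).1) A) : ℚ) • rowSum pos A :=
  charSum_mul_charSum le_rfl _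

theorem colSum_mul_self (pos : α → ℕ × ℕ) (A : Finset α) :
    colSum pos A * colSum pos A =
      (Nat.card (fiberGroup (fun x => (pos x).2) A) : ℚ) • colSum pos A :=
  charSum_mul_charSum le_rfl _

/-- A Young symmetrizer `a b` does not square to zero: otherwise `a b a = 0`, since
`(a b a) (a b a)^* = |R| a b a b a`, and then `a b = 0`, since `(a b) (a b)^* = |C| a b a`. -/
theorem IsTableau.symmetrizer_sq_ne_zero {pos : α → ℕ × ℕ} {A : Finset α}
    (hA : IsTableau pos A) : symmetrizer pos A * symmetrizer pos A ≠ 0 := by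
  have hra : rev (rowSum pos A) = rowSum pos A := rev_charSum _ fun _ => rfl
  have hrb : rev (colSum pos A) = colSum pos A := rev_charSum _ fun σ => by simp
  have h1 := mul_rev_ne_zero hA.symmetrizer_ne_zero
  have h2 : rowSum pos A * colSum pos A * rowSum pos A ≠ 0 := by
    intro h
    apply h1
    rw [symmetrizer, rev_mul, hra, hrb,
      show ∀ a b : PermAlg α, a * b * (b * a) = a * (b * b) * a from fun a b => by
        simp only [mul_assoc], colSum_mul_self, mul_smul_comm, smul_mul_assoc, h, smul_zero]
  have h3 := mul_rev_ne_zero h2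
  intro h
  apply h3
  have h4 : ∀ a b : PermAlg α, a * b * a * (a * (b * a)) = a * b * (a * a) * (b * a) :=
    fun a b => by simp only [mul_assoc]
  have h5 : ∀ a b : PermAlg α, a * b * a * (b * a) = (a * b) * (a * b) * a :=
    fun a b => by simp only [mul_assoc]
  rw [rev_mul, rev_mul, hra, hrb, h4, rowSum_mul_self, mul_smul_comm, smul_mul_assoc, h5,
    ← symmetrizer, h, zero_mul, smul_zero]

/-! ### Von Neumann's lemma -/

theorem eq_range_card_of_lower {s : Finset ℕ} (h : ∀ x ∈ s, ∀ y ≤ x, y ∈ s) :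
    s = Finset.range s.card := by
  refine Finset.eq_of_subset_of_card_le (fun x hx => ?_) (by simp)
  have h1 : Finset.range (x + 1) ⊆ s := fun y hy =>
    h x hx y (Nat.lt_succ_iff.1 (Finset.mem_range.1 hy))
  have h2 := Finset.card_le_card h1
  rw [Finset.card_range] at h2
  exact Finset.mem_range.2 h2

/-- Among the sets of `n` natural numbers, `{0, …, n - 1}` alone has the smallest sum. -/
theorem sum_range_card_le (s : Finset ℕ) :
    ∑ i ∈ Finset.range s.card, i ≤ ∑ i ∈ s, i ∧
      (∑ i ∈ Finset.range s.card, i = ∑ i ∈ s, i → s = Finset.range s.card) := by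
  set n := s.card with hn
  have hc : (Finset.range n \ s).card = (s \ Finset.range n).card := by
    have h1 := Finset.card_sdiff_add_card_inter (Finset.range n) s
    have h2 := Finset.card_sdiff_add_card_inter s (Finset.range n)
    rw [Finset.inter_comm, Finset.card_range] at h1
    omega
  have h1 : ∑ i ∈ Finset.range n \ s, i ≤ (Finset.range n \ s).card * n := by
    rw [← smul_eq_mul]
    exact Finset.sum_le_card_nsmul _ _ _ fun i hi =>
      (Finset.mem_range.1 (Finset.mem_sdiff.1 hi).1).le
  have h2 : (s \ Finset.range n).card * n ≤ ∑ i ∈ s \ Finset.range n, i := by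
    rw [← smul_eq_mul]
    exact Finset.card_nsmul_le_sum _ _ _ fun i hi =>
      not_lt.1 fun h => (Finset.mem_sdiff.1 hi).2 (Finset.mem_range.2 h)
  have h3 := Finset.sum_inter_add_sum_sdiff (Finset.range n) s (fun i => i)
  have h4 := Finset.sum_inter_add_sum_sdiff s (Finset.range n) (fun i => i)
  rw [Finset.inter_comm] at h3
  rw [hc] at h1
  refine ⟨by omega, fun h => ?_⟩
  by_contra hne
  have hne' : (Finset.range n \ s).Nonempty := by
    rw [Finset.sdiff_nonempty]
    intro hsub
    exact hne (Finset.eq_of_subset_of_card_le hsub (by simp [hn])).symm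
  have h5 : ∑ i ∈ Finset.range n \ s, i < ∑ i ∈ Finset.range n \ s, n :=
    Finset.sum_lt_sum_of_nonempty hne' fun i hi => Finset.mem_range.1 (Finset.mem_sdiff.1 hi).1
  rw [Finset.sum_const, smul_eq_mul, hc] at h5
  omega

/-- If no two elements of a column are moved by `σ` to the same row, then every row that `σ`
assigns to an element of a column meets that column. Both `σ` and the identity fill each column
with as many distinct rows, the identity with the smallest possible ones, and the two sums of all
row indices agree. -/
theorem IsTableau.exists_cell {pos : α → ℕ × ℕ} {A : Finset α} (hA : IsTableau pos A)
    {σ : Perm α} (hσ : σ ∈ supportedIn A)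
    (h : ∀ x ∈ A, ∀ y ∈ A, (pos x).2 = (pos y).2 → (pos (σ x)).1 = (pos (σ y)).1 → x = y)
    {x : α} (hx : x ∈ A) :
    ∃ y ∈ A, (pos y).1 = (pos (σ x)).1 ∧ (pos y).2 = (pos x).2 := by
  set col : ℕ → Finset α := fun j => A.filter fun x => (pos x).2 = j with hcol
  have hinj : ∀ j, Set.InjOn (fun x => (pos (σ x)).1) (col j) := by
    intro j x hx y hy hxy
    have hx' := Finset.mem_filter.1 hx
    have hy' := Finset.mem_filter.1 hy
    exact h x hx'.1 y hy'.1 (hx'.2.trans hy'.2.symm) hxy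
  have hinj' : ∀ j, Set.InjOn (fun x => (pos x).1) (col j) := by
    intro j x hx y hy hxy
    have hx' := Finset.mem_filter.1 hx
    have hy' := Finset.mem_filter.1 hy
    exact hA.injOn hx'.1 hy'.1 (Prod.ext hxy (hx'.2.trans hy'.2.symm))
  have hrows : ∀ j, (col j).image (fun x => (pos x).1) = Finset.range (col j).card := by
    intro j
    rw [← Finset.card_image_of_injOn (hinj' j)]
    refine eq_range_card_of_lower fun r hr r' hr' => ?_
    obtain ⟨x, hx, rfl⟩ := Finset.mem_image.1 hr
    have hx' := Finset.mem_filter.1 hx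
    obtain ⟨y, hy, hy'⟩ := hA.lower x hx'.1 (r', j) ⟨hr', hx'.2.ge⟩
    exact Finset.mem_image.2 ⟨y, Finset.mem_filter.2 ⟨hy, by rw [hy']⟩, by rw [hy']⟩
  have hle : ∀ j, ∑ x ∈ col j, (pos x).1 ≤ ∑ x ∈ col j, (pos (σ x)).1 := by
    intro j
    have h1 := (sum_range_card_le ((col j).image fun x => (pos (σ x)).1)).1
    rw [Finset.card_image_of_injOn (hinj j), ← hrows, Finset.sum_image (hinj' j),
      Finset.sum_image (hinj j)] at h1
    exact h1
  have htot : ∑ j ∈ A.image (fun x => (pos x).2), ∑ x ∈ col j, (pos x).1 =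
      ∑ j ∈ A.image (fun x => (pos x).2), ∑ x ∈ col j, (pos (σ x)).1 := by
    rw [Finset.sum_fiberwise_of_maps_to fun x hx => Finset.mem_image_of_mem _ hx,
      Finset.sum_fiberwise_of_maps_to fun x hx => Finset.mem_image_of_mem _ hx]
    exact (Finset.sum_equiv σ (fun x => (apply_mem_iff hσ x).symm) fun _ _ => rfl).symm
  have heq := (Finset.sum_eq_sum_iff_of_le fun j _ => hle j).1 htot (pos x).2
    (Finset.mem_image_of_mem _ hx)
  have hset : (col (pos x).2).image (fun y => (pos (σ y)).1) =
      (col (pos x).2).image (fun y => (pos y).1) := by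
    have h1 := (sum_range_card_le ((col (pos x).2).image fun y => (pos (σ y)).1)).2
    rw [Finset.card_image_of_injOn (hinj _), ← hrows, Finset.sum_image (hinj' _),
      Finset.sum_image (hinj _)] at h1
    exact h1 heq
  have hmem : (pos (σ x)).1 ∈ (col (pos x).2).image (fun y => (pos (σ y)).1) :=
    Finset.mem_image.2 ⟨x, Finset.mem_filter.2 ⟨hx, rfl⟩, rfl⟩
  rw [hset] at hmem
  obtain ⟨y, hy, hy'⟩ := Finset.mem_image.1 hmem
  exact ⟨y, (Finset.mem_filter.1 hy).1, hy', (Finset.mem_filter.1 hy).2⟩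

/-- A permutation that moves no two elements of a column to the same row is the product of a row
permutation and a column permutation: the column permutation brings each element to the row in
which `σ` wants it, within its own column. -/
theorem IsTableau.exists_eq_mul {pos : α → ℕ × ℕ} {A : Finset α} (hA : IsTableau pos A)
    {σ : Perm α} (hσ : σ ∈ supportedIn A)
    (h : ∀ x ∈ A, ∀ y ∈ A, (pos x).2 = (pos y).2 → (pos (σ x)).1 = (pos (σ y)).1 → x = y) :
    ∃ r ∈ fiberGroup (fun x => (pos x).1) A, ∃ c ∈ fiberGroup (fun x => (pos x).2) A,
      σ = r * c := by
  have hex : ∀ x, ∃ y, (x ∈ A → y ∈ A ∧ (pos y).1 = (pos (σ x)).1 ∧ (pos y).2 = (pos x).2) ∧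
      (x ∉ A → y = x) := by
    intro x
    by_cases hx : x ∈ A
    · obtain ⟨y, hy⟩ := hA.exists_cell hσ h hx
      exact ⟨y, fun _ => hy, fun h => absurd hx h⟩
    · exact ⟨x, fun h => absurd h hx, fun _ => rfl⟩
  choose q hq hq' using hex
  have hinj : Function.Injective q := by
    intro x y hxy
    by_cases hx : x ∈ A <;> by_cases hy : y ∈ A
    · refine h x hx y hy ?_ ?_
      · rw [← (hq x hx).2.2, hxy, (hq y hy).2.2]
      · rw [← (hq x hx).2.1, hxy, (hq y hy).2.1]
    · exact absurd (hq' y hy ▸ hxy ▸ (hq x hx).1) hy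
    · exact absurd (hq' x hx ▸ hxy ▸ (hq y hy).1) hx
    · rw [← hq' x hx, hxy, hq' y hy]
  set c : Perm α := Equiv.ofBijective q (Finite.injective_iff_bijective.1 hinj) with hc
  have hcq : ∀ x, c x = q x := fun _ => rfl
  have hcA : c ∈ supportedIn A := fun x hx => hq' x hx
  refine ⟨σ * c⁻¹, ⟨mul_mem hσ (inv_mem hcA), fun x => ?_⟩, c, ⟨hcA, fun x => ?_⟩, by simp⟩
  · obtain ⟨y, rfl⟩ := c.surjective x
    have h1 : (σ * c⁻¹) (c y) = σ y := by rw [← Perm.mul_apply, inv_mul_cancel_right]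
    rw [h1]
    by_cases hy : y ∈ A
    · exact (hq y hy).2.1.symm
    · rw [hcq, hq' y hy, hσ y hy]
  · by_cases hx : x ∈ A
    · exact (hq x hx).2.2
    · rw [hcA x hx]

/-- The trick behind Young symmetrizers: `a σ b = 0` as soon as two elements in one column are
moved by `σ` to the same row. -/
theorem rowSum_mul_single_mul_colSum_eq_zero {pos : α → ℕ × ℕ} {A : Finset α} {σ : Perm α}
    (hσ : σ ∈ supportedIn A) {x y : α} (hx : x ∈ A) (hy : y ∈ A) (hxy : x ≠ y)
    (hc : (pos x).2 = (pos y).2) (hr : (pos (σ x)).1 = (pos (σ y)).1) :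
    rowSum pos A * MonoidAlgebra.single σ 1 * colSum pos A = 0 := by
  have h1 : rowSum pos A * MonoidAlgebra.single (swap (σ x) (σ y)) 1 = rowSum pos A :=
    charSum_mul_single 1 (swap_mem_fiberGroup ((apply_mem_iff hσ x).2 hx)
      ((apply_mem_iff hσ y).2 hy) hr)
  have h2 : MonoidAlgebra.single (swap x y) (-1) * colSum pos A = colSum pos A := by
    have h3 := single_mul_charSum (signHom α) (swap_mem_fiberGroup (g := fun x => (pos x).2)
      hx hy hc)
    rwa [signHom_apply, Perm.sign_swap hxy, Units.val_neg, Units.val_one, Int.cast_neg,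
      Int.cast_one] at h3
  have h3 : swap (σ x) (σ y) * σ = σ * swap x y := by
    rw [Equiv.swap_apply_apply]; group
  have h4 : rowSum pos A * MonoidAlgebra.single σ 1 * colSum pos A =
      -(rowSum pos A * MonoidAlgebra.single σ 1 * colSum pos A) := by
    conv_lhs => rw [← h1]
    conv_rhs => rw [← h2]
    have h5 : (MonoidAlgebra.single (swap (σ x) (σ y)) 1 * MonoidAlgebra.single σ 1 : PermAlg α) =
        -(MonoidAlgebra.single σ 1 * MonoidAlgebra.single (swap x y) (-1)) := by
      rw [MonoidAlgebra.single_mul_single, MonoidAlgebra.single_mul_single, h3,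
        ← MonoidAlgebra.single_neg]
      simp
    rw [mul_assoc (rowSum pos A), h5]
    simp only [mul_neg, neg_mul, mul_assoc]
  have h5 := eq_neg_iff_add_eq_zero.1 h4
  rw [← two_smul ℚ] at h5
  exact (smul_eq_zero.1 h5).resolve_left two_ne_zero

/-- Von Neumann's lemma: `a x b` is a multiple of `a b`. -/
theorem IsTableau.exists_smul_eq {pos : α → ℕ × ℕ} {A : Finset α} (hA : IsTableau pos A)
    {z : PermAlg α} (hz : ∀ σ ∉ supportedIn A, z.coeff σ = 0) :
    ∃ κ : ℚ, rowSum pos A * z * colSum pos A = κ • symmetrizer pos A := by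
  have key : ∀ σ ∈ supportedIn A, ∃ κ : ℚ,
      rowSum pos A * MonoidAlgebra.single σ 1 * colSum pos A = κ • symmetrizer pos A := by
    intro σ hσ
    by_cases h : ∀ x ∈ A, ∀ y ∈ A, (pos x).2 = (pos y).2 → (pos (σ x)).1 = (pos (σ y)).1 → x = y
    · obtain ⟨r, hr, c, hc, rfl⟩ := hA.exists_eq_mul hσ h
      refine ⟨signHom α c⁻¹, ?_⟩
      have h1 : (MonoidAlgebra.single (r * c) 1 : PermAlg α) =
          signHom α c⁻¹ • (MonoidAlgebra.single r 1 * MonoidAlgebra.single c (signHom α c)) := by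
        rw [MonoidAlgebra.single_mul_single, MonoidAlgebra.smul_single', one_mul, hom_inv_mul]
      have h2 : rowSum pos A * MonoidAlgebra.single r 1 = rowSum pos A := charSum_mul_single 1 hr
      have h3 : MonoidAlgebra.single c (signHom α c) * colSum pos A = colSum pos A :=
        single_mul_charSum _ hc
      rw [h1, mul_smul_comm, smul_mul_assoc, ← mul_assoc, h2, mul_assoc, h3, symmetrizer]
    · push Not at h
      obtain ⟨x, hx, y, hy, hc, hr, hxy⟩ := h
      exact ⟨0, by rw [rowSum_mul_single_mul_colSum_eq_zero hσ hx hy hxy hc hr, zero_smul]⟩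
  have key' : ∀ σ, ∃ κ : ℚ, rowSum pos A * MonoidAlgebra.single σ (z.coeff σ) * colSum pos A =
      κ • symmetrizer pos A := by
    intro σ
    by_cases hσ : σ ∈ supportedIn A
    · obtain ⟨κ, hκ⟩ := key σ hσ
      refine ⟨z.coeff σ * κ, ?_⟩
      have h1 : (MonoidAlgebra.single σ (z.coeff σ) : PermAlg α) =
          z.coeff σ • MonoidAlgebra.single σ 1 := by simp
      rw [h1, mul_smul_comm, smul_mul_assoc, hκ, smul_smul]
    · exact ⟨0, by simp [hz σ hσ]⟩
  choose κ hκ using key'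
  refine ⟨∑ σ, κ σ, ?_⟩
  conv_lhs => rw [eq_sum_single z, Finset.mul_sum, Finset.sum_mul]
  rw [Finset.sum_congr rfl fun σ _ => hκ σ, Finset.sum_smul]

/-- A Young symmetrizer is an eigenvector of every central element of the group algebra of the
permutations of its entries. -/
theorem IsTableau.exists_mul_symmetrizer {pos : α → ℕ × ℕ} {A : Finset α} (hA : IsTableau pos A)
    {z : PermAlg α} (hz : ∀ σ ∉ supportedIn A, z.coeff σ = 0)
    (hcomm : ∀ σ ∈ supportedIn A, Commute z (MonoidAlgebra.single σ 1)) :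
    ∃ κ : ℚ, z * symmetrizer pos A = κ • symmetrizer pos A := by
  obtain ⟨κ, hκ⟩ := hA.exists_smul_eq hz
  refine ⟨κ, ?_⟩
  have h1 : Commute z (rowSum pos A) :=
    commute_charSum (fun σ hσ => hcomm σ (fiberGroup_le _ _ hσ)) _
  rw [← hκ, symmetrizer, ← mul_assoc, h1.eq]

end PermAlg

/-! ### Cutting and joining cycles -/

section Orbits

variable {α : Type*} [Fintype α] [DecidableEq α]

/-- The cycle of `σ` through `x`, as a set; it is `{x}` if `x` is a fixed point. -/
def orb (σ : Perm α) (x : α) : Finset α :=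
  open Classical in Finset.univ.filter (σ.SameCycle x)

theorem mem_orb {σ : Perm α} {x y : α} : y ∈ orb σ x ↔ σ.SameCycle x y := by
  simp [orb]

theorem mem_orb_self (σ : Perm α) (x : α) : x ∈ orb σ x := mem_orb.2 (Perm.SameCycle.refl σ x)

theorem pow_mem_orb (σ : Perm α) (x : α) (k : ℕ) : (σ ^ k) x ∈ orb σ x :=
  mem_orb.2 ⟨k, by simp⟩

theorem orb_eq_orb_iff {σ : Perm α} {x y : α} : orb σ x = orb σ y ↔ y ∈ orb σ x := by
  constructor
  · intro h
    rw [h]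
    exact mem_orb_self σ y
  · intro h
    ext z
    rw [mem_orb, mem_orb]
    rw [mem_orb] at h
    exact ⟨fun h' => h.symm.trans h', fun h' => h.trans h'⟩

theorem orb_eq_image {σ : Perm α} {x : α} {m : ℕ} (hm : 0 < m) (h : (σ ^ m) x = x) :
    orb σ x = (Finset.range m).image fun k => (σ ^ k) x := by
  ext y
  rw [mem_orb, Finset.mem_image]
  constructor
  · intro hy
    obtain ⟨k, -, hk⟩ := hy.exists_pow_eq'
    refine ⟨k % m, Finset.mem_range.2 (Nat.mod_lt _ hm), ?_⟩
    have h1 : ∀ q, (σ ^ (m * q)) x = x := by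
      intro q
      rw [pow_mul]
      exact Perm.pow_apply_eq_self_of_apply_eq_self h q
    rw [← hk]
    conv_rhs => rw [← Nat.mod_add_div k m, pow_add, Perm.mul_apply, h1]
  · rintro ⟨k, -, rfl⟩
    exact ⟨k, by simp⟩

theorem card_orb_eq {σ : Perm α} {x : α} {m : ℕ} (hm : 0 < m) (h : (σ ^ m) x = x)
    (h' : ∀ k, 0 < k → k < m → (σ ^ k) x ≠ x) : (orb σ x).card = m := by
  rw [orb_eq_image hm h, Finset.card_image_of_injOn, Finset.card_range]
  have key : ∀ k l, k < m → l < m → k < l → (σ ^ k) x ≠ (σ ^ l) x := by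
    intro k l _ hl hkl heq
    obtain ⟨t, rfl⟩ := Nat.exists_eq_add_of_lt hkl
    rw [show k + t + 1 = k + (t + 1) by ring, pow_add, Perm.mul_apply] at heq
    exact h' (t + 1) (by omega) (by omega) ((σ ^ k).injective heq).symm
  intro k hk l hl hkl
  have hk' := Finset.mem_range.1 hk
  have hl' := Finset.mem_range.1 hl
  rcases lt_trichotomy k l with h1 | h1 | h1
  · exact absurd hkl (key k l hk' hl' h1)
  · exact h1
  · exact absurd hkl.symm (key l k hl' hk' h1)

/-- The length of the cycle of `x` is the time of the first return to `x`. -/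
theorem card_orb_spec (σ : Perm α) (x : α) : 0 < (orb σ x).card ∧
    (σ ^ (orb σ x).card) x = x ∧ ∀ k, 0 < k → k < (orb σ x).card → (σ ^ k) x ≠ x := by
  classical
  have hex : ∃ m, 0 < m ∧ (σ ^ m) x = x :=
    ⟨orderOf σ, orderOf_pos σ, by rw [pow_orderOf_eq_one]; rfl⟩
  have h1 : (orb σ x).card = Nat.find hex :=
    card_orb_eq (Nat.find_spec hex).1 (Nat.find_spec hex).2 fun k hk hk' h =>
      Nat.find_min hex hk' ⟨hk, h⟩
  rw [h1]
  exact ⟨(Nat.find_spec hex).1, (Nat.find_spec hex).2, fun k hk hk' h =>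
      Nat.find_min hex hk' ⟨hk, h⟩⟩

theorem orb_eq_image_range (σ : Perm α) (x : α) :
    orb σ x = (Finset.range (orb σ x).card).image fun k => (σ ^ k) x :=
  orb_eq_image (card_orb_spec σ x).1 (card_orb_spec σ x).2.1

theorem injOn_pow_apply (σ : Perm α) (x : α) :
    Set.InjOn (fun k => (σ ^ k) x) (Finset.range (orb σ x).card) := by
  rw [← Finset.card_image_iff, ← orb_eq_image_range, Finset.card_range]

theorem orb_subset {A : Finset α} {σ : Perm α} (hσ : σ ∈ supportedIn A) {x : α} (hx : x ∈ A) :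
    orb σ x ⊆ A := by
  rw [orb_eq_image_range]
  intro y hy
  obtain ⟨k, -, rfl⟩ := Finset.mem_image.1 hy
  exact (apply_mem_iff (pow_mem hσ k) x).2 hx

theorem orb_eq_singleton {σ : Perm α} {x : α} (h : σ x = x) : orb σ x = {x} := by
  have h1 := orb_eq_image (σ := σ) (x := x) (m := 1) one_pos (by simpa using h)
  simpa using h1

theorem pow_swap_mul_apply_of_lt {σ : Perm α} {i j x : α} {n : ℕ}
    (h : ∀ k, 0 < k → k < n → (σ ^ k) x ≠ i ∧ (σ ^ k) x ≠ j) {k : ℕ} (hk : k < n) :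
    ((swap i j * σ) ^ k) x = (σ ^ k) x := by
  induction k with
  | zero => rfl
  | succ k ih =>
    rw [pow_succ', Perm.mul_apply, ih (by omega), Perm.mul_apply, ← Perm.mul_apply σ, ← pow_succ']
    exact swap_apply_of_ne_of_ne (h _ (by omega) hk).1 (h _ (by omega) hk).2

theorem pow_swap_mul_apply {σ : Perm α} {i j x : α} {n : ℕ}
    (h : ∀ k, 0 < k → k < n → (σ ^ k) x ≠ i ∧ (σ ^ k) x ≠ j) (hn : 0 < n) :
    ((swap i j * σ) ^ n) x = swap i j ((σ ^ n) x) := by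
  obtain ⟨m, rfl⟩ := Nat.exists_eq_succ_of_ne_zero hn.ne'
  rw [Nat.succ_eq_add_one, pow_succ', Perm.mul_apply,
    pow_swap_mul_apply_of_lt h (Nat.lt_succ_self m), Perm.mul_apply, ← Perm.mul_apply σ,
    ← pow_succ']

theorem orb_swap_mul_of_notMem {σ : Perm α} {i j x : α} (hi : i ∉ orb σ x) (hj : j ∉ orb σ x) :
    orb (swap i j * σ) x = orb σ x := by
  obtain ⟨h1, h2, h3⟩ := card_orb_spec σ x
  have h : ∀ k, 0 < k → k < (orb σ x).card → (σ ^ k) x ≠ i ∧ (σ ^ k) x ≠ j := fun k _ _ =>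
    ⟨fun h => hi (h ▸ pow_mem_orb σ x k), fun h => hj (h ▸ pow_mem_orb σ x k)⟩
  have h4 : ((swap i j * σ) ^ (orb σ x).card) x = x := by
    rw [pow_swap_mul_apply h h1, h2]
    exact swap_apply_of_ne_of_ne (fun h => hi (h ▸ mem_orb_self σ x))
      fun h => hj (h ▸ mem_orb_self σ x)
  rw [orb_eq_image h1 h4]
  conv_rhs => rw [orb_eq_image_range σ x]
  exact Finset.image_congr fun k hk => pow_swap_mul_apply_of_lt h (Finset.mem_range.1 hk)

/-- The cycles of `σ` on `A`, fixed points included. -/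
def cycles (σ : Perm α) (A : Finset α) : Finset (Finset α) := A.image (orb σ)

/-- The product over the cycles of `σ` on `A` of a function of the length. -/
def cycleProd {R : Type*} [CommMonoid R] (g : ℕ → R) (σ : Perm α) (A : Finset α) : R :=
  ∏ B ∈ cycles σ A, g B.card

theorem sum_cycles {R : Type*} [AddCommMonoid R] {A : Finset α} {σ : Perm α}
    (hσ : σ ∈ supportedIn A) (g : Finset α → R) :
    ∑ B ∈ cycles σ A, B.card • g B = ∑ x ∈ A, g (orb σ x) := by
  rw [Finset.sum_comp g (orb σ)]
  refine Finset.sum_congr rfl fun B hB => ?_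
  obtain ⟨x, hx, rfl⟩ := Finset.mem_image.1 hB
  congr 2
  ext y
  rw [Finset.mem_filter, eq_comm (a := orb σ y), orb_eq_orb_iff]
  exact ⟨fun h => ⟨orb_subset hσ hx h, h⟩, fun h => h.2⟩

/-- Multiplication by `(i σ^b(i))` cuts a cycle of length `a` into two of lengths `b`, `a - b`. -/
theorem card_orb_cut {σ : Perm α} {i : α} {b : ℕ} (hb : 0 < b) (hb' : b < (orb σ i).card) :
    orb (swap i ((σ ^ b) i) * σ) i = (Finset.range b).image (fun k => (σ ^ k) i) ∧
    (orb (swap i ((σ ^ b) i) * σ) i).card = b ∧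
    orb (swap i ((σ ^ b) i) * σ) ((σ ^ b) i) =
      (Finset.range ((orb σ i).card - b)).image (fun k => (σ ^ (b + k)) i) ∧
    (orb (swap i ((σ ^ b) i) * σ) ((σ ^ b) i)).card = (orb σ i).card - b := by
  obtain ⟨h1, h2, h3⟩ := card_orb_spec σ i
  have hinj := injOn_pow_apply σ i
  set a := (orb σ i).card with ha
  set j := (σ ^ b) i with hj
  have hne : ∀ k l, k < a → l < a → k ≠ l → (σ ^ k) i ≠ (σ ^ l) i := fun k l hk hl hkl h =>
    hkl (hinj (Finset.mem_coe.2 (Finset.mem_range.2 hk))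
      (Finset.mem_coe.2 (Finset.mem_range.2 hl)) h)
  have p1 : ∀ k, 0 < k → k < b → (σ ^ k) i ≠ i ∧ (σ ^ k) i ≠ j := fun k hk hk' =>
    ⟨h3 k hk (by omega), hne k b (by omega) hb' (by omega)⟩
  have e1 : ((swap i j * σ) ^ b) i = i := by
    rw [pow_swap_mul_apply p1 hb, ← hj, swap_apply_right]
  have hpow : ∀ k, (σ ^ k) j = (σ ^ (b + k)) i := fun k => by
    rw [hj, ← Perm.mul_apply, ← pow_add, add_comm]
  have p2 : ∀ k, 0 < k → k < a - b → (σ ^ k) j ≠ i ∧ (σ ^ k) j ≠ j := fun k hk hk' => by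
    rw [hpow]
    exact ⟨h3 _ (by omega) (by omega), hne _ b (by omega) hb' (by omega)⟩
  have e2 : ((swap i j * σ) ^ (a - b)) j = j := by
    rw [pow_swap_mul_apply p2 (by omega), hpow, show b + (a - b) = a by omega, h2,
      swap_apply_left]
  refine ⟨?_, ?_, ?_, ?_⟩
  · rw [orb_eq_image hb e1]
    exact Finset.image_congr fun k hk => pow_swap_mul_apply_of_lt p1 (Finset.mem_range.1 hk)
  · refine card_orb_eq hb e1 fun k hk hk' => ?_
    rw [pow_swap_mul_apply_of_lt p1 hk']
    exact (p1 k hk hk').1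
  · rw [orb_eq_image (by omega) e2]
    refine Finset.image_congr fun k hk => ?_
    exact (pow_swap_mul_apply_of_lt p2 (Finset.mem_range.1 hk)).trans (hpow k)
  · refine card_orb_eq (by omega) e2 fun k hk hk' => ?_
    rw [pow_swap_mul_apply_of_lt p2 hk']
    exact (p2 k hk hk').2

theorem cycleProd_cut {R : Type*} [CommMonoid R] (g : ℕ → R) {A : Finset α} {σ : Perm α}
    (hσ : σ ∈ supportedIn A) {i : α} (hi : i ∈ A) {b : ℕ} (hb : 0 < b)
    (hb' : b < (orb σ i).card) :
    cycleProd g (swap i ((σ ^ b) i) * σ) A * g (orb σ i).card =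
      cycleProd g σ A * (g b * g ((orb σ i).card - b)) := by
  obtain ⟨hU, hUc, hV, hVc⟩ := card_orb_cut hb hb'
  have hinj := injOn_pow_apply σ i
  have hO := orb_eq_image_range σ i
  set a := (orb σ i).card with ha
  set j := (σ ^ b) i with hj
  set σ' := swap i j * σ with hσ'
  have hjO : j ∈ orb σ i := pow_mem_orb σ i b
  have hjA : j ∈ A := orb_subset hσ hi hjO
  have hUV : orb σ' i ≠ orb σ' j := by
    intro h
    have h1 : j ∈ orb σ' i := h ▸ mem_orb_self σ' j
    rw [hU] at h1
    obtain ⟨k, hk, hk'⟩ := Finset.mem_image.1 h1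
    have hk2 := Finset.mem_range.1 hk
    have := hinj (Finset.mem_coe.2 (Finset.mem_range.2 (by omega : k < a)))
      (Finset.mem_coe.2 (Finset.mem_range.2 hb')) hk'
    omega
  have hsplit : ∀ x ∈ orb σ i, x ∈ orb σ' i ∨ x ∈ orb σ' j := by
    intro x hx
    rw [hO] at hx
    obtain ⟨k, hk, rfl⟩ := Finset.mem_image.1 hx
    have hk' := Finset.mem_range.1 hk
    rcases lt_or_ge k b with h | h
    · left
      rw [hU]
      exact Finset.mem_image_of_mem _ (Finset.mem_range.2 h)
    · right
      rw [hV]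
      exact Finset.mem_image.2 ⟨k - b, Finset.mem_range.2 (by omega), by
        rw [show b + (k - b) = k by omega]⟩
  have hother : ∀ x, x ∉ orb σ i → orb σ' x = orb σ x := by
    intro x hx
    refine orb_swap_mul_of_notMem (fun h => hx ?_) fun h => hx ?_
    · rw [← orb_eq_orb_iff.2 h]
      exact mem_orb_self σ x
    · rw [orb_eq_orb_iff.2 hjO, ← orb_eq_orb_iff.2 h]
      exact mem_orb_self σ x
  have hmemA : orb σ i ∈ cycles σ A := Finset.mem_image_of_mem _ hi
  have hnot : ∀ y ∈ orb σ i, ∀ z, orb σ' y = orb σ z → orb σ z = orb σ i := by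
    intro y hy z h
    have h1 : y ∈ orb σ z := h ▸ mem_orb_self σ' y
    rw [orb_eq_orb_iff.2 h1, orb_eq_orb_iff.2 hy]
  have hc : cycles σ' A = insert (orb σ' i) (insert (orb σ' j) ((cycles σ A).erase (orb σ i))) := by
    ext B
    simp only [cycles, Finset.mem_insert, Finset.mem_erase, Finset.mem_image]
    constructor
    · rintro ⟨x, hx, rfl⟩
      by_cases hxO : x ∈ orb σ i
      · rcases hsplit x hxO with h | h
        · exact Or.inl (orb_eq_orb_iff.2 h).symm
        · exact Or.inr (Or.inl (orb_eq_orb_iff.2 h).symm)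
      · rw [hother x hxO]
        exact Or.inr (Or.inr ⟨fun h => hxO (h ▸ mem_orb_self σ x), x, hx, rfl⟩)
    · rintro (rfl | rfl | ⟨h, x, hx, rfl⟩)
      · exact ⟨i, hi, rfl⟩
      · exact ⟨j, hjA, rfl⟩
      · exact ⟨x, hx, hother x fun h' => h (orb_eq_orb_iff.2 h').symm⟩
  have hV' : orb σ' j ∉ (cycles σ A).erase (orb σ i) := by
    intro h
    obtain ⟨h1, h2⟩ := Finset.mem_erase.1 h
    obtain ⟨z, -, hz⟩ := Finset.mem_image.1 h2
    exact h1 (hz ▸ hnot j hjO z hz.symm)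
  have hU' : orb σ' i ∉ insert (orb σ' j) ((cycles σ A).erase (orb σ i)) := by
    intro h
    rcases Finset.mem_insert.1 h with h | h
    · exact hUV h
    obtain ⟨h1, h2⟩ := Finset.mem_erase.1 h
    obtain ⟨z, -, hz⟩ := Finset.mem_image.1 h2
    exact h1 (hz ▸ hnot i (mem_orb_self σ i) z hz.symm)
  rw [cycleProd, cycleProd, hc, Finset.prod_insert hU', Finset.prod_insert hV', hUc, hVc,
    ← Finset.mul_prod_erase _ _ hmemA, ← ha]
  ac_rfl

/-- Multiplication by `(i j)` joins the cycles of `i` and `j` if these are distinct. -/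
theorem card_orb_join {σ : Perm α} {i j : α} (hj : j ∉ orb σ i) :
    ((swap i j * σ) ^ (orb σ i).card) i = j ∧
      (orb (swap i j * σ) i).card = (orb σ i).card + (orb σ j).card := by
  obtain ⟨h1, h2, h3⟩ := card_orb_spec σ i
  obtain ⟨h1', h2', h3'⟩ := card_orb_spec σ j
  have hi : i ∉ orb σ j := fun h => hj (by
    rw [← orb_eq_orb_iff.2 h]; exact mem_orb_self σ j)
  set a := (orb σ i).card
  set b := (orb σ j).card
  have p1 : ∀ k, 0 < k → k < a → (σ ^ k) i ≠ i ∧ (σ ^ k) i ≠ j := fun k hk hk' =>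
    ⟨h3 k hk hk', fun h => hj (h ▸ pow_mem_orb σ i k)⟩
  have p2 : ∀ k, 0 < k → k < b → (σ ^ k) j ≠ i ∧ (σ ^ k) j ≠ j := fun k hk hk' =>
    ⟨fun h => hi (h ▸ pow_mem_orb σ j k), h3' k hk hk'⟩
  have e1 : ((swap i j * σ) ^ a) i = j := by
    rw [pow_swap_mul_apply p1 h1, h2, swap_apply_left]
  have e2 : ((swap i j * σ) ^ b) j = i := by
    rw [pow_swap_mul_apply p2 h1', h2', swap_apply_right]
  refine ⟨e1, card_orb_eq (by omega) ?_ fun k hk hk' => ?_⟩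
  · rw [add_comm, pow_add, Perm.mul_apply, e1, e2]
  · rcases lt_or_ge k a with h | h
    · rw [pow_swap_mul_apply_of_lt p1 h]
      exact (p1 k hk h).1
    · obtain ⟨l, rfl⟩ := Nat.exists_eq_add_of_le h
      rw [add_comm, pow_add, Perm.mul_apply, e1,
        pow_swap_mul_apply_of_lt p2 (by omega : l < b)]
      exact fun h => hi (h ▸ pow_mem_orb σ j l)

theorem cycleProd_join {R : Type*} [CommMonoid R] (g : ℕ → R) {A : Finset α} {σ : Perm α}
    (hσ : σ ∈ supportedIn A) {i j : α} (hi : i ∈ A) (hj : j ∈ A) (hij : j ∉ orb σ i) :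
    cycleProd g (swap i j * σ) A * (g (orb σ i).card * g (orb σ j).card) =
      cycleProd g σ A * g ((orb σ i).card + (orb σ j).card) := by
  obtain ⟨h1, h2⟩ := card_orb_join hij
  have h3 := (card_orb_spec σ i).1
  have h4 := (card_orb_spec σ j).1
  have h5 := cycleProd_cut g (mul_mem (swap_mem_supportedIn hi hj) hσ) hi h3
    (by rw [h2]; omega)
  -- multiplying by `(i j)` once more cuts the joined cycle again
  rw [h1, h2, swap_mul_self_mul, Nat.add_sub_cancel_left] at h5
  exact h5.symm

end Orbits

/-! ### Hyperbolic power series -/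

section Hyperbolic

open PowerSeries

/-- The series `e^{c z}`. -/
def expS (c : ℚ) : PowerSeries ℚ := rescale c (exp ℚ)

/-- The series `2 sinh(n z / 2)`. -/
def sh (n : ℕ) : PowerSeries ℚ := expS (n / 2) - expS (-(n / 2))

/-- The series `2 cosh(n z / 2)`. -/
def ch (n : ℕ) : PowerSeries ℚ := expS (n / 2) + expS (-(n / 2))

theorem coeff_expS (c : ℚ) (n : ℕ) : coeff n (expS c) = c ^ n / n.factorial := by
  simp [expS, coeff_rescale, coeff_exp, div_eq_mul_inv]

theorem expS_mul (c d : ℚ) : expS c * expS d = expS (c + d) := exp_mul_exp_eq_exp_add c d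

theorem expS_zero : expS 0 = 1 := by
  ext n
  rw [coeff_expS, coeff_one]
  rcases eq_or_ne n 0 with rfl | hn
  · simp
  · simp [hn]

theorem expS_pow (c : ℚ) (n : ℕ) : expS c ^ n = expS (n * c) := by
  induction n with
  | zero => simp [expS_zero]
  | succ n ih => rw [pow_succ, ih, expS_mul]; push_cast; ring_nf

theorem derivative_expS (c : ℚ) : derivative ℚ (expS c) = c • expS c := by
  ext n
  rw [coeff_derivative, coeff_smul, coeff_expS, coeff_expS, Nat.factorial_succ, smul_eq_mul]
  have : (n.factorial : ℚ) ≠ 0 := by positivity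
  push_cast
  field_simp
  ring

theorem expS_half_mul : expS (1 / 2) * expS (-(1 / 2)) = 1 := by
  rw [expS_mul, add_neg_cancel, expS_zero]

theorem sh_eq (n : ℕ) : sh n = expS (1 / 2) ^ n - expS (-(1 / 2)) ^ n := by
  rw [expS_pow, expS_pow, sh]; congr 2 <;> ring

theorem ch_eq (n : ℕ) : ch n = expS (1 / 2) ^ n + expS (-(1 / 2)) ^ n := by
  rw [expS_pow, expS_pow, ch]; congr 2 <;> ring

theorem sh_zero : sh 0 = 0 := by
  rw [sh_eq, pow_zero, pow_zero, sub_self]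

theorem two_mul_derivative_sh (n : ℕ) : 2 * derivative ℚ (sh n) = n * ch n := by
  rw [sh, map_sub, derivative_expS, derivative_expS, ch]
  ext m
  have h2 : (2 : PowerSeries ℚ) = PowerSeries.C 2 := (map_ofNat _ 2).symm
  have hn : (n : PowerSeries ℚ) = PowerSeries.C (n : ℚ) := by simp
  rw [h2, hn, coeff_C_mul, coeff_C_mul]
  simp only [map_sub, map_add, coeff_smul, smul_eq_mul]
  ring

theorem two_mul_sh_add (a b : ℕ) : 2 * sh (a + b) = sh a * ch b + ch a * sh b := by
  simp only [sh_eq, ch_eq, pow_add]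
  ring

theorem sh_one_mul_ch_add (m : ℕ) : sh 1 * ch (m + 1) + 2 * sh m = ch 1 * sh (m + 1) := by
  simp only [sh_eq, ch_eq, pow_succ]
  linear_combination (2 * (expS (-(1 / 2))) ^ m - 2 * (expS (1 / 2)) ^ m) * expS_half_mul

/-- The sum over the ways to cut a cycle in two telescopes after multiplication by
`2 sinh(z/2)`. -/
theorem sh_one_mul_sum (m : ℕ) :
    sh 1 * ∑ b ∈ Finset.range m, sh (b + 1) * sh (m - b) = m * (sh 1 * ch (m + 1)) - 2 * sh m := by
  have huv := expS_half_mul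
  simp only [sh_eq, ch_eq]
  set u := expS (1 / 2)
  set v := expS (-(1 / 2))
  have h1 : ∀ b ∈ Finset.range m, (u ^ (b + 1) - v ^ (b + 1)) * (u ^ (m - b) - v ^ (m - b)) =
      (u ^ (m + 1) + v ^ (m + 1)) - u ^ b * v ^ (m - 1 - b) - v ^ b * u ^ (m - 1 - b) := by
    intro b hb
    have hb' := Finset.mem_range.1 hb
    obtain ⟨t, rfl⟩ := Nat.exists_eq_add_of_lt hb'
    rw [show b + t + 1 - b = t + 1 by omega, show b + t + 1 - 1 - b = t by omega]
    have e1 : u ^ (b + 1) * v ^ (t + 1) = u ^ b * v ^ t := by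
      linear_combination u ^ b * v ^ t * huv
    have e2 : v ^ (b + 1) * u ^ (t + 1) = v ^ b * u ^ t := by
      linear_combination v ^ b * u ^ t * huv
    linear_combination -e1 - e2
  rw [Finset.sum_congr rfl h1, Finset.sum_sub_distrib, Finset.sum_sub_distrib, Finset.sum_const,
    Finset.card_range, nsmul_eq_mul]
  have g1 := (Commute.all u v).geom_sum₂_mul m
  have g2 := (Commute.all v u).geom_sum₂_mul m
  linear_combination -g1 + g2

theorem sh_ne_zero {n : ℕ} (hn : 0 < n) : sh n ≠ 0 := by
  intro h
  have h1 : coeff 1 (sh n) = 0 := by rw [h, map_zero]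
  rw [sh, map_sub, coeff_expS, coeff_expS] at h1
  simp at h1
  omega

theorem sh_eq_rescale (n : ℕ) : sh n = (n : PowerSeries ℚ) * X * rescale (n : ℚ) S := by
  have hn : (n : PowerSeries ℚ) = PowerSeries.C (n : ℚ) := by simp
  ext m
  rw [hn]
  cases m with
  | zero =>
    rw [mul_assoc, coeff_C_mul, coeff_zero_X_mul, mul_zero, sh, map_sub, coeff_expS, coeff_expS,
      pow_zero, pow_zero, sub_self]
  | succ m =>
    rw [mul_assoc, coeff_C_mul, coeff_succ_X_mul, coeff_rescale, S, coeff_mk, sh, map_sub,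
      coeff_expS, coeff_expS]
    have : ((m + 1).factorial : ℚ) ≠ 0 := by positivity
    split_ifs with h
    · rw [Odd.neg_pow (Even.add_one h), div_pow, pow_succ (2 : ℚ)]
      field_simp
      ring
    · rw [Even.neg_pow (Odd.add_one (Nat.not_even_iff_odd.1 h))]
      ring

theorem sh_one_eq : sh 1 = X * S := by
  have h := sh_eq_rescale 1
  simpa using h

theorem constantCoeff_S : constantCoeff S = 1 := by
  rw [← coeff_zero_eq_constantCoeff_apply, S, coeff_mk]
  simp

theorem S_mul_inv : S * S⁻¹ = 1 :=
  PowerSeries.mul_inv_cancel _ (by rw [constantCoeff_S]; exact one_ne_zero)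

end Hyperbolic

/-! ### The weight of a partial permutation -/

section Weight

open PowerSeries

variable {α : Type*} [Fintype α] [DecidableEq α]

/-- The series `h^{|A|} / |A|! ∏ h_c` over the lengths `c` of the cycles of `σ` on `A`, where
`h_c = 2 sinh(c z / 2)` and `h = h_1`. -/
def cycleSeries (σ : Perm α) (A : Finset α) : PowerSeries ℚ :=
  (1 / (A.card.factorial : ℚ)) • (sh 1 ^ A.card * cycleProd sh σ A)

/-- The series `h^{|A| - 2} / |A|! ∏ h_c` over the cycles of `σ` on the nonempty set `A`; the
quotient by `h ^ 2 = z ^ 2 S(z) ^ 2` is formed by a shift of the coefficients. It is `0` for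
empty `A`. -/
def weightSeries (σ : Perm α) (A : Finset α) : PowerSeries ℚ :=
  S⁻¹ ^ 2 * PowerSeries.mk fun n => coeff (n + 2) (cycleSeries σ A)

/-- The coefficient of `z^m / m!` in the weight series. -/
def weight (m : ℕ) (A : Finset α) (σ : Perm α) : ℚ :=
  (m.factorial : ℚ) * coeff m (weightSeries σ A)

theorem X_dvd_sh (n : ℕ) : X ∣ sh n :=
  ⟨(n : PowerSeries ℚ) * rescale (n : ℚ) S, by rw [sh_eq_rescale]; ring⟩

theorem X_dvd_cycleProd {A : Finset α} (hA : A.Nonempty) (σ : Perm α) : X ∣ cycleProd sh σ A := by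
  obtain ⟨x, hx⟩ := hA
  exact (X_dvd_sh _).trans (Finset.dvd_prod_of_mem _ (Finset.mem_image_of_mem _ hx))

theorem X_pow_dvd_cycleSeries {A : Finset α} (hA : A.Nonempty) (σ : Perm α) :
    X ^ (A.card + 1) ∣ cycleSeries σ A := by
  rw [cycleSeries, pow_succ]
  exact dvd_smul_of_dvd _ (mul_dvd_mul (pow_dvd_pow_of_dvd (X_dvd_sh 1) _) (X_dvd_cycleProd hA σ))

theorem sh_sq_mul_weightSeries {A : Finset α} (hA : A.Nonempty) (σ : Perm α) :
    sh 1 ^ 2 * weightSeries σ A = cycleSeries σ A := by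
  have h1 : X ^ 2 * (PowerSeries.mk fun n => coeff (n + 2) (cycleSeries σ A)) =
      cycleSeries σ A := by
    obtain ⟨q, hq⟩ : X ^ 2 ∣ cycleSeries σ A :=
      (pow_dvd_pow X (by have := hA.card_pos; omega)).trans (X_pow_dvd_cycleSeries hA σ)
    rw [hq]
    congr 1
    ext n
    rw [coeff_mk, coeff_X_pow_mul]
  conv_rhs => rw [← h1]
  rw [weightSeries, sh_one_eq]
  linear_combination (X ^ 2 * PowerSeries.mk fun n => coeff (n + 2) (cycleSeries σ A)) *
    (S * S⁻¹ + 1) * S_mul_inv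

theorem weightSeries_empty (σ : Perm α) : weightSeries σ ∅ = 0 := by
  have h : (PowerSeries.mk fun n => coeff (n + 2) (cycleSeries σ ∅)) = 0 := by
    ext n
    simp [cycleSeries, cycleProd, cycles, coeff_one]
  rw [weightSeries, h, mul_zero]

theorem weight_zero {A : Finset α} (hA : A.Nonempty) {σ : Perm α} (hσ : σ ∈ supportedIn A) :
    weight 0 A σ = if A.card = 1 then 1 else 0 := by
  have h0 : weight 0 A σ = coeff 2 (cycleSeries σ A) := by
    have h1 : constantCoeff S⁻¹ = 1 := by rw [constantCoeff_inv, constantCoeff_S, inv_one]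
    simp [weight, weightSeries, h1]
  rw [h0]
  split_ifs with h
  · obtain ⟨x, rfl⟩ := Finset.card_eq_one.1 h
    have h1 : orb σ x = {x} :=
      (Finset.subset_singleton_iff.1 (orb_subset hσ (Finset.mem_singleton_self x))).resolve_left
        (Finset.Nonempty.ne_empty ⟨x, mem_orb_self σ x⟩)
    have h2 : cycleSeries σ {x} = X ^ 2 * (S * S) := by
      simp only [cycleSeries, cycleProd, cycles, Finset.image_singleton, Finset.prod_singleton, h1,
        Finset.card_singleton, sh_one_eq, Nat.factorial_one, Nat.cast_one, div_one, one_smul]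
      ring
    rw [h2, coeff_X_pow_mul']
    simp [constantCoeff_S]
  · exact (X_pow_dvd_iff.1 (X_pow_dvd_cycleSeries hA σ)) 2 (by have := hA.card_pos; omega)

/-- The field of fractions of the power series, in which the logarithmic derivatives live. -/
abbrev Frac : Type := FractionRing (PowerSeries ℚ)

/-- The embedding of the power series into their field of fractions. -/
abbrev toFrac : PowerSeries ℚ →+* Frac := algebraMap _ _

theorem toFrac_injective : Function.Injective toFrac :=
  IsFractionRing.injective (PowerSeries ℚ) Frac

instance charZero_frac : CharZero Frac :=
  have : CharZero (PowerSeries ℚ) := algebraRat.charZero _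
  charZero_of_injective_ringHom toFrac_injective

theorem toFrac_sh_ne_zero {n : ℕ} (hn : 0 < n) : toFrac (sh n) ≠ 0 := by
  intro h
  exact sh_ne_zero hn (toFrac_injective (h.trans (map_zero _).symm))

/-- The logarithmic derivative of the product over the cycles is a sum over the points. -/
theorem two_mul_derivative_cycleProd {A : Finset α} {σ : Perm α} (hσ : σ ∈ supportedIn A) :
    toFrac (2 * derivative ℚ (cycleProd sh σ A)) =
      toFrac (cycleProd sh σ A) *
        ∑ x ∈ A, toFrac (ch (orb σ x).card) / toFrac (sh (orb σ x).card) := by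
  rw [← sum_cycles hσ fun B => toFrac (ch B.card) / toFrac (sh B.card), cycleProd]
  have hpos : ∀ B ∈ cycles σ A, 0 < B.card := by
    intro B hB
    obtain ⟨x, -, rfl⟩ := Finset.mem_image.1 hB
    exact (card_orb_spec σ x).1
  generalize cycles σ A = s at hpos
  induction s using Finset.induction_on with
  | empty => simp
  | insert B s hB ih =>
    have ih' := ih fun B' h => hpos B' (Finset.mem_insert_of_mem h)
    have h0 := toFrac_sh_ne_zero (hpos B (Finset.mem_insert_self _ _))
    have hd := congrArg toFrac (two_mul_derivative_sh B.card)
    rw [Finset.prod_insert hB, Finset.sum_insert hB, Derivation.leibniz]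
    simp only [smul_eq_mul, map_mul, map_add, map_ofNat, map_natCast, nsmul_eq_mul] at ih' hd ⊢
    have h1 : toFrac (sh B.card) * (toFrac (ch B.card) / toFrac (sh B.card)) =
        toFrac (ch B.card) := by
      field_simp
    linear_combination toFrac (sh B.card) * ih' + toFrac (∏ B ∈ s, sh B.card) * hd -
      toFrac (∏ B ∈ s, sh B.card) * B.card * h1

theorem sum_orb_erase {M : Type*} [AddCommMonoid M] (σ : Perm α) (i : α) (g : α → M) :
    ∑ j ∈ (orb σ i).erase i, g j =
      ∑ b ∈ Finset.range ((orb σ i).card - 1), g ((σ ^ (b + 1)) i) := by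
  have hpos := (card_orb_spec σ i).1
  have h3 := (card_orb_spec σ i).2.2
  have hinj := injOn_pow_apply σ i
  have hset : (orb σ i).erase i =
      (Finset.range ((orb σ i).card - 1)).image fun b => (σ ^ (b + 1)) i := by
    ext y
    rw [Finset.mem_erase, Finset.mem_image]
    constructor
    · rintro ⟨hy, hy'⟩
      rw [orb_eq_image_range] at hy'
      obtain ⟨k, hk, rfl⟩ := Finset.mem_image.1 hy'
      have hk' := Finset.mem_range.1 hk
      have hk0 : k ≠ 0 := by
        rintro rfl
        exact hy rfl
      exact ⟨k - 1, Finset.mem_range.2 (by omega), by rw [show k - 1 + 1 = k by omega]⟩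
    · rintro ⟨b, hb, rfl⟩
      have hb' := Finset.mem_range.1 hb
      exact ⟨h3 _ (by omega) (by omega), pow_mem_orb _ _ _⟩
  rw [hset, Finset.sum_image]
  intro k hk l hl hkl
  have hk' := Finset.mem_range.1 hk
  have hl' := Finset.mem_range.1 hl
  have := hinj (Finset.mem_coe.2 (Finset.mem_range.2 (by omega : k + 1 < _)))
    (Finset.mem_coe.2 (Finset.mem_range.2 (by omega : l + 1 < _))) hkl
  omega

/-- The sum over all products `(i j) σ`: those `j` in the cycle of `i` cut it, the others join
it with their own cycle. -/
theorem sum_cycleProd_swap_mul {A : Finset α} {σ : Perm α} (hσ : σ ∈ supportedIn A) {i : α}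
    (hi : i ∈ A) {m : ℕ} (hm : (orb σ i).card = m + 1) :
    ∑ j ∈ A.erase i, toFrac (cycleProd sh (swap i j * σ) A) =
      toFrac (cycleProd sh σ A) *
        (toFrac (∑ b ∈ Finset.range m, sh (b + 1) * sh (m - b)) / toFrac (sh (m + 1)) +
          ∑ j ∈ A \ orb σ i, (toFrac (ch (orb σ j).card) / toFrac (sh (orb σ j).card) +
            toFrac (ch (m + 1)) / toFrac (sh (m + 1))) / 2) := by
  have ha := toFrac_sh_ne_zero (Nat.succ_pos m)
  have hsplit : A.erase i = (orb σ i).erase i ∪ (A \ orb σ i) := by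
    ext x
    simp only [Finset.mem_erase, Finset.mem_union, Finset.mem_sdiff]
    constructor
    · rintro ⟨h1, h2⟩
      by_cases h3 : x ∈ orb σ i
      · exact Or.inl ⟨h1, h3⟩
      · exact Or.inr ⟨h2, h3⟩
    · rintro (⟨h1, h2⟩ | ⟨h1, h2⟩)
      · exact ⟨h1, orb_subset hσ hi h2⟩
      · exact ⟨fun h => h2 (h ▸ mem_orb_self σ i), h1⟩
  have hdisj : Disjoint ((orb σ i).erase i) (A \ orb σ i) :=
    Finset.disjoint_sdiff.mono_left (Finset.erase_subset _ _)
  rw [hsplit, Finset.sum_union hdisj, sum_orb_erase, hm, Nat.add_sub_cancel, mul_add, map_sum,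
    Finset.sum_div, Finset.mul_sum, Finset.mul_sum]
  congr 1
  · refine Finset.sum_congr rfl fun b hb => ?_
    have hb' := Finset.mem_range.1 hb
    have h1 := congrArg toFrac (cycleProd_cut sh hσ hi (Nat.succ_pos b) (by rw [hm]; omega))
    rw [hm, show m + 1 - b.succ = m - b by omega] at h1
    simp only [map_mul, Nat.succ_eq_add_one] at h1 ⊢
    rw [mul_div_assoc', eq_div_iff ha, h1]
  · refine Finset.sum_congr rfl fun j hj => ?_
    obtain ⟨hjA, hj⟩ := Finset.mem_sdiff.1 hj
    have hb := toFrac_sh_ne_zero (card_orb_spec σ j).1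
    have h1 := congrArg toFrac (cycleProd_join sh hσ hi hjA hj)
    have h2 := congrArg toFrac (two_mul_sh_add (m + 1) (orb σ j).card)
    rw [hm] at h1
    simp only [map_mul, map_add, map_ofNat] at h1 h2 ⊢
    have h3 : toFrac (cycleProd sh (swap i j * σ) A) = toFrac (cycleProd sh σ A) *
        toFrac (sh (m + 1 + (orb σ j).card)) /
          (toFrac (sh (m + 1)) * toFrac (sh (orb σ j).card)) := by
      rw [eq_div_iff (mul_ne_zero ha hb), h1]
    have h4 : toFrac (sh (m + 1 + (orb σ j).card)) =
        (toFrac (sh (m + 1)) * toFrac (ch (orb σ j).card) +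
          toFrac (ch (m + 1)) * toFrac (sh (orb σ j).card)) / 2 := by
      rw [← h2, mul_div_cancel_left₀ _ two_ne_zero]
    rw [h3, h4]
    field_simp

theorem cycleProd_erase {A : Finset α} {σ : Perm α} {j : α} (hj : j ∈ A) (hσ : σ j = j) :
    cycleProd sh σ A = sh 1 * cycleProd sh σ (A.erase j) := by
  have h1 : cycles σ A = insert {j} (cycles σ (A.erase j)) := by
    rw [← orb_eq_singleton hσ, cycles, cycles, ← Finset.image_insert, Finset.insert_erase hj]
  rw [cycleProd, h1, Finset.prod_insert]
  · rfl
  · intro h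
    obtain ⟨x, hx, hx'⟩ := Finset.mem_image.1 h
    have h2 := mem_orb_self σ x
    rw [hx', Finset.mem_singleton] at h2
    exact (Finset.mem_erase.1 hx).1 h2

/-- If `σ` moves `i` and `j = σ⁻¹(i)`, then `(i j) σ` fixes `j`; it has the cycles of `σ`, with
`j` taken out of that of `i`. -/
theorem cycleProd_swap_mul_erase {A : Finset α} {σ : Perm α} (hσ : σ ∈ supportedIn A) {i : α}
    (hi : i ∈ A) {m : ℕ} (hm : (orb σ i).card = m + 1) (hσi : σ i ≠ i) :
    σ⁻¹ i ∈ A ∧ toFrac (cycleProd sh (swap i (σ⁻¹ i) * σ) (A.erase (σ⁻¹ i))) =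
      toFrac (cycleProd sh σ A) * (toFrac (sh m) / toFrac (sh (m + 1))) := by
  obtain ⟨-, h2, -⟩ := card_orb_spec σ i
  have hjA : σ⁻¹ i ∈ A := (apply_mem_iff (inv_mem hσ) i).2 hi
  refine ⟨hjA, ?_⟩
  have hm0 : 0 < m := by
    rcases Nat.eq_zero_or_pos m with rfl | h
    · rw [hm, zero_add, pow_one] at h2
      exact absurd h2 hσi
    · exact h
  have hj : (σ ^ m) i = σ⁻¹ i := by
    rw [hm, pow_succ', Perm.mul_apply] at h2
    rw [Perm.eq_inv_iff_eq, h2]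
  have hfix : (swap i (σ⁻¹ i) * σ) (σ⁻¹ i) = σ⁻¹ i := by
    rw [Perm.mul_apply, ← Perm.mul_apply σ, mul_inv_cancel, Perm.one_apply, swap_apply_left]
  have h3 := congrArg toFrac (cycleProd_cut sh hσ hi hm0 (by rw [hm]; omega))
  rw [hj, hm, Nat.add_sub_cancel_left, cycleProd_erase hjA hfix] at h3
  have ha := toFrac_sh_ne_zero (Nat.succ_pos m)
  have h1 := toFrac_sh_ne_zero one_pos
  simp only [map_mul, Nat.succ_eq_add_one] at h3 ha
  rw [mul_div_assoc', eq_div_iff ha]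
  apply mul_left_cancel₀ h1
  linear_combination h3

theorem sh_sq_mul_weightSeries' {A : Finset α} (hA : A.Nonempty) (σ : Perm α) :
    toFrac (sh 1) ^ 2 * toFrac (weightSeries σ A) =
      toFrac (sh 1) ^ A.card * toFrac (cycleProd sh σ A) / (A.card.factorial : Frac) := by
  have h := congrArg toFrac (sh_sq_mul_weightSeries hA σ)
  rw [map_mul, map_pow] at h
  have h0 : (A.card.factorial : Frac) ≠ 0 := Nat.cast_ne_zero.2 (Nat.factorial_ne_zero _)
  rw [h, eq_div_iff h0, ← map_pow, ← map_mul, ← map_natCast toFrac, ← map_mul]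
  congr 1
  rw [cycleSeries, smul_mul_assoc, ← nsmul_eq_mul', ← Nat.cast_smul_eq_nsmul ℚ, smul_smul,
    one_div_mul_cancel (Nat.cast_ne_zero.2 (Nat.factorial_ne_zero _)), one_smul]

/-- The cut-and-join equation. Multiplication by `(i j)` cuts or joins cycles of `σ` on `A`; the
last term accounts for those permutations whose product with `(i j)` is new on `A` because they
live on `A` without `j`. -/
theorem derivative_weightSeries {A : Finset α} {σ : Perm α} (hσ : σ ∈ supportedIn A) {i : α}
    (hi : i ∈ A) :
    derivative ℚ (weightSeries σ A) = ∑ j ∈ A.erase i, weightSeries (swap i j * σ) A +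
      if σ i = i then 0 else weightSeries (swap i (σ⁻¹ i) * σ) (A.erase (σ⁻¹ i)) := by
  have hA : A.Nonempty := ⟨i, hi⟩
  obtain ⟨m, hm⟩ := Nat.exists_eq_succ_of_ne_zero (card_orb_spec σ i).1.ne'
  rw [Nat.succ_eq_add_one] at hm
  obtain ⟨e, he⟩ := Nat.exists_eq_succ_of_ne_zero hA.card_pos.ne'
  rw [Nat.succ_eq_add_one] at he
  have hs := toFrac_sh_ne_zero one_pos
  have ha := toFrac_sh_ne_zero (Nat.succ_pos m)
  have hF : (e.factorial : Frac) ≠ 0 := Nat.cast_ne_zero.2 (Nat.factorial_ne_zero _)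
  have hE : ((e : Frac) + 1) ≠ 0 := by exact_mod_cast Nat.succ_ne_zero e
  apply toFrac_injective
  -- the term of the permutations on a smaller set
  have h3 : toFrac (sh 1) ^ 2 * toFrac (if σ i = i then 0 else
      weightSeries (swap i (σ⁻¹ i) * σ) (A.erase (σ⁻¹ i))) =
      toFrac (sh 1) ^ e * (toFrac (cycleProd sh σ A) * (toFrac (sh m) / toFrac (sh (m + 1)))) /
        (e.factorial : Frac) := by
    split_ifs with h
    · have hm0 : m = 0 := by
        rw [orb_eq_singleton h, Finset.card_singleton] at hm
        omega
      rw [hm0, sh_zero]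
      simp
    · obtain ⟨hj, hc⟩ := cycleProd_swap_mul_erase hσ hi hm h
      have hcard : (A.erase (σ⁻¹ i)).card = e := by
        rw [Finset.card_erase_of_mem hj, he, Nat.add_sub_cancel]
      have hne : (A.erase (σ⁻¹ i)).Nonempty :=
        ⟨i, Finset.mem_erase.2 ⟨fun h' => h (by
          rw [eq_comm, Perm.inv_eq_iff_eq] at h'; exact h'.symm), hi⟩⟩
      rw [sh_sq_mul_weightSeries' hne, hcard, hc]
  have h1 : toFrac (sh 1) ^ 2 * ∑ j ∈ A.erase i, toFrac (weightSeries (swap i j * σ) A) =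
      toFrac (sh 1) ^ (e + 1) * (∑ j ∈ A.erase i, toFrac (cycleProd sh (swap i j * σ) A)) /
        ((e + 1).factorial : Frac) := by
    rw [Finset.mul_sum, Finset.mul_sum, Finset.sum_div]
    refine Finset.sum_congr rfl fun j _ => ?_
    rw [sh_sq_mul_weightSeries' hA, he]
  have h0 := sh_sq_mul_weightSeries' hA σ
  -- the derivative of `h ^ 2 W = h ^ d ∏ h_c / d!`
  have hD : 2 * (toFrac (sh 1) * toFrac (ch 1) * toFrac (weightSeries σ A)) +
      2 * (toFrac (sh 1) ^ 2 * toFrac (derivative ℚ (weightSeries σ A))) =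
      ((e + 1) * toFrac (sh 1) ^ e * toFrac (ch 1) * toFrac (cycleProd sh σ A) +
        toFrac (sh 1) ^ (e + 1) * toFrac (2 * derivative ℚ (cycleProd sh σ A))) /
          ((e + 1).factorial : Frac) := by
    have h := congrArg (fun q => 2 * derivative ℚ q) (sh_sq_mul_weightSeries hA σ)
    have hd := two_mul_derivative_sh 1
    simp only [cycleSeries, Derivation.leibniz, Derivation.leibniz_pow, Derivation.map_smul,
      smul_eq_mul, he, nsmul_eq_mul, Nat.add_sub_cancel, one_div] at h
    rw [eq_div_iff (Nat.cast_ne_zero.2 (Nat.factorial_ne_zero _)), ← map_natCast toFrac]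
    have h0' : (((e + 1).factorial : ℕ) : PowerSeries ℚ) =
        PowerSeries.C ((e + 1).factorial : ℚ) := by simp
    have hCC : PowerSeries.C ((e + 1).factorial : ℚ) *
        PowerSeries.C ((e + 1).factorial : ℚ)⁻¹ = 1 := by
      rw [← map_mul, mul_inv_cancel₀ (Nat.cast_ne_zero.2 (Nat.factorial_ne_zero _)), map_one]
    rw [h0']
    rw [PowerSeries.smul_eq_C_mul] at h
    push_cast at h hd
    have key : (2 * (sh 1 * ch 1 * weightSeries σ A) +
        2 * (sh 1 ^ 2 * derivative ℚ (weightSeries σ A))) *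
          PowerSeries.C ((e + 1).factorial : ℚ) =
        ((e : PowerSeries ℚ) + 1) * sh 1 ^ e * ch 1 * cycleProd sh σ A +
          sh 1 ^ (e + 1) * (2 * derivative ℚ (cycleProd sh σ A)) := by
      linear_combination PowerSeries.C ((e + 1).factorial : ℚ) * h -
        (2 * sh 1 * weightSeries σ A * PowerSeries.C ((e + 1).factorial : ℚ) -
          (e + 1) * sh 1 ^ e * cycleProd sh σ A) * hd +
        2 * (sh 1 ^ (e + 1) * derivative ℚ (cycleProd sh σ A) +
          cycleProd sh σ A * ((e + 1) * sh 1 ^ e * derivative ℚ (sh 1))) * hCC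
    have key' := congrArg toFrac key
    simp only [map_mul, map_add, map_pow, map_ofNat, map_one, map_natCast] at key' ⊢
    exact key'
  have hS := sum_cycleProd_swap_mul hσ hi hm
  have hT : ∑ x ∈ A, toFrac (ch (orb σ x).card) / toFrac (sh (orb σ x).card) =
      (m + 1) * (toFrac (ch (m + 1)) / toFrac (sh (m + 1))) +
        ∑ x ∈ A \ orb σ i, toFrac (ch (orb σ x).card) / toFrac (sh (orb σ x).card) := by
    rw [← Finset.sum_sdiff (orb_subset hσ hi), add_comm]
    congr 1
    rw [Finset.sum_congr rfl fun x hx => by rw [← orb_eq_orb_iff.2 hx, hm], Finset.sum_const, hm,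
      nsmul_eq_mul]
    push_cast
    rfl
  have hcard : (((A \ orb σ i).card : ℕ) : Frac) = e - m := by
    rw [Finset.card_sdiff_of_subset (orb_subset hσ hi), hm, he,
      Nat.cast_sub (by rw [← hm, ← he]; exact Finset.card_le_card (orb_subset hσ hi))]
    push_cast
    ring
  rw [two_mul_derivative_cycleProd hσ, hT] at hD
  rw [← Finset.sum_div, Finset.sum_add_distrib, Finset.sum_const, nsmul_eq_mul, hcard] at hS
  rw [he] at h0
  -- the addition formulas
  have hk := congrArg toFrac (sh_one_mul_ch_add m)
  have hb := congrArg toFrac (sh_one_mul_sum m)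
  simp only [map_mul, map_add, map_sub, map_ofNat, map_natCast] at hk hb
  rw [map_add, map_sum]
  generalize toFrac (weightSeries σ A) = w at *
  generalize toFrac (derivative ℚ (weightSeries σ A)) = w' at *
  generalize toFrac (if σ i = i then 0 else _) = w3 at *
  generalize ∑ j ∈ A.erase i, toFrac (weightSeries (swap i j * σ) A) = w1 at *
  generalize ∑ j ∈ A.erase i, toFrac (cycleProd sh (swap i j * σ) A) = P1 at *
  generalize toFrac (cycleProd sh σ A) = P at *
  generalize ∑ x ∈ A \ orb σ i, toFrac (ch (orb σ x).card) / toFrac (sh (orb σ x).card) = T at *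
  generalize toFrac (∑ b ∈ Finset.range m, sh (b + 1) * sh (m - b)) = Q at *
  rw [Nat.succ_eq_add_one] at ha
  generalize toFrac (sh (m + 1)) = ha' at *
  generalize toFrac (ch (m + 1)) = ca at *
  generalize toFrac (sh m) = hm' at *
  generalize toFrac (sh 1) = h at *
  generalize toFrac (ch 1) = c at *
  generalize hx : ca / ha' = x at *
  generalize hr : hm' / ha' = r at *
  have hk' : h * x + 2 * r = c := by
    rw [← hx, ← hr]
    field_simp
    linear_combination hk
  have hb' : h * (Q / ha') = m * (h * x) - 2 * r := by
    rw [← hx, ← hr]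
    field_simp
    linear_combination hb
  generalize Q / ha' = q at *
  have hfac : (((e + 1).factorial : ℕ) : Frac) = (e + 1) * (e.factorial : Frac) := by
    rw [Nat.factorial_succ]
    push_cast
    rfl
  rw [hfac] at h0 h1 hD
  -- the common factor `G = h W` of all terms
  obtain ⟨G, hG⟩ : ∃ G, G = h ^ e * P / ((e + 1) * (e.factorial : Frac)) := ⟨_, rfl⟩
  have h0' : h * w = G := by
    apply mul_left_cancel₀ hs
    rw [hG, ← mul_assoc, ← sq, h0, pow_succ]
    ring
  have h3' : h ^ 2 * w3 = (e + 1) * G * r := by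
    rw [h3, hG]
    field_simp
  have h1' : h ^ 2 * w1 = G * (h * q + h * (T + (e - m) * x) / 2) := by
    rw [h1, hG, hS, pow_succ]
    ring
  have hD' : 2 * (c * G) + 2 * (h ^ 2 * w') = G * ((e + 1) * c + h * ((m + 1) * x + T)) := by
    have h4 : ((e + 1) * h ^ e * c * P + h ^ (e + 1) * (P * ((m + 1) * x + T))) /
        ((e + 1) * (e.factorial : Frac)) = G * ((e + 1) * c + h * ((m + 1) * x + T)) := by
      rw [hG]
      ring
    rw [← h4, ← hD, ← h0']
    ring
  apply mul_left_cancel₀ (mul_ne_zero two_ne_zero (pow_ne_zero 2 hs) : 2 * h ^ 2 ≠ 0)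
  linear_combination hD' - 2 * h1' - 2 * h3' - 2 * G * hb' - (e - 1) * G * hk'

end Weight

/-! ### Sums over partial permutations -/

section PartialPerm

variable {α : Type*} [Fintype α] [DecidableEq α]

/-- The permutations supported in `A`, as a finite set. -/
def permsIn (A : Finset α) : Finset (Perm α) :=
  open Classical in Finset.univ.filter (· ∈ supportedIn A)

theorem mem_permsIn {A : Finset α} {σ : Perm α} : σ ∈ permsIn A ↔ σ ∈ supportedIn A := by
  simp [permsIn]

/-- The sum over the partial permutations of `A`, that is, over the pairs of a subset `B` of `A`
and a permutation of `B`, with coefficients `F`. -/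
def pairSum (F : Finset α → Perm α → ℚ) (A : Finset α) : PermAlg α :=
  ∑ B ∈ A.powerset, ∑ σ ∈ permsIn B, MonoidAlgebra.single σ (F B σ)

/-- The coefficients `F` depend only on the conjugacy class of the partial permutation. -/
def ConjInvariant (F : Finset α → Perm α → ℚ) : Prop :=
  ∀ (τ : Perm α) (B : Finset α) (σ : Perm α), F (B.map τ.toEmbedding) (τ * σ * τ⁻¹) = F B σ

theorem conj_mem_supportedIn {τ σ : Perm α} {B : Finset α} (h : σ ∈ supportedIn B) :
    τ * σ * τ⁻¹ ∈ supportedIn (B.map τ.toEmbedding) := by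
  intro x hx
  have hx' : τ⁻¹ x ∉ B := fun h' => hx (Finset.mem_map.2 ⟨τ⁻¹ x, h', by simp⟩)
  rw [Perm.mul_apply, Perm.mul_apply, h _ hx', ← Perm.mul_apply, mul_inv_cancel, Perm.one_apply]

theorem map_inv_map (τ : Perm α) (B : Finset α) :
    (B.map τ.toEmbedding).map (τ⁻¹).toEmbedding = B := by
  ext x
  simp only [Finset.mem_map_equiv]
  exact iff_of_eq (congrArg (· ∈ B) (τ.symm_apply_apply x))

theorem map_map_inv (τ : Perm α) (B : Finset α) :
    (B.map (τ⁻¹).toEmbedding).map τ.toEmbedding = B := by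
  ext x
  simp only [Finset.mem_map_equiv]
  exact iff_of_eq (congrArg (· ∈ B) (τ.apply_symm_apply x))

theorem map_subset_of_mem_supportedIn {τ : Perm α} {A B : Finset α} (hτ : τ ∈ supportedIn A)
    (h : B ⊆ A) : B.map τ.toEmbedding ⊆ A := by
  intro x hx
  obtain ⟨y, hy, rfl⟩ := Finset.mem_map.1 hx
  exact (apply_mem_iff hτ y).2 (h hy)

theorem ConjInvariant.commute_pairSum {F : Finset α → Perm α → ℚ} (hF : ConjInvariant F)
    {A : Finset α} {τ : Perm α} (hτ : τ ∈ supportedIn A) :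
    Commute (pairSum F A) (MonoidAlgebra.single τ 1) := by
  rw [Commute, SemiconjBy, eq_comm, pairSum, Finset.mul_sum, Finset.sum_mul]
  simp only [Finset.mul_sum, Finset.sum_mul, MonoidAlgebra.single_mul_single, one_mul, mul_one]
  rw [Finset.sum_sigma', Finset.sum_sigma']
  refine Finset.sum_bij' (fun q _ => ⟨q.1.map τ.toEmbedding, τ * q.2 * τ⁻¹⟩)
    (fun q _ => ⟨q.1.map (τ⁻¹).toEmbedding, τ⁻¹ * q.2 * τ⟩) ?_ ?_ ?_ ?_ ?_
  · rintro ⟨B, σ⟩ h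
    simp only [Finset.mem_sigma, Finset.mem_powerset, mem_permsIn] at h ⊢
    exact ⟨map_subset_of_mem_supportedIn hτ h.1, conj_mem_supportedIn h.2⟩
  · rintro ⟨B, σ⟩ h
    simp only [Finset.mem_sigma, Finset.mem_powerset, mem_permsIn] at h ⊢
    have h1 := conj_mem_supportedIn (τ := τ⁻¹) h.2
    rw [inv_inv] at h1
    exact ⟨map_subset_of_mem_supportedIn (inv_mem hτ) h.1, h1⟩
  · rintro ⟨B, σ⟩ -
    simp only [map_inv_map, Sigma.mk.injEq, heq_eq_eq, true_and]
    group
  · rintro ⟨B, σ⟩ -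
    simp only [map_map_inv, Sigma.mk.injEq, heq_eq_eq, true_and]
    group
  · rintro ⟨B, σ⟩ -
    simp only [inv_mul_cancel_right]
    exact congrArg _ (hF τ B σ).symm

theorem coeff_pairSum_eq_zero (F : Finset α → Perm α → ℚ) {A : Finset α} {σ : Perm α}
    (hσ : σ ∉ supportedIn A) : (pairSum F A).coeff σ = 0 := by
  simp only [pairSum, MonoidAlgebra.coeff_sum, Finsupp.finsetSum_apply, MonoidAlgebra.coeff_single]
  refine Finset.sum_eq_zero fun B hB => Finset.sum_eq_zero fun τ hτ => Finsupp.single_eq_of_ne ?_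
  rintro rfl
  exact hσ (supportedIn_mono (Finset.mem_powerset.1 hB) (mem_permsIn.1 hτ))

/-- The lengths of the cycles of `σ` on `A`, fixed points included. -/
def cycleLengths (σ : Perm α) (A : Finset α) : Multiset ℕ := (cycles σ A).val.map Finset.card

theorem cycleProd_eq {R : Type*} [CommMonoid R] (g : ℕ → R) (σ : Perm α) (A : Finset α) :
    cycleProd g σ A = ((cycleLengths σ A).map g).prod := by
  rw [cycleLengths, Multiset.map_map]
  rfl

theorem orb_conj (τ σ : Perm α) (x : α) :
    orb (τ * σ * τ⁻¹) (τ x) = (orb σ x).map τ.toEmbedding := by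
  ext y
  rw [mem_orb, Perm.sameCycle_conj, Finset.mem_map]
  constructor
  · intro h
    refine ⟨τ⁻¹ y, mem_orb.2 ?_, by simp⟩
    simpa using h
  · rintro ⟨z, hz, rfl⟩
    simpa using mem_orb.1 hz

theorem cycleLengths_conj (τ σ : Perm α) (A : Finset α) :
    cycleLengths (τ * σ * τ⁻¹) (A.map τ.toEmbedding) = cycleLengths σ A := by
  have h1 : cycles (τ * σ * τ⁻¹) (A.map τ.toEmbedding) =
      (cycles σ A).map (Finset.mapEmbedding τ.toEmbedding).toEmbedding := by
    ext B
    simp only [cycles, Finset.mem_image, Finset.mem_map]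
    constructor
    · rintro ⟨x, ⟨y, hy, rfl⟩, rfl⟩
      exact ⟨_, ⟨y, hy, rfl⟩, (orb_conj τ σ y).symm⟩
    · rintro ⟨_, ⟨y, hy, rfl⟩, rfl⟩
      exact ⟨τ y, ⟨y, hy, rfl⟩, orb_conj τ σ y⟩
  rw [cycleLengths, h1, Finset.map_val, Multiset.map_map, cycleLengths]
  refine Multiset.map_congr rfl fun B _ => ?_
  simp

theorem weight_conjInvariant (m : ℕ) : ConjInvariant (α := α) (weight m) := by
  intro τ B σ
  simp only [weight, weightSeries, cycleSeries, cycleProd_eq, cycleLengths_conj, Finset.card_map]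

/-! ### Powers of Jucys–Murphy elements -/

/-- The cut-and-join equation for the coefficients of the weight series. -/
theorem weight_succ (m : ℕ) {A : Finset α} {σ : Perm α} (hσ : σ ∈ supportedIn A) {i : α}
    (hi : i ∈ A) :
    weight (m + 1) A σ = ∑ j ∈ A.erase i, weight m A (swap i j * σ) +
      if σ i = i then 0 else weight m (A.erase (σ⁻¹ i)) (swap i (σ⁻¹ i) * σ) := by
  have h := congrArg (PowerSeries.coeff m) (derivative_weightSeries hσ hi)
  rw [PowerSeries.coeff_derivative, map_add, map_sum] at h
  simp only [weight, Nat.factorial_succ, Nat.cast_mul, ← Finset.mul_sum]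
  have h1 : (if σ i = i then (0 : ℚ) else (m.factorial : ℚ) * PowerSeries.coeff m
      (weightSeries (swap i (σ⁻¹ i) * σ) (A.erase (σ⁻¹ i)))) = (m.factorial : ℚ) *
      PowerSeries.coeff m (if σ i = i then 0 else
        weightSeries (swap i (σ⁻¹ i) * σ) (A.erase (σ⁻¹ i))) := by
    split_ifs <;> simp
  rw [h1, ← mul_add, ← h]
  push_cast
  ring

/-- The sum of the transpositions `(i j)`, `j ∈ B`: a Jucys–Murphy element. -/
def jucysMurphy (i : α) (B : Finset α) : PermAlg α := ∑ j ∈ B, MonoidAlgebra.single (swap i j) 1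

theorem permsIn_singleton (i : α) : permsIn ({i} : Finset α) = {1} := by
  ext σ
  rw [mem_permsIn, Finset.mem_singleton]
  constructor
  · intro h
    ext x
    by_cases hx : x = i
    · subst hx
      have h1 := (apply_mem_iff h x).2 (Finset.mem_singleton_self x)
      exact Finset.mem_singleton.1 h1
    · exact h x (by simpa using hx)
  · rintro rfl
    exact one_mem _

/-- The powers of a Jucys–Murphy element as sums over partial permutations. -/
theorem jucysMurphy_pow (m : ℕ) {i : α} {B : Finset α} (hi : i ∉ B) :
    jucysMurphy i B ^ m = ∑ A ∈ B.powerset, ∑ σ ∈ permsIn (insert i A),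
      MonoidAlgebra.single σ (weight m (insert i A) σ) := by
  have hiA : ∀ A ∈ B.powerset, i ∉ A := fun A hA h => hi (Finset.mem_powerset.1 hA h)
  induction m with
  | zero =>
    rw [pow_zero, Finset.sum_eq_single_of_mem ∅ (Finset.empty_mem_powerset B)]
    · rw [insert_empty_eq, permsIn_singleton, Finset.sum_singleton,
        weight_zero (Finset.singleton_nonempty i) (one_mem _), if_pos (Finset.card_singleton i)]
      rfl
    · intro A hA hne
      refine Finset.sum_eq_zero fun σ hσ => ?_
      rw [weight_zero (Finset.insert_nonempty i A) (mem_permsIn.1 hσ), if_neg,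
        MonoidAlgebra.single_zero]
      rw [Finset.card_insert_of_notMem (hiA A hA)]
      have := Finset.card_ne_zero_of_mem (Finset.nonempty_iff_ne_empty.2 hne).choose_spec
      omega
  | succ m ih =>
    have hR : ∑ A ∈ B.powerset, ∑ σ ∈ permsIn (insert i A),
        (MonoidAlgebra.single σ (weight (m + 1) (insert i A) σ) : PermAlg α) =
        ∑ A ∈ B.powerset, ∑ σ ∈ permsIn (insert i A), ∑ j ∈ A,
          MonoidAlgebra.single σ (weight m (insert i A) (swap i j * σ)) +
        ∑ A ∈ B.powerset, ∑ σ ∈ permsIn (insert i A) with σ i ≠ i,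
          MonoidAlgebra.single σ
            (weight m ((insert i A).erase (σ⁻¹ i)) (swap i (σ⁻¹ i) * σ)) := by
      rw [← Finset.sum_add_distrib]
      refine Finset.sum_congr rfl fun A hA => ?_
      rw [Finset.sum_filter, ← Finset.sum_add_distrib]
      refine Finset.sum_congr rfl fun σ hσ => ?_
      rw [weight_succ m (mem_permsIn.1 hσ) (Finset.mem_insert_self i A),
        Finset.erase_insert (hiA A hA), MonoidAlgebra.single_add]
      congr 1
      · exact map_sum (MonoidAlgebra.singleAddHom σ) _ _
      · split_ifs with h1 h2
        · exact absurd h1 h2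
        · exact MonoidAlgebra.single_zero σ
        · rfl
    have hL : jucysMurphy i B * ∑ A ∈ B.powerset, ∑ σ ∈ permsIn (insert i A),
        MonoidAlgebra.single σ (weight m (insert i A) σ) =
        ∑ A ∈ B.powerset, ∑ σ ∈ permsIn (insert i A), ∑ j ∈ A,
          MonoidAlgebra.single (swap i j * σ) (weight m (insert i A) σ) +
        ∑ A ∈ B.powerset, ∑ σ ∈ permsIn (insert i A), ∑ j ∈ B \ A,
          MonoidAlgebra.single (swap i j * σ) (weight m (insert i A) σ) := by
      rw [← Finset.sum_add_distrib, Finset.mul_sum]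
      refine Finset.sum_congr rfl fun A hA => ?_
      rw [← Finset.sum_add_distrib, Finset.mul_sum]
      refine Finset.sum_congr rfl fun σ hσ => ?_
      rw [jucysMurphy, Finset.sum_mul, add_comm, Finset.sum_sdiff (Finset.mem_powerset.1 hA)]
      refine Finset.sum_congr rfl fun j _ => ?_
      rw [MonoidAlgebra.single_mul_single, one_mul]
    rw [pow_succ', ih, hL, hR]
    congr 1
    · refine Finset.sum_congr rfl fun A _ => ?_
      rw [Finset.sum_comm, Finset.sum_comm (s := permsIn _)]
      refine Finset.sum_congr rfl fun j hj => ?_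
      have hsw := swap_mem_supportedIn (Finset.mem_insert_self i A) (Finset.mem_insert_of_mem hj)
      refine Finset.sum_equiv (Equiv.mulLeft (swap i j)) (fun σ => ?_) fun σ _ => ?_
      · rw [mem_permsIn, mem_permsIn, Equiv.coe_mulLeft, Subgroup.mul_mem_cancel_left _ hsw]
      · rw [Equiv.coe_mulLeft, swap_mul_self_mul]
    · simp only [Finset.sum_sigma']
      -- the terms that enlarge `A` by `j` correspond to the permutations that move `i`, `j` being
      -- the preimage of `i`
      refine Finset.sum_bij'
        (fun q _ => (⟨insert q.2.2 q.1, swap i q.2.2 * q.2.1⟩ : (_ : Finset α) × Perm α))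
        (fun q _ => (⟨q.1.erase (q.2⁻¹ i), swap i (q.2⁻¹ i) * q.2, q.2⁻¹ i⟩ :
          (_ : Finset α) × (_ : Perm α) × α)) ?_ ?_ ?_ ?_ ?_
      · rintro ⟨A, σ, j⟩ h
        simp only [Finset.mem_sigma, Finset.mem_powerset, mem_permsIn, Finset.mem_sdiff,
          Finset.mem_filter] at h ⊢
        obtain ⟨hA, hσ, hjB, hjA⟩ := h
        have hij : j ≠ i := fun h => hi (h ▸ hjB)
        have hσj : σ j = j := hσ j (by simp [hij, hjA])
        refine ⟨Finset.insert_subset hjB hA, mul_mem (swap_mem_supportedIn (by simp) (by simp))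
          (supportedIn_mono (Finset.insert_subset_insert _ (Finset.subset_insert _ _)) hσ), ?_⟩
        rw [Perm.mul_apply]
        intro h
        rw [swap_apply_eq_iff, swap_apply_left] at h
        exact hij (σ.injective (hσj.trans h.symm))
      · rintro ⟨A, τ⟩ h
        simp only [Finset.mem_sigma, Finset.mem_powerset, mem_permsIn, Finset.mem_sdiff,
          Finset.mem_filter] at h ⊢
        obtain ⟨hA, hτ, hτi⟩ := h
        have hji : τ⁻¹ i ≠ i := fun h => hτi (by
          rw [Perm.inv_eq_iff_eq] at h
          exact h.symm)
        have hjA : τ⁻¹ i ∈ A := (Finset.mem_insert.1 ((apply_mem_iff (inv_mem hτ) i).2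
          (Finset.mem_insert_self i A))).resolve_left hji
        refine ⟨(Finset.erase_subset _ _).trans hA, fun x hx => ?_, hA hjA, by simp⟩
        rw [Finset.mem_insert, Finset.mem_erase] at hx
        push Not at hx
        by_cases hxj : x = τ⁻¹ i
        · rw [hxj, Perm.mul_apply, ← Perm.mul_apply τ, mul_inv_cancel, Perm.one_apply,
            swap_apply_left]
        · have hx' : τ x = x := hτ x (by simp [hx.1, hx.2 hxj])
          rw [Perm.mul_apply, hx', swap_apply_of_ne_of_ne hx.1 hxj]
      · rintro ⟨A, σ, j⟩ h
        simp only [Finset.mem_sigma, Finset.mem_powerset, mem_permsIn, Finset.mem_sdiff] at h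
        obtain ⟨hA, hσ, hjB, hjA⟩ := h
        have hij : j ≠ i := fun h => hi (h ▸ hjB)
        have hσj : σ j = j := hσ j (by simp [hij, hjA])
        have hj : (swap i j * σ)⁻¹ i = j := by
          rw [Perm.inv_eq_iff_eq, Perm.mul_apply, hσj, swap_apply_right]
        simp only [hj, Finset.erase_insert hjA, swap_mul_self_mul]
      · rintro ⟨A, τ⟩ h
        simp only [Finset.mem_sigma, Finset.mem_powerset, mem_permsIn, Finset.mem_filter] at h
        obtain ⟨hA, hτ, hτi⟩ := h
        have hji : τ⁻¹ i ≠ i := fun h => hτi (by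
          rw [Perm.inv_eq_iff_eq] at h
          exact h.symm)
        have hjA : τ⁻¹ i ∈ A := (Finset.mem_insert.1 ((apply_mem_iff (inv_mem hτ) i).2
          (Finset.mem_insert_self i A))).resolve_left hji
        simp only [Finset.insert_erase hjA, swap_mul_self_mul]
      · rintro ⟨A, σ, j⟩ h
        simp only [Finset.mem_sigma, Finset.mem_powerset, mem_permsIn, Finset.mem_sdiff] at h
        obtain ⟨hA, hσ, hjB, hjA⟩ := h
        have hij : j ≠ i := fun h => hi (h ▸ hjB)
        have hσj : σ j = j := hσ j (by simp [hij, hjA])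
        have hj : (swap i j * σ)⁻¹ i = j := by
          rw [Perm.inv_eq_iff_eq, Perm.mul_apply, hσj, swap_apply_right]
        have hset : (insert i (insert j A)).erase j = insert i A := by
          rw [Finset.insert_comm, Finset.erase_insert (by simp [hij, hjA])]
        simp only [hj, swap_mul_self_mul, hset]

/-- The sum of the `m`-th powers of the Jucys–Murphy elements of the permutations of `A`, by
`jmPowerSum_insert`. This form shows that it is central. -/
def jmPowerSum (m : ℕ) (A : Finset α) : PermAlg α := pairSum (weight m) A

theorem jmPowerSum_empty (m : ℕ) : jmPowerSum m (∅ : Finset α) = 0 := by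
  simp [jmPowerSum, pairSum, weight, weightSeries_empty]

theorem jmPowerSum_insert (m : ℕ) {i : α} {B : Finset α} (hi : i ∉ B) :
    jmPowerSum m (insert i B) = jmPowerSum m B + jucysMurphy i B ^ m := by
  rw [jmPowerSum, pairSum, Finset.sum_powerset_insert hi, jucysMurphy_pow m hi]
  rfl

end PartialPerm

/-! ### Contents as eigenvalues -/

section Contents

variable {α : Type*} [Fintype α] [DecidableEq α]

/-- The content of the cell of `x`: column index minus row index. -/
def content (pos : α → ℕ × ℕ) (x : α) : ℚ := ((pos x).2 : ℚ) - (pos x).1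

/-- A transposition of two entries acts between the row sum and the column sum by `1` if the
entries are in the same row, by `-1` if they are in the same column, and by `0` otherwise. -/
theorem IsTableau.rowSum_mul_swap_mul_colSum {pos : α → ℕ × ℕ} {A : Finset α}
    (hA : IsTableau pos A) {x y : α} (hx : x ∈ A) (hy : y ∈ A) (hxy : x ≠ y) :
    rowSum pos A * MonoidAlgebra.single (swap x y) 1 * colSum pos A =
      ((if (pos x).1 = (pos y).1 then 1 else 0) - (if (pos x).2 = (pos y).2 then 1 else 0) : ℚ) •
        symmetrizer pos A := by
  have hzero : ∀ u ∈ A, ∀ v ∈ A, u ≠ v → (pos v).1 < (pos u).1 → (pos u).2 ≠ (pos v).2 →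
      rowSum pos A * MonoidAlgebra.single (swap u v) 1 * colSum pos A = 0 := by
    intro u hu v hv huv hr hc
    obtain ⟨w, hw, hw'⟩ := hA.lower u hu ((pos v).1, (pos u).2) ⟨hr.le, le_rfl⟩
    have hwu : w ≠ u := by
      rintro rfl
      rw [hw'] at hr
      exact lt_irrefl _ hr
    have hwv : w ≠ v := by
      rintro rfl
      exact hc (by rw [hw'])
    refine rowSum_mul_single_mul_colSum_eq_zero (swap_mem_supportedIn hu hv) hu hw hwu.symm
      (by rw [hw']) ?_
    rw [swap_apply_left, swap_apply_of_ne_of_ne hwu hwv, hw']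
  by_cases hr : (pos x).1 = (pos y).1
  · have hc : (pos x).2 ≠ (pos y).2 := fun hc => hxy (hA.injOn hx hy (Prod.ext hr hc))
    have h1 : rowSum pos A * MonoidAlgebra.single (swap x y) 1 = rowSum pos A :=
      charSum_mul_single 1 (swap_mem_fiberGroup hx hy hr)
    rw [h1, if_pos hr, if_neg hc, sub_zero, one_smul, symmetrizer]
  · by_cases hc : (pos x).2 = (pos y).2
    · have h2 : MonoidAlgebra.single (swap x y) (-1) * colSum pos A = colSum pos A := by
        have h3 := single_mul_charSum (signHom α) (swap_mem_fiberGroup (g := fun x => (pos x).2)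
          hx hy hc)
        rwa [signHom_apply, Perm.sign_swap hxy, Units.val_neg, Units.val_one, Int.cast_neg,
          Int.cast_one] at h3
      have h3 : MonoidAlgebra.single (swap x y) 1 * colSum pos A = -colSum pos A := by
        conv_rhs => rw [← h2]
        rw [MonoidAlgebra.single_neg, neg_mul, neg_neg]
      rw [mul_assoc, h3, if_neg hr, if_pos hc, mul_neg, zero_sub, neg_smul, one_smul, symmetrizer]
    · rw [if_neg hr, if_neg hc, sub_zero, zero_smul]
      rcases lt_or_gt_of_ne hr with h | h
      · rw [swap_comm]
        exact hzero y hy x hx hxy.symm h (Ne.symm hc)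
      · exact hzero x hx y hy hxy h hc

theorem card_filter_eq_of_image {A : Finset α} {g : α → ℕ} {n : ℕ} {q : α → Prop}
    [DecidablePred q] (hinj : Set.InjOn g (A.filter q : Finset α))
    (h : ∀ y ∈ A, q y → g y < n) (h' : ∀ c < n, ∃ y ∈ A, q y ∧ g y = c) :
    (A.filter q).card = n := by
  rw [← Finset.card_image_of_injOn hinj, show (A.filter q).image g = Finset.range n from ?_,
    Finset.card_range]
  ext c
  rw [Finset.mem_image, Finset.mem_range]
  constructor
  · rintro ⟨y, hy, rfl⟩
    exact h y (Finset.mem_filter.1 hy).1 (Finset.mem_filter.1 hy).2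
  · intro hc
    obtain ⟨y, hy, hy', rfl⟩ := h' c hc
    exact ⟨y, Finset.mem_filter.2 ⟨hy, hy'⟩, rfl⟩

/-- The Jucys–Murphy element of a corner acts between row sum and column sum by the content of the
corner. -/
theorem IsTableau.rowSum_mul_jucysMurphy_mul_colSum {pos : α → ℕ × ℕ} {A : Finset α}
    (hA : IsTableau pos A) {x : α} (hx : x ∈ A) (hmax : ∀ y ∈ A, pos x ≤ pos y → y = x) :
    rowSum pos A * jucysMurphy x (A.erase x) * colSum pos A =
      content pos x • symmetrizer pos A := by
  have h1 : ∀ y ∈ A.erase x, rowSum pos A * MonoidAlgebra.single (swap x y) 1 * colSum pos A =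
      ((if (pos x).1 = (pos y).1 then 1 else 0) - (if (pos x).2 = (pos y).2 then 1 else 0) : ℚ) •
        symmetrizer pos A := fun y hy =>
    hA.rowSum_mul_swap_mul_colSum hx (Finset.mem_erase.1 hy).2 (Finset.mem_erase.1 hy).1.symm
  rw [jucysMurphy, Finset.mul_sum, Finset.sum_mul, Finset.sum_congr rfl h1, ← Finset.sum_smul,
    Finset.sum_sub_distrib, Finset.sum_boole, Finset.sum_boole, content]
  have hinj : Set.InjOn pos (A.erase x) :=
    hA.injOn.mono (Finset.coe_subset.2 (Finset.erase_subset _ _))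
  have hrow : ((A.erase x).filter fun y => (pos x).1 = (pos y).1).card = (pos x).2 := by
    refine card_filter_eq_of_image (g := fun y => (pos y).2) ?_ ?_ ?_
    · intro y hy z hz hyz
      obtain ⟨hy1, hy2⟩ := Finset.mem_filter.1 hy
      obtain ⟨hz1, hz2⟩ := Finset.mem_filter.1 hz
      exact hinj hy1 hz1 (Prod.ext (hy2.symm.trans hz2) hyz)
    · intro y hy hr
      by_contra h
      exact (Finset.mem_erase.1 hy).1 (hmax y (Finset.mem_erase.1 hy).2 ⟨hr.le, not_lt.1 h⟩)
    · intro c hc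
      obtain ⟨y, hy, hy'⟩ := hA.lower x hx ((pos x).1, c) ⟨le_rfl, hc.le⟩
      refine ⟨y, Finset.mem_erase.2 ⟨?_, hy⟩, by rw [hy'], by rw [hy']⟩
      rintro rfl
      rw [hy'] at hc
      exact lt_irrefl _ hc
  have hcol : ((A.erase x).filter fun y => (pos x).2 = (pos y).2).card = (pos x).1 := by
    refine card_filter_eq_of_image (g := fun y => (pos y).1) ?_ ?_ ?_
    · intro y hy z hz hyz
      obtain ⟨hy1, hy2⟩ := Finset.mem_filter.1 hy
      obtain ⟨hz1, hz2⟩ := Finset.mem_filter.1 hz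
      exact hinj hy1 hz1 (Prod.ext hyz (hy2.symm.trans hz2))
    · intro y hy hr
      by_contra h
      exact (Finset.mem_erase.1 hy).1 (hmax y (Finset.mem_erase.1 hy).2 ⟨not_lt.1 h, hr.le⟩)
    · intro c hc
      obtain ⟨y, hy, hy'⟩ := hA.lower x hx (c, (pos x).2) ⟨hc.le, le_rfl⟩
      refine ⟨y, Finset.mem_erase.2 ⟨?_, hy⟩, by rw [hy'], by rw [hy']⟩
      rintro rfl
      rw [hy'] at hc
      exact lt_irrefl _ hc
  rw [hrow, hcol]

theorem IsTableau.exists_corner {pos : α → ℕ × ℕ} {A : Finset α} (hA : IsTableau pos A)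
    (hne : A.Nonempty) : ∃ x ∈ A, (∀ y ∈ A, pos x ≤ pos y → y = x) ∧
      IsTableau pos (A.erase x) := by
  obtain ⟨x, hx, hmax⟩ := Finset.exists_max_image A (fun x => (pos x).1 + (pos x).2) hne
  have hmax' : ∀ y ∈ A, pos x ≤ pos y → y = x := by
    intro y hy hxy
    have h1 := hmax y hy
    have h2 : (pos x).1 ≤ (pos y).1 := hxy.1
    have h3 : (pos x).2 ≤ (pos y).2 := hxy.2
    exact hA.injOn hy hx (Prod.ext (by omega) (by omega))
  refine ⟨x, hx, hmax', hA.injOn.mono (Finset.coe_subset.2 (Finset.erase_subset _ _)),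
    fun y hy c hc => ?_⟩
  obtain ⟨hyx, hyA⟩ := Finset.mem_erase.1 hy
  obtain ⟨z, hz, rfl⟩ := hA.lower y hyA c hc
  exact ⟨z, Finset.mem_erase.2 ⟨fun h => hyx (hmax' y hyA (h ▸ hc)), hz⟩, rfl⟩

/-- Branching: row and column sums of a tableau absorb those of a smaller tableau. -/
theorem exists_mul_mul_eq_smul (pos : α → ℕ × ℕ) {A A' : Finset α} (h : A' ⊆ A) :
    ∃ t : ℚ, t ≠ 0 ∧ ∀ z, rowSum pos A * (rowSum pos A' * z * colSum pos A') * colSum pos A =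
      t • (rowSum pos A * z * colSum pos A) := by
  refine ⟨Nat.card (fiberGroup (fun x => (pos x).1) A') *
    Nat.card (fiberGroup (fun x => (pos x).2) A'),
    mul_ne_zero (card_subgroup_ne_zero _) (card_subgroup_ne_zero _), fun z => ?_⟩
  have h1 : rowSum pos A * rowSum pos A' = _ := charSum_mul_charSum' (fiberGroup_mono _ h) 1
  have h2 : colSum pos A' * colSum pos A = _ := charSum_mul_charSum (fiberGroup_mono _ h) _
  calc _ = (rowSum pos A * rowSum pos A') * z * (colSum pos A' * colSum pos A) := by
        simp only [mul_assoc]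
    _ = _ := by rw [h1, h2, smul_mul_assoc, smul_mul_smul_comm]; rfl

/-- The `m`-th power sum of the Jucys–Murphy elements acts on a Young symmetrizer by the `m`-th
power sum of the contents. For the step from `A' = A \ {x}` to `A`, the element `y = e' b e`, with
`e = a b` and `e'` the symmetrizers of `A` and `A'`, is a common eigenvector of the power sums of
`A` and of `A'`, hence of all powers of the Jucys–Murphy element of `x`; it suffices to know the
eigenvalue of the latter itself. -/
theorem IsTableau.jmPowerSum_mul_symmetrizer {pos : α → ℕ × ℕ} {A : Finset α}
    (hA : IsTableau pos A) (m : ℕ) :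
    jmPowerSum m A * symmetrizer pos A = (∑ x ∈ A, content pos x ^ m) • symmetrizer pos A := by
  induction hn : A.card generalizing A m with
  | zero =>
    rw [Finset.card_eq_zero] at hn
    subst hn
    rw [jmPowerSum_empty, zero_mul, Finset.sum_empty, zero_smul]
  | succ n ih =>
    obtain ⟨x, hx, hmax, hA'⟩ := hA.exists_corner (Finset.card_pos.1 (by omega))
    set A' := A.erase x with hA'def
    have hsub : A' ⊆ A := Finset.erase_subset _ _
    have hins : insert x A' = A := Finset.insert_erase hx
    have ih' := fun m => ih hA' m (by rw [hA'def, Finset.card_erase_of_mem hx, hn]; rfl)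
    have hG : ∀ m, jmPowerSum m A = jmPowerSum m A' + jucysMurphy x A' ^ m := fun m => by
      rw [← hins]
      exact jmPowerSum_insert m (Finset.notMem_erase x A)
    have hcomm : ∀ m, ∀ σ ∈ supportedIn A, Commute (jmPowerSum m A) (MonoidAlgebra.single σ 1) :=
      fun m σ hσ => (weight_conjInvariant m).commute_pairSum hσ
    have hcomm' : ∀ m, ∀ σ ∈ supportedIn A',
        Commute (jmPowerSum m A') (MonoidAlgebra.single σ 1) :=
      fun m σ hσ => (weight_conjInvariant m).commute_pairSum hσ
    have hex : ∀ m, ∃ κ : ℚ, jmPowerSum m A * symmetrizer pos A = κ • symmetrizer pos A := fun m =>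
      hA.exists_mul_symmetrizer (fun σ hσ => coeff_pairSum_eq_zero (weight m) hσ) (hcomm m)
    choose κ hκ using hex
    set κ' : ℕ → ℚ := fun m => ∑ y ∈ A', content pos y ^ m with hκ'
    obtain ⟨t, ht, hbr⟩ := exists_mul_mul_eq_smul pos hsub
    have hbr1 : rowSum pos A * symmetrizer pos A' * colSum pos A = t • symmetrizer pos A := by
      have h1 := hbr 1
      rwa [mul_one, mul_one] at h1
    have cR : ∀ m, Commute (jmPowerSum m A) (rowSum pos A) := fun m =>
      commute_charSum (fun σ hσ => hcomm m σ (fiberGroup_le _ _ hσ)) _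
    have cC : ∀ m, Commute (jmPowerSum m A) (colSum pos A) := fun m =>
      commute_charSum (fun σ hσ => hcomm m σ (fiberGroup_le _ _ hσ)) _
    have cR' : ∀ m, Commute (jmPowerSum m A) (rowSum pos A') := fun m =>
      commute_charSum (fun σ hσ => hcomm m σ (supportedIn_mono hsub (fiberGroup_le _ _ hσ))) _
    have cC' : ∀ m, Commute (jmPowerSum m A) (colSum pos A') := fun m =>
      commute_charSum (fun σ hσ => hcomm m σ (supportedIn_mono hsub (fiberGroup_le _ _ hσ))) _
    have cR'' : ∀ m, Commute (jmPowerSum m A') (rowSum pos A') := fun m =>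
      commute_charSum (fun σ hσ => hcomm' m σ (fiberGroup_le _ _ hσ)) _
    -- the difference of the eigenvalues for `m = 1`
    have hone : κ 1 - κ' 1 = content pos x := by
      have e1 : rowSum pos A * jmPowerSum 1 A * colSum pos A = κ 1 • symmetrizer pos A := by
        rw [← (cR 1).eq, mul_assoc]
        exact hκ 1
      have e2 : rowSum pos A * jmPowerSum 1 A' * colSum pos A = κ' 1 • symmetrizer pos A := by
        have h1 : t • (rowSum pos A * jmPowerSum 1 A' * colSum pos A) =
            t • (κ' 1 • symmetrizer pos A) := by
          rw [← hbr, ← (cR'' 1).eq, mul_assoc (jmPowerSum 1 A'), ← symmetrizer, ih' 1,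
            mul_smul_comm, smul_mul_assoc, hbr1, smul_comm]
        exact smul_right_injective _ ht h1
      have e3 := hA.rowSum_mul_jucysMurphy_mul_colSum hx hmax
      rw [hG 1, pow_one, mul_add, add_mul, e2, e3, ← add_smul] at e1
      have := smul_left_injective ℚ hA.symmetrizer_ne_zero e1
      linarith
    set y := symmetrizer pos A' * colSum pos A * symmetrizer pos A with hy
    have hy0 : y ≠ 0 := by
      intro h
      apply hA.symmetrizer_sq_ne_zero
      have h1 : t • (symmetrizer pos A * symmetrizer pos A) = rowSum pos A * y := by
        rw [← smul_mul_assoc, ← hbr1, hy]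
        simp only [mul_assoc]
      rw [h, mul_zero] at h1
      exact (smul_eq_zero.1 h1).resolve_left ht
    have hX : ∀ m, jucysMurphy x A' ^ m * y = (κ m - κ' m) • y := by
      intro m
      have h1 : jmPowerSum m A * y = κ m • y := by
        have c1 : Commute (jmPowerSum m A) (symmetrizer pos A' * colSum pos A) :=
          ((cR' m).mul_right (cC' m)).mul_right (cC m)
        rw [hy, ← mul_assoc, c1.eq, mul_assoc, hκ m, mul_smul_comm]
      have h2 : jmPowerSum m A' * y = κ' m • y := by
        rw [hy, mul_assoc, ← mul_assoc, ih' m, smul_mul_assoc]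
      rw [sub_smul, ← h1, ← h2, hG m, add_mul, add_sub_cancel_left]
    have hXm : ∀ m, jucysMurphy x A' ^ m * y = (content pos x ^ m) • y := by
      intro m
      induction m with
      | zero => simp
      | succ m ihm =>
        have h1 := hX 1
        rw [pow_one, hone] at h1
        rw [pow_succ, mul_assoc, h1, mul_smul_comm, ihm, smul_smul, pow_succ, mul_comm]
    have h1 : κ m - κ' m = content pos x ^ m :=
      smul_left_injective ℚ hy0 ((hX m).symm.trans (hXm m))
    rw [hκ m, ← Finset.add_sum_erase A _ hx]
    congr 1
    simp only [hκ'] at h1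
    linarith

end Contents

/-! ### Cycle lengths and cycle types -/

section CycleType

variable {α : Type*} [Fintype α] [DecidableEq α]

theorem sum_cycleLengths {σ : Perm α} {A : Finset α} (hσ : σ ∈ supportedIn A) :
    (cycleLengths σ A).sum = A.card := by
  have h := sum_cycles hσ fun _ => 1
  simp only [smul_eq_mul, mul_one, Finset.sum_const] at h
  exact h

theorem pos_of_mem_cycleLengths {σ : Perm α} {A : Finset α} {n : ℕ} (h : n ∈ cycleLengths σ A) :
    0 < n := by
  obtain ⟨B, hB, rfl⟩ := Multiset.mem_map.1 h
  obtain ⟨x, -, rfl⟩ := Finset.mem_image.1 hB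
  exact (card_orb_spec σ x).1

theorem orb_eq_support_cycleOf {σ : Perm α} {x : α} (hx : σ x ≠ x) :
    orb σ x = (σ.cycleOf x).support := by
  ext y
  rw [mem_orb, Perm.mem_support_cycleOf_iff' hx]

theorem filter_cycleLengths {σ : Perm α} {A : Finset α} (hσ : σ ∈ supportedIn A) :
    (cycleLengths σ A).filter (fun n => 2 ≤ n) = σ.cycleType := by
  have hinj : Set.InjOn Perm.support (σ.cycleFactorsFinset : Set (Perm α)) := by
    intro c hc d hd hcd
    by_contra hne
    have h1 := (σ.cycleFactorsFinset_pairwise_disjoint hc hd hne).disjoint_support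
    rw [← hcd, disjoint_self, Finset.bot_eq_empty, Perm.support_eq_empty_iff] at h1
    exact (Perm.mem_cycleFactorsFinset_iff.1 hc).1.ne_one h1
  have hset : (cycles σ A).filter (fun B => 2 ≤ B.card) =
      σ.cycleFactorsFinset.image Perm.support := by
    ext B
    simp only [cycles, Finset.mem_filter, Finset.mem_image]
    constructor
    · rintro ⟨⟨x, hx, rfl⟩, h2⟩
      have hx' : σ x ≠ x := fun h => by
        rw [orb_eq_singleton h, Finset.card_singleton] at h2
        omega
      exact ⟨σ.cycleOf x, Perm.cycleOf_mem_cycleFactorsFinset_iff.2 (Perm.mem_support.2 hx'),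
        (orb_eq_support_cycleOf hx').symm⟩
    · rintro ⟨c, hc, rfl⟩
      obtain ⟨hcyc, hc'⟩ := Perm.mem_cycleFactorsFinset_iff.1 hc
      obtain ⟨x, hx⟩ := hcyc.nonempty_support
      have hx' : σ x ≠ x := by
        rw [← hc' x hx]
        exact Perm.mem_support.1 hx
      have hcx : c = σ.cycleOf x := Perm.cycle_is_cycleOf hx hc
      refine ⟨⟨x, ?_, ?_⟩, hcyc.two_le_card_support⟩
      · by_contra hxA
        exact hx' (hσ x hxA)
      · rw [orb_eq_support_cycleOf hx', ← hcx]
  rw [Perm.cycleType_def, cycleLengths, Multiset.filter_map]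
  have h1 := Finset.image_val_of_injOn hinj
  rw [← hset, Finset.filter_val] at h1
  rw [← Multiset.map_map, ← h1]
  rfl

theorem multiset_eq_of_filter_eq {s t : Multiset ℕ} (hs : ∀ n ∈ s, 0 < n) (ht : ∀ n ∈ t, 0 < n)
    (hsum : s.sum = t.sum) (h : s.filter (fun n => 2 ≤ n) = t.filter (fun n => 2 ≤ n)) : s = t := by
  have key : ∀ u : Multiset ℕ, (∀ n ∈ u, 0 < n) → u = u.filter (fun n => 2 ≤ n) +
      Multiset.replicate (u.sum - (u.filter fun n => 2 ≤ n).sum) 1 := by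
    intro u hu
    have h1 : u.filter (fun n => ¬ 2 ≤ n) =
        Multiset.replicate (u.filter fun n => ¬ 2 ≤ n).card 1 := by
      refine Multiset.eq_replicate_card.2 fun b hb => ?_
      have hb' := Multiset.mem_filter.1 hb
      have := hu b hb'.1
      omega
    have h2 : u.sum - (u.filter fun n => 2 ≤ n).sum = (u.filter fun n => ¬ 2 ≤ n).card := by
      have h3 := congrArg Multiset.sum (Multiset.filter_add_not (fun n => 2 ≤ n) u)
      rw [Multiset.sum_add, h1, Multiset.sum_replicate, smul_eq_mul, mul_one] at h3
      omega
    rw [h2, ← h1, Multiset.filter_add_not]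
  rw [key s hs, key t ht, hsum, h]

theorem cycleLengths_eq_of_cycleType_eq {β : Type*} [Fintype β] [DecidableEq β]
    {σ : Perm α} {A : Finset α}
    (hσ : σ ∈ supportedIn A) {τ : Perm β} {B : Finset β} (hτ : τ ∈ supportedIn B)
    (hc : A.card = B.card) (h : σ.cycleType = τ.cycleType) :
    cycleLengths σ A = cycleLengths τ B :=
  multiset_eq_of_filter_eq (fun _ => pos_of_mem_cycleLengths) (fun _ => pos_of_mem_cycleLengths)
    (by rw [sum_cycleLengths hσ, sum_cycleLengths hτ, hc])
    (by rw [filter_cycleLengths hσ, filter_cycleLengths hτ, h])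

theorem mem_supportedIn_univ (σ : Perm α) : σ ∈ supportedIn (Finset.univ : Finset α) :=
  fun x hx => absurd (Finset.mem_univ x) hx

theorem parts_partition_eq (σ : Perm α) : σ.partition.parts = cycleLengths σ Finset.univ :=
  multiset_eq_of_filter_eq (fun _ => σ.partition.parts_pos) (fun _ => pos_of_mem_cycleLengths)
    (by rw [sum_cycleLengths (mem_supportedIn_univ σ), σ.partition.parts_sum, Finset.card_univ])
    (by rw [filter_cycleLengths (mem_supportedIn_univ σ), Perm.filter_parts_partition_eq_cycleType])

theorem hasType_iff {d : ℕ} (σ : Perm (Fin d)) (μ : YoungDiagram) :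
    HasType σ μ ↔ cycleLengths σ Finset.univ = (μ.rowLens : Multiset ℕ) := by
  rw [HasType, parts_partition_eq]

/-- The permutations of `A` correspond to those of `Fin d`, `d = |A|`. -/
theorem card_filter_cycleLengths (A : Finset α) (s : Multiset ℕ) :
    ((permsIn A).filter fun σ => cycleLengths σ A = s).card =
      ((Finset.univ : Finset (Perm (Fin A.card))).filter
        fun τ => cycleLengths τ Finset.univ = s).card := by
  classical
  set e : Fin A.card ≃ {x // x ∈ A} := A.equivFin.symm
  have hmem : ∀ τ : Perm (Fin A.card), τ.extendDomain e ∈ supportedIn A := fun τ x hx =>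
    Perm.extendDomain_apply_not_subtype τ e hx
  have hlen : ∀ τ : Perm (Fin A.card),
      cycleLengths (τ.extendDomain e) A = cycleLengths τ Finset.univ := fun τ =>
    cycleLengths_eq_of_cycleType_eq (hmem τ) (mem_supportedIn_univ τ) (by simp)
      (Perm.cycleType_extendDomain e)
  symm
  refine Finset.card_bij (fun τ _ => τ.extendDomain e) ?_ ?_ ?_
  · intro τ hτ
    exact Finset.mem_filter.2 ⟨mem_permsIn.2 (hmem τ), by
      rw [hlen]; exact (Finset.mem_filter.1 hτ).2⟩
  · intro τ _ τ' _ h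
    exact Perm.extendDomainHom_injective e h
  · intro σ hσ
    obtain ⟨h1, h2⟩ := Finset.mem_filter.1 hσ
    have h3 := mem_permsIn.1 h1
    have h4 : (e.symm.permCongr (σ.subtypePerm (p := (· ∈ A)) fun x =>
        apply_mem_iff h3 x)).extendDomain e = σ := by
      ext x
      by_cases hx : x ∈ A
      · rw [Perm.extendDomain_apply_subtype _ _ hx]
        simp
      · rw [Perm.extendDomain_apply_not_subtype _ _ hx, h3 x hx]
    refine ⟨_, Finset.mem_filter.2 ⟨Finset.mem_univ _, ?_⟩, h4⟩
    rw [← hlen, h4, h2]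

end CycleType

/-! ### Central characters of Specht modules -/

section CentralCharacter

/-- The cell of an entry of the standard tableau of shape `lam`. -/
def cellPos (lam : YoungDiagram) (i : Fin lam.card) : ℕ × ℕ := (tableau lam i).1

theorem cellPos_mem (lam : YoungDiagram) (i : Fin lam.card) : cellPos lam i ∈ lam.cells :=
  (tableau lam i).2

theorem isTableau_cellPos (lam : YoungDiagram) : IsTableau (cellPos lam) Finset.univ where
  injOn := fun _ _ _ _ h => (tableau lam).injective (Subtype.ext h)
  lower := fun x _ c hc => by
    have h1 : c ∈ lam.cells := lam.isLowerSet hc (cellPos_mem lam x)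
    exact ⟨(tableau lam).symm ⟨c, h1⟩, Finset.mem_univ _, by rw [cellPos, apply_symm_apply]⟩

theorem sum_cellPos {M : Type*} [AddCommMonoid M] (lam : YoungDiagram) (g : ℕ × ℕ → M) :
    ∑ i, g (cellPos lam i) = ∑ c ∈ lam.cells, g c := by
  rw [← Finset.sum_coe_sort lam.cells]
  exact Fintype.sum_equiv (tableau lam) _ _ fun _ => rfl

theorem youngSymmetrizer_eq (lam : YoungDiagram) :
    youngSymmetrizer lam = symmetrizer (cellPos lam) Finset.univ := by
  classical
  rw [youngSymmetrizer, symmetrizer, rowSum, colSum, charSum, charSum]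
  congr 1
  · refine Finset.sum_congr ?_ fun _ _ => rfl
    ext σ
    simp only [rowStabilizer, Finset.mem_filter, Finset.mem_univ, true_and, mem_fiberGroup,
      mem_supportedIn_univ]
    rfl
  · refine Finset.sum_congr ?_ fun _ _ => rfl
    ext σ
    simp only [colStabilizer, Finset.mem_filter, Finset.mem_univ, true_and, mem_fiberGroup,
      mem_supportedIn_univ]
    rfl

theorem coeff_youngSymmetrizer_one (lam : YoungDiagram) : (youngSymmetrizer lam).coeff 1 = 1 := by
  rw [youngSymmetrizer_eq]
  exact (isTableau_cellPos lam).coeff_symmetrizer_one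

/-- The eigenvalue of a central element `z` on the Young symmetrizer of shape `lam`, read off at
the identity permutation, where the Young symmetrizer has coefficient `1`. -/
def centralChar (lam : YoungDiagram) : GroupAlg lam.card →ₗ[ℚ] ℚ where
  toFun z := (z * youngSymmetrizer lam).coeff 1
  map_add' z w := by rw [add_mul]; rfl
  map_smul' r z := by rw [smul_mul_assoc]; rfl

theorem centralChar_eq_of_mul {lam : YoungDiagram} {z : GroupAlg lam.card} {κ : ℚ}
    (h : z * youngSymmetrizer lam = κ • youngSymmetrizer lam) : centralChar lam z = κ := by
  change (z * youngSymmetrizer lam).coeff 1 = κ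
  rw [h, MonoidAlgebra.coeff_smul, Finsupp.smul_apply, coeff_youngSymmetrizer_one, smul_eq_mul,
    mul_one]

theorem mul_youngSymmetrizer {lam : YoungDiagram} {z : GroupAlg lam.card}
    (hz : z ∈ ClassAlg lam.card) :
    z * youngSymmetrizer lam = centralChar lam z • youngSymmetrizer lam := by
  obtain ⟨κ, hκ⟩ := (isTableau_cellPos lam).exists_mul_symmetrizer (z := z)
    (fun σ hσ => absurd (mem_supportedIn_univ σ) hσ)
    (fun σ _ => ((Subalgebra.mem_center_iff.1 hz) _).symm)
  rw [← youngSymmetrizer_eq] at hκ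
  rw [centralChar_eq_of_mul hκ, hκ]

theorem centralChar_one (lam : YoungDiagram) : centralChar lam 1 = 1 :=
  centralChar_eq_of_mul (by rw [one_mul, one_smul])

theorem centralChar_mul {lam : YoungDiagram} {z w : GroupAlg lam.card} (hz : z ∈ ClassAlg lam.card)
    (hw : w ∈ ClassAlg lam.card) :
    centralChar lam (z * w) = centralChar lam z * centralChar lam w :=
  centralChar_eq_of_mul (by
    rw [mul_assoc, mul_youngSymmetrizer hw, mul_smul_comm, mul_youngSymmetrizer hz, smul_smul,
      mul_comm])

theorem ConjInvariant.pairSum_mem {d : ℕ} {F : Finset (Fin d) → Perm (Fin d) → ℚ}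
    (hF : ConjInvariant F) : pairSum F Finset.univ ∈ ClassAlg d := by
  rw [Subalgebra.mem_center_iff]
  intro b
  rw [eq_sum_single b, Finset.mul_sum, Finset.sum_mul]
  refine Finset.sum_congr rfl fun σ _ => ?_
  have h1 : (MonoidAlgebra.single σ (b.coeff σ) : GroupAlg d) =
      b.coeff σ • MonoidAlgebra.single σ 1 := by simp
  rw [h1, smul_mul_assoc, mul_smul_comm, (hF.commute_pairSum (mem_supportedIn_univ σ)).eq]

/-- The central character of a power sum of Jucys–Murphy elements. -/
theorem centralChar_jmPowerSum (lam : YoungDiagram) (m : ℕ) :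
    centralChar lam (jmPowerSum m Finset.univ) =
      ∑ c ∈ lam.cells, ((c.2 : ℚ) - c.1) ^ m := by
  apply centralChar_eq_of_mul
  rw [youngSymmetrizer_eq, (isTableau_cellPos lam).jmPowerSum_mul_symmetrizer m,
    ← sum_cellPos lam fun c => ((c.2 : ℚ) - c.1) ^ m]
  rfl

open Classical in
/-- The indicator function of the partial permutations of cycle type `η`. -/
def typeIndicator {α : Type*} [Fintype α] [DecidableEq α] (η : YoungDiagram) (A : Finset α)
    (σ : Perm α) : ℚ :=
  if cycleLengths σ A = (η.rowLens : Multiset ℕ) then 1 else 0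

theorem typeIndicator_conjInvariant {α : Type*} [Fintype α] [DecidableEq α] (η : YoungDiagram) :
    ConjInvariant (α := α) (typeIndicator η) := by
  intro τ B σ
  rw [typeIndicator, typeIndicator, cycleLengths_conj]

/-- The sum over all partial permutations of cycle type `η`, in the group algebra of `S(d)`. -/
def partialClassSum (d : ℕ) (η : YoungDiagram) : GroupAlg d :=
  pairSum (typeIndicator η) Finset.univ

theorem partialClassSum_mem (d : ℕ) (η : YoungDiagram) : partialClassSum d η ∈ ClassAlg d :=
  (typeIndicator_conjInvariant η).pairSum_mem

/-- The trace of the action of the group algebra on the Specht module. -/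
def spechtTrace (lam : YoungDiagram) : GroupAlg lam.card →ₗ[ℚ] ℚ :=
  (LinearMap.trace ℚ (specht lam)) ∘ₗ (Algebra.lsmul ℚ ℚ (specht lam)).toLinearMap

theorem spechtTrace_single (lam : YoungDiagram) (σ : Perm (Fin lam.card)) :
    spechtTrace lam (MonoidAlgebra.single σ 1) = (spechtRep lam).character σ := rfl

theorem spechtTrace_of_mem {lam : YoungDiagram} {z : GroupAlg lam.card}
    (hz : z ∈ ClassAlg lam.card) : spechtTrace lam z = centralChar lam z * dim lam := by
  have h1 : (Algebra.lsmul ℚ ℚ (specht lam)) z = centralChar lam z • LinearMap.id := by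
    ext ⟨v, hv⟩ : 2
    obtain ⟨x, rfl⟩ := Submodule.mem_span_singleton.1 hv
    change z * (x * youngSymmetrizer lam) = centralChar lam z • (x * youngSymmetrizer lam)
    rw [← mul_assoc, ← (Subalgebra.mem_center_iff.1 hz) x, mul_assoc, mul_youngSymmetrizer hz,
      mul_smul_comm]
  rw [spechtTrace, LinearMap.comp_apply, AlgHom.toLinearMap_apply, h1, map_smul,
    LinearMap.trace_id, smul_eq_mul, dim]

theorem dim_ne_zero (lam : YoungDiagram) : (dim lam : ℚ) ≠ 0 := by
  have hfin : Module.Finite ℚ (GroupAlg lam.card) :=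
    Module.Finite.equiv (MonoidAlgebra.coeffLinearEquiv ℚ).symm
  have hfin' : Module.Finite ℚ (specht lam) :=
    Module.Finite.of_injective ((specht lam).subtype.restrictScalars ℚ) Subtype.val_injective
  have hnt : Nontrivial (specht lam) := by
    refine ⟨⟨⟨youngSymmetrizer lam, Submodule.mem_span_singleton_self _⟩, 0, fun h => ?_⟩⟩
    have h1 := coeff_youngSymmetrizer_one lam
    have h2 : youngSymmetrizer lam = 0 := congrArg Subtype.val h
    rw [h2] at h1
    exact zero_ne_one h1
  exact Nat.cast_ne_zero.2 (Module.finrank_pos (R := ℚ) (M := specht lam)).ne'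

theorem character_eq_chi {lam η : YoungDiagram} {A : Finset (Fin lam.card)}
    {σ : Perm (Fin lam.card)} (hσ : σ ∈ supportedIn A)
    (h : cycleLengths σ A = (η.rowLens : Multiset ℕ)) :
    (spechtRep lam).character σ = chi lam η := by
  have hcard : η.card = A.card := by
    rw [← sum_cycleLengths hσ, h, Multiset.sum_coe, rowLens_sum]
  have hle : η.card ≤ lam.card := by
    rw [hcard]
    exact (Finset.card_le_univ A).trans (by simp)
  rw [chi, dif_pos hle]
  have h1 : ((rep η).viaFintypeEmbedding (Fin.castLEEmb hle)).cycleType = (rep η).cycleType :=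
    Perm.cycleType_extendDomain _
  have h2 : (rep η).cycleType = σ.cycleType := by
    rw [← filter_cycleLengths hσ, h, ← filter_cycleLengths (mem_supportedIn_univ (rep η)),
      (hasType_iff _ _).1 (rep_hasType η)]
  obtain ⟨τ, hτ⟩ := isConj_iff.1 (Perm.isConj_of_cycleType_eq (h2.symm.trans h1.symm))
  rw [← hτ, Representation.char_conj]

/-- The normalized character `f_η(lam)` is the central character of the sum of all partial
permutations of type `η`. -/
theorem f_eq_centralChar (η lam : YoungDiagram) :
    f η lam = centralChar lam (partialClassSum lam.card η) := by
  classical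
  have h1 : spechtTrace lam (partialClassSum lam.card η) =
      (lam.card.choose η.card : ℚ) * ((conjClass η.card η).card : ℚ) * chi lam η := by
    have h2 : ∀ A : Finset (Fin lam.card), ∑ σ ∈ permsIn A,
        spechtTrace lam (MonoidAlgebra.single σ (typeIndicator η A σ)) =
        if A.card = η.card then ((conjClass η.card η).card : ℚ) * chi lam η else 0 := by
      intro A
      have h3 : ∀ σ ∈ permsIn A, spechtTrace lam (MonoidAlgebra.single σ (typeIndicator η A σ)) =
          if cycleLengths σ A = (η.rowLens : Multiset ℕ) then chi lam η else 0 := by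
        intro σ hσ
        rw [typeIndicator]
        split_ifs with h
        · rw [spechtTrace_single, character_eq_chi (mem_permsIn.1 hσ) h]
        · rw [MonoidAlgebra.single_zero, map_zero]
      rw [Finset.sum_congr rfl h3, ← Finset.sum_filter, Finset.sum_const, nsmul_eq_mul,
        card_filter_cycleLengths]
      split_ifs with hA
      · congr 2
        rw [conjClass, ← hA]
        congr 1
        ext τ
        simp [hasType_iff]
      · rw [Finset.filter_false_of_mem, Finset.card_empty, Nat.cast_zero, zero_mul]
        intro τ _ h
        apply hA
        have h4 := sum_cycleLengths (mem_supportedIn_univ τ)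
        rw [h, Multiset.sum_coe, rowLens_sum] at h4
        simpa using h4.symm
    rw [partialClassSum, pairSum, map_sum]
    simp only [map_sum, h2]
    rw [← Finset.sum_filter, Finset.sum_const, nsmul_eq_mul, mul_assoc,
      ← Finset.powersetCard_eq_filter,
      Finset.card_powersetCard, Finset.card_univ, Fintype.card_fin]
  rw [spechtTrace_of_mem (partialClassSum_mem _ _)] at h1
  rw [f, mul_div_assoc', ← h1, mul_div_cancel_right₀ _ (dim_ne_zero lam)]

end CentralCharacter

/-! ### The coefficients of the completed cycles -/

section Coefficients

open PowerSeries

/-- The coefficient of `C_μ` in the completed `k`-cycle, written with hyperbolic sines. -/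
def rho (k : ℕ) (μ : YoungDiagram) : ℚ :=
  ((k - 1).factorial : ℚ) * coeff (k + 1) (S⁻¹ * ((1 / (μ.card.factorial : ℚ)) •
    (sh 1 ^ μ.card * (μ.rowLens.map sh).prod)))

theorem prod_map_sh (l : List ℕ) : (l.map sh).prod =
    PowerSeries.C (l.prod : ℚ) * X ^ l.length * (l.map fun m : ℕ => rescale (m : ℚ) S).prod := by
  induction l with
  | nil => simp
  | cons a l ih =>
    rw [List.map_cons, List.prod_cons, ih, sh_eq_rescale, List.prod_cons, List.length_cons,
      List.map_cons, List.prod_cons, Nat.cast_mul, map_mul, pow_succ]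
    have ha : (a : PowerSeries ℚ) = PowerSeries.C (a : ℚ) := by simp
    rw [ha]
    ring

/-- In the definition of `rhoSeries`, the list of the row lengths is cast to `ℚ` entry by entry
before the series are formed. -/
theorem rhoSeries_eq (μ : YoungDiagram) : rhoSeries μ =
    S ^ μ.card * S⁻¹ * (μ.rowLens.map fun m : ℕ => rescale (m : ℚ) S).prod := by
  rw [rhoSeries]
  congr 2
  induction μ.rowLens with
  | nil => rfl
  | cons a l ih => exact congrArg (rescale (a : ℚ) S :: ·) ih

theorem rho_eq (k : ℕ) (μ : YoungDiagram) : rho k μ =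
    if μ.card + μ.colLen 0 ≤ k + 1 then
      ((k - 1).factorial : ℚ) * ((μ.rowLens.prod : ℚ) / (μ.card.factorial : ℚ)) *
        coeff (k + 1 - (μ.card + μ.colLen 0)) (rhoSeries μ) else 0 := by
  have h1 : S⁻¹ * ((1 / (μ.card.factorial : ℚ)) • (sh 1 ^ μ.card * (μ.rowLens.map sh).prod)) =
      PowerSeries.C ((μ.rowLens.prod : ℚ) / (μ.card.factorial : ℚ)) *
        (X ^ (μ.card + μ.colLen 0) * rhoSeries μ) := by
    rw [prod_map_sh, rhoSeries_eq, YoungDiagram.length_rowLens, PowerSeries.smul_eq_C_mul,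
      sh_one_eq, one_div, div_eq_inv_mul, map_mul, pow_add, mul_pow]
    ring
  rw [rho, h1, coeff_C_mul, coeff_X_pow_mul']
  split_ifs
  · ring
  · ring

theorem rescale_neg_one_S : rescale (-1) S = S := by
  ext n
  rw [coeff_rescale, S, coeff_mk]
  split_ifs with h
  · rw [h.neg_one_pow, one_mul]
  · rw [mul_zero]

theorem rescale_neg_one_rhoSeries (μ : YoungDiagram) :
    rescale (-1) (rhoSeries μ) = rhoSeries μ := by
  have hS : S ≠ 0 := fun h => by
    have h1 := S_mul_inv
    rw [h, zero_mul] at h1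
    exact zero_ne_one h1
  have hinv : rescale (-1) S⁻¹ = S⁻¹ := by
    have h1 := congrArg (rescale (-1)) S_mul_inv
    rw [map_mul, map_one, rescale_neg_one_S, ← S_mul_inv] at h1
    exact mul_left_cancel₀ hS h1
  have hm : ∀ m : ℕ, rescale (-1) (rescale (m : ℚ) S) = rescale (m : ℚ) S := by
    intro m
    rw [rescale_rescale, mul_comm, ← rescale_rescale, rescale_neg_one_S]
  rw [rhoSeries_eq, map_mul, map_mul, map_pow, map_list_prod, rescale_neg_one_S, hinv, List.map_map]
  congr 3
  exact funext fun m => hm m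

theorem coeff_rhoSeries_of_odd (μ : YoungDiagram) {n : ℕ} (hn : Odd n) :
    coeff n (rhoSeries μ) = 0 := by
  have h1 := congrArg (coeff n) (rescale_neg_one_rhoSeries μ)
  rw [coeff_rescale, hn.neg_one_pow] at h1
  linarith

theorem rho_of_eq {k g : ℕ} {μ : YoungDiagram} (h : k + 1 = μ.card + μ.colLen 0 + 2 * g) :
    rho k μ = ((k - 1).factorial : ℚ) * ((μ.rowLens.prod : ℚ) / (μ.card.factorial : ℚ)) *
        coeff (2 * g) (rhoSeries μ) := by
  rw [rho_eq, if_pos (by omega), h, Nat.add_sub_cancel_left]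

theorem rho_of_not_exists {k : ℕ} {μ : YoungDiagram}
    (h : ¬ ∃ g : ℕ, k + 1 = μ.card + μ.colLen 0 + 2 * g) : rho k μ = 0 := by
  rw [rho_eq]
  split_ifs with h1
  · rw [coeff_rhoSeries_of_odd, mul_zero]
    rw [← Nat.not_even_iff_odd]
    rintro ⟨g, hg⟩
    exact h ⟨g, by omega⟩
  · rfl

theorem finite_card_eq (d : ℕ) : {μ : YoungDiagram | μ.card = d}.Finite := by
  choose ty hty using fun σ : Perm (Fin d) => exists_type σ
  refine (Set.finite_range ty).subset ?_
  rintro μ rfl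
  exact ⟨rep μ, (hty (rep μ)).unique (rep_hasType μ)⟩

theorem finite_support_rho (k : ℕ) : (Function.support (rho k)).Finite := by
  refine ((Set.finite_Iic (k + 1)).biUnion fun d _ => finite_card_eq d).subset fun μ hμ => ?_
  rw [Function.mem_support, rho_eq] at hμ
  have h1 : μ.card + μ.colLen 0 ≤ k + 1 := by
    by_contra h
    exact hμ (if_neg h)
  exact Set.mem_biUnion (Set.mem_Iic.2 (by omega : μ.card ≤ k + 1)) rfl

/-- The completed `k`-cycle. -/
def completedCycle (k : ℕ) : TotalClassAlg :=
  classBasis.repr.symm (Finsupp.ofSupportFinite (rho k) (finite_support_rho k))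

theorem repr_completedCycle (k : ℕ) (μ : YoungDiagram) :
    classBasis.repr (completedCycle k) μ = rho k μ := by
  rw [completedCycle, LinearEquiv.apply_symm_apply, Finsupp.ofSupportFinite_coe]

theorem phi_apply (x : TotalClassAlg) (lam : YoungDiagram) :
    phi x lam = (classBasis.repr x).sum fun μ r => r * f μ lam := by
  rw [phi, Module.Basis.constr_apply, Finsupp.sum_apply']
  rfl

end Coefficients

/-! ### The Fourier transform of a completed cycle -/

section Fourier

open PowerSeries

variable {α : Type*} [Fintype α] [DecidableEq α]

theorem pairSum_add (F G : Finset α → Perm α → ℚ) (A : Finset α) :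
    pairSum (F + G) A = pairSum F A + pairSum G A := by
  simp [pairSum, MonoidAlgebra.single_add, Finset.sum_add_distrib]

theorem pairSum_smul (r : ℚ) (F : Finset α → Perm α → ℚ) (A : Finset α) :
    pairSum (r • F) A = r • pairSum F A := by
  simp [pairSum, Finset.smul_sum]

/-- `pairSum` as a linear map. -/
def pairSumHom (A : Finset α) : (Finset α → Perm α → ℚ) →ₗ[ℚ] PermAlg α where
  toFun F := pairSum F A
  map_add' F G := pairSum_add F G A
  map_smul' r F := pairSum_smul r F A

theorem exists_rowLens_eq (σ : Perm α) (A : Finset α) :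
    ∃ μ : YoungDiagram, cycleLengths σ A = (μ.rowLens : Multiset ℕ) := by
  refine ⟨YoungDiagram.ofRowLens ((cycleLengths σ A).sort (· ≥ ·))
    (Multiset.pairwise_sort _ _).sortedGE, ?_⟩
  rw [YoungDiagram.rowLens_ofRowLens_eq_self, Multiset.sort_eq]
  intro x hx
  exact pos_of_mem_cycleLengths ((Multiset.mem_sort _).1 hx)

theorem sum_rho_typeIndicator (k : ℕ) {A : Finset α} {σ : Perm α} (hσ : σ ∈ supportedIn A) :
    ∑ μ ∈ (finite_support_rho k).toFinset, rho k μ * typeIndicator μ A σ =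
      ((k - 1).factorial : ℚ) * coeff (k + 1) (S⁻¹ * cycleSeries σ A) := by
  obtain ⟨μ, hμ⟩ := exists_rowLens_eq σ A
  have hcard : μ.card = A.card := by
    rw [← sum_cycleLengths hσ, hμ, Multiset.sum_coe, rowLens_sum]
  rw [Finset.sum_eq_single μ]
  · rw [typeIndicator, if_pos hμ, mul_one, rho, cycleSeries, cycleProd_eq, hμ, hcard,
      Multiset.map_coe, Multiset.prod_coe]
  · intro ν _ hν
    rw [typeIndicator, if_neg, mul_zero]
    exact fun h => hν (rowLens_perm_injective (h.symm.trans hμ))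
  · intro h
    have h1 : rho k μ = 0 := by simpa using h
    rw [h1, zero_mul]

/-- Extraction of the powers of Jucys–Murphy elements from the coefficients of the completed
cycle. The empty partial permutation is responsible for the constant term. -/
theorem coeff_inv_mul_cycleSeries (k : ℕ) (σ : Perm α) (A : Finset α) :
    coeff (k + 1) (S⁻¹ * cycleSeries σ A) =
      coeff (k + 1) S⁻¹ * (if A = ∅ then 1 else 0) +
        ∑ q ∈ Finset.HasAntidiagonal.antidiagonal k,
          coeff q.1 (sh 1) / (q.2.factorial : ℚ) * weight q.2 A σ := by
  rcases A.eq_empty_or_nonempty with rfl | hA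
  · simp [weight, weightSeries_empty, cycleSeries, cycleProd, cycles]
  · have h1 : S⁻¹ * cycleSeries σ A = X * (sh 1 * weightSeries σ A) := by
      rw [← sh_sq_mul_weightSeries hA, sh_one_eq]
      linear_combination X ^ 2 * S * weightSeries σ A * S_mul_inv
    rw [h1, coeff_succ_X_mul, coeff_mul, if_neg hA.ne_empty, mul_zero, zero_add]
    refine Finset.sum_congr rfl fun q _ => ?_
    have : (q.2.factorial : ℚ) ≠ 0 := by positivity
    rw [weight]
    field_simp

theorem pairSum_empty_indicator :
    pairSum (fun A (_ : Perm α) => if A = ∅ then (1 : ℚ) else 0) Finset.univ = 1 := by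
  have h0 : permsIn (∅ : Finset α) = {1} := by
    ext σ
    rw [mem_permsIn, Finset.mem_singleton]
    exact ⟨fun h => Equiv.ext fun x => h x (Finset.notMem_empty x), fun h => h ▸ one_mem _⟩
  rw [pairSum, Finset.sum_eq_single_of_mem ∅ (Finset.empty_mem_powerset _)]
  · rw [h0, Finset.sum_singleton, if_pos rfl]
    rfl
  · intro A _ hA
    simp [hA]

theorem sum_rho_partialClassSum (k d : ℕ) :
    ∑ μ ∈ (finite_support_rho k).toFinset, rho k μ • partialClassSum d μ =
      ((k - 1).factorial : ℚ) • (coeff (k + 1) S⁻¹ • (1 : GroupAlg d) +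
        ∑ q ∈ Finset.HasAntidiagonal.antidiagonal k,
          (coeff q.1 (sh 1) / (q.2.factorial : ℚ)) • jmPowerSum q.2 Finset.univ) := by
  have h1 : ∀ F : Finset (Fin d) → Perm (Fin d) → ℚ,
      pairSum F Finset.univ = pairSumHom Finset.univ F := fun _ => rfl
  simp only [partialClassSum, jmPowerSum, ← pairSum_empty_indicator, h1]
  simp only [← map_smul, ← map_sum, ← map_add]
  simp only [← h1, pairSum]
  refine Finset.sum_congr rfl fun A _ => Finset.sum_congr rfl fun σ hσ => ?_
  congr 1
  simp only [Finset.sum_apply, Pi.smul_apply, Pi.add_apply, smul_eq_mul]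
  rw [sum_rho_typeIndicator k (mem_permsIn.1 hσ), coeff_inv_mul_cycleSeries]

theorem sum_cells (lam : YoungDiagram) (g : ℕ → ℕ → ℚ) :
    ∑ c ∈ lam.cells, g c.1 c.2 =
      ∑ i ∈ Finset.range (lam.colLen 0), ∑ j ∈ Finset.range (lam.rowLen i), g i j := by
  have h2 : ∀ c ∈ lam.cells, c.1 ∈ Finset.range (lam.colLen 0) := by
    rintro ⟨i, j⟩ hc
    rw [Finset.mem_range, ← YoungDiagram.mem_iff_lt_colLen]
    exact lam.up_left_mem le_rfl (Nat.zero_le _) hc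
  rw [← Finset.sum_fiberwise_of_maps_to h2]
  refine Finset.sum_congr rfl fun i _ => ?_
  have h3 : (lam.cells.filter fun c => c.1 = i) = lam.row i := rfl
  rw [h3, YoungDiagram.row_eq_prod, Finset.sum_product, Finset.sum_singleton]

/-- The shifted power sum as a sum over the cells, by telescoping along the rows. -/
theorem p_eq (k : ℕ) (lam : YoungDiagram) : p k lam =
    ∑ c ∈ lam.cells, (((c.2 : ℚ) - c.1 + 1 / 2) ^ k - ((c.2 : ℚ) - c.1 - 1 / 2) ^ k) +
      (1 - 1 / 2 ^ k) * zetaNeg k := by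
  rw [p, sum_cells lam fun i j => (((j : ℚ) - i + 1 / 2) ^ k - ((j : ℚ) - i - 1 / 2) ^ k)]
  congr 1
  have h1 : Finset.Icc 1 (lam.colLen 0) = (Finset.range (lam.colLen 0)).map
      (addRightEmbedding 1) := by
    ext i
    simp only [Finset.mem_Icc, Finset.mem_map, Finset.mem_range, addRightEmbedding_apply]
    exact ⟨fun h => ⟨i - 1, by omega, by omega⟩, by rintro ⟨j, hj, rfl⟩; omega⟩
  rw [h1, Finset.sum_map]
  refine Finset.sum_congr rfl fun i _ => ?_
  have h2 := Finset.sum_range_sub (fun j : ℕ => ((j : ℚ) - (i + 1) + 1 / 2) ^ k) (lam.rowLen i)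
  simp only [addRightEmbedding_apply, Nat.add_sub_cancel]
  push_cast at h2 ⊢
  rw [zero_sub] at h2
  rw [← h2]
  refine Finset.sum_congr rfl fun j _ => ?_
  congr 2 <;> ring

/-- The generating function of the constant terms of the shifted power sums. -/
theorem inv_S_eq : S⁻¹ = 2 * rescale (1 / 2) (bernoulliPowerSeries ℚ) - bernoulliPowerSeries ℚ := by
  have hB := bernoulliPowerSeries_mul_exp_sub_one ℚ
  have hB' := congrArg (rescale (1 / 2 : ℚ)) hB
  have hE : exp ℚ = expS (1 / 2) ^ 2 := by
    rw [expS_pow, expS]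
    norm_num
  have hE' : rescale (1 / 2 : ℚ) (exp ℚ) = expS (1 / 2) := rfl
  have hEV := expS_half_mul
  have h2 : (2 : PowerSeries ℚ) * PowerSeries.C (1 / 2 : ℚ) = 1 := by
    rw [show (2 : PowerSeries ℚ) = PowerSeries.C 2 from (map_ofNat _ 2).symm, ← map_mul]
    norm_num
  rw [map_mul, map_sub, hE', map_one, rescale_X] at hB'
  rw [hE] at hB
  have h1 : X * (S * (2 * rescale (1 / 2) (bernoulliPowerSeries ℚ) - bernoulliPowerSeries ℚ)) =
      X * 1 := by
    rw [← mul_assoc, ← sh_one_eq, sh_eq]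
    generalize rescale (1 / 2) (bernoulliPowerSeries ℚ) = B' at *
    generalize bernoulliPowerSeries ℚ = B at *
    generalize expS (1 / 2) = E at *
    generalize expS (-(1 / 2)) = V at *
    linear_combination (2 * V * (E + 1)) * hB' - V * hB + V * (E + 1) * X * h2 + X * hEV -
      (2 * B' - B) * E * hEV
  have h3 := mul_left_cancel₀ X_ne_zero h1
  calc S⁻¹ = S⁻¹ * (S * (2 * rescale (1 / 2) (bernoulliPowerSeries ℚ) -
        bernoulliPowerSeries ℚ)) := by rw [h3, mul_one]
    _ = (S * S⁻¹) * (2 * rescale (1 / 2) (bernoulliPowerSeries ℚ) - bernoulliPowerSeries ℚ) := by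
        ring
    _ = _ := by rw [S_mul_inv, one_mul]

theorem zetaNeg_eq (k : ℕ) : zetaNeg k = (-1) ^ k * bernoulli (k + 1) / (k + 1) := by
  have h := zetaNeg_spec k
  rw [riemannZeta_neg_nat_eq_bernoulli] at h
  exact_mod_cast h

theorem constant_term {k : ℕ} (hk : 1 ≤ k) :
    ((k - 1).factorial : ℚ) * coeff (k + 1) S⁻¹ = 1 / k * ((1 - 1 / 2 ^ k) * zetaNeg k) := by
  have h2 : (2 : PowerSeries ℚ) = PowerSeries.C 2 := (map_ofNat _ 2).symm
  have hB : coeff (k + 1) (bernoulliPowerSeries ℚ) =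
      bernoulli (k + 1) / ((k + 1).factorial : ℚ) := by
    simp [bernoulliPowerSeries]
  rw [inv_S_eq, map_sub, h2, coeff_C_mul, coeff_rescale, hB, zetaNeg_eq]
  have hsign : -bernoulli (k + 1) = (-1) ^ k * bernoulli (k + 1) := by
    rcases Nat.even_or_odd k with h | h
    · rw [bernoulli_eq_zero_of_odd h.add_one (by omega)]
      simp
    · rw [h.neg_one_pow]
      ring
  rw [← hsign]
  obtain ⟨n, rfl⟩ := Nat.exists_eq_succ_of_ne_zero (by omega : k ≠ 0)
  rw [Nat.succ_eq_add_one, Nat.add_sub_cancel, Nat.factorial_succ (n + 1), Nat.factorial_succ n]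
  have : (n.factorial : ℚ) ≠ 0 := by positivity
  have h3 : (1 / 2 : ℚ) ^ (n + 1 + 1) * 2 = 1 / 2 ^ (n + 1) := by
    rw [pow_succ, mul_assoc, one_div_mul_cancel two_ne_zero, mul_one, one_div_pow]
  push_cast
  rw [← mul_assoc 2, mul_comm 2, h3]
  field_simp
  ring

theorem coeff_sum_contents (k : ℕ) (x : ℚ) :
    ∑ q ∈ Finset.HasAntidiagonal.antidiagonal k,
      coeff q.1 (sh 1) / (q.2.factorial : ℚ) * x ^ q.2 =
      ((x + 1 / 2) ^ k - (x - 1 / 2) ^ k) / k.factorial := by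
  have h1 : sh 1 * expS x = expS (x + 1 / 2) - expS (x - 1 / 2) := by
    rw [sh, sub_mul, expS_mul, expS_mul, Nat.cast_one]
    congr 2 <;> ring
  have h2 := congrArg (coeff k) h1
  rw [coeff_mul, map_sub, coeff_expS, coeff_expS] at h2
  rw [sub_div, ← h2]
  refine Finset.sum_congr rfl fun q _ => ?_
  rw [coeff_expS]
  ring

/-- The Fourier transform of the completed cycle is the shifted power sum. -/
theorem phi_completedCycle {k : ℕ} (hk : 1 ≤ k) :
    phi (completedCycle k) = (1 / (k : ℚ)) • p k := by
  ext lam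
  have h1 : phi (completedCycle k) lam = centralChar lam
      (∑ μ ∈ (finite_support_rho k).toFinset, rho k μ • partialClassSum lam.card μ) := by
    rw [phi_apply, map_sum, completedCycle, LinearEquiv.apply_symm_apply, Finsupp.sum]
    have hs : (Finsupp.ofSupportFinite (rho k) (finite_support_rho k)).support =
        (finite_support_rho k).toFinset := by
      ext μ
      simp [Finsupp.ofSupportFinite_coe]
    rw [hs]
    refine Finset.sum_congr rfl fun μ _ => ?_
    rw [map_smul, smul_eq_mul, f_eq_centralChar, Finsupp.ofSupportFinite_coe]
  have hfac : ((k - 1).factorial : ℚ) / k.factorial = 1 / k := by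
    obtain ⟨n, rfl⟩ := Nat.exists_eq_succ_of_ne_zero (by omega : k ≠ 0)
    rw [Nat.succ_eq_add_one, Nat.add_sub_cancel, Nat.factorial_succ n]
    have : (n.factorial : ℚ) ≠ 0 := by positivity
    push_cast
    field_simp
  rw [h1, sum_rho_partialClassSum, map_smul, map_add, map_smul, centralChar_one, map_sum,
    Pi.smul_apply, p_eq, smul_eq_mul, smul_eq_mul, smul_eq_mul, mul_one, mul_add, mul_add,
    constant_term hk, add_comm]
  congr 1
  simp only [map_smul, centralChar_jmPowerSum, smul_eq_mul, Finset.mul_sum]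
  rw [Finset.sum_comm]
  refine Finset.sum_congr rfl fun c _ => ?_
  rw [← Finset.mul_sum, coeff_sum_contents, ← hfac]
  ring

end Fourier

/-! ### Contents determine a Young diagram -/

section ContentsSeparate

theorem sum_eval_eq_of_sum_pow_eq {ι : Type*} {s t : Finset ι} {g : ι → ℚ}
    (h : ∀ m : ℕ, ∑ c ∈ s, g c ^ m = ∑ c ∈ t, g c ^ m) (P : Polynomial ℚ) :
    ∑ c ∈ s, P.eval (g c) = ∑ c ∈ t, P.eval (g c) := by
  simp only [Polynomial.eval_eq_sum_range]
  rw [Finset.sum_comm, Finset.sum_comm (s := t)]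
  refine Finset.sum_congr rfl fun m _ => ?_
  rw [← Finset.mul_sum, ← Finset.mul_sum, h]

/-- Power sums determine the multiplicities of the values. -/
theorem card_filter_eq_of_sum_pow_eq {ι : Type*} {s t : Finset ι} {g : ι → ℚ}
    (h : ∀ m : ℕ, ∑ c ∈ s, g c ^ m = ∑ c ∈ t, g c ^ m) (r : ℚ) :
    (s.filter fun c => g c = r).card = (t.filter fun c => g c = r).card := by
  classical
  -- a polynomial that vanishes at all values of `g` other than `r`
  set T : Finset ℚ := ((s ∪ t).image g).erase r
  set P : Polynomial ℚ := ∏ q ∈ T, (Polynomial.X - Polynomial.C q) with hP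
  have hr : P.eval r ≠ 0 := by
    rw [hP, Polynomial.eval_prod, Finset.prod_ne_zero_iff]
    intro q hq
    rw [Polynomial.eval_sub, Polynomial.eval_X, Polynomial.eval_C, sub_ne_zero]
    exact (Finset.mem_erase.1 hq).1.symm
  have hsum : ∀ u ⊆ s ∪ t, ∑ c ∈ u, P.eval (g c) = (u.filter fun c => g c = r).card * P.eval r := by
    intro u hu
    rw [← nsmul_eq_mul, ← Finset.sum_const, Finset.sum_filter]
    refine Finset.sum_congr rfl fun c hc => ?_
    split_ifs with hcr
    · rw [hcr]
    · rw [hP, Polynomial.eval_prod]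
      refine Finset.prod_eq_zero (Finset.mem_erase.2 ⟨hcr, Finset.mem_image_of_mem g (hu hc)⟩) ?_
      simp
  have h1 := sum_eval_eq_of_sum_pow_eq h P
  rw [hsum s Finset.subset_union_left, hsum t Finset.subset_union_right] at h1
  exact_mod_cast mul_right_cancel₀ hr h1

/-- The cells on a diagonal of a Young diagram form an initial segment of the diagonal. -/
theorem mem_iff_min_lt (lam : YoungDiagram) (i j : ℕ) : (i, j) ∈ lam ↔
    min i j < (lam.cells.filter fun c => ((c.2 : ℚ) - c.1) = (j : ℚ) - i).card := by
  set D := lam.cells.filter fun c => ((c.2 : ℚ) - c.1) = (j : ℚ) - i with hD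
  have hmem : ∀ c, c ∈ D ↔ c ∈ lam ∧ c.2 + i = j + c.1 := by
    intro c
    rw [hD, Finset.mem_filter, YoungDiagram.mem_cells, sub_eq_sub_iff_add_eq_add]
    exact and_congr_right fun _ => by exact_mod_cast Iff.rfl
  have hinj : Set.InjOn (fun c : ℕ × ℕ => min c.1 c.2) D := by
    intro c hc d hd hcd
    have h1 := ((hmem c).1 hc).2
    have h2 := ((hmem d).1 hd).2
    simp only at hcd
    exact Prod.ext (by omega) (by omega)
  have himg : D.image (fun c => min c.1 c.2) = Finset.range D.card := by
    rw [← Finset.card_image_of_injOn hinj]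
    refine eq_range_card_of_lower fun r hr q hq => ?_
    obtain ⟨c, hc, rfl⟩ := Finset.mem_image.1 hr
    obtain ⟨h1, h2⟩ := (hmem c).1 hc
    refine Finset.mem_image.2 ⟨(c.1 - (min c.1 c.2 - q), c.2 - (min c.1 c.2 - q)),
      (hmem _).2 ⟨lam.up_left_mem (Nat.sub_le _ _) (Nat.sub_le _ _) h1, ?_⟩, ?_⟩
    · simp only
      omega
    · simp only
      omega
  rw [← Finset.mem_range, ← himg, Finset.mem_image]
  constructor
  · intro h
    exact ⟨(i, j), (hmem _).2 ⟨h, rfl⟩, rfl⟩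
  · rintro ⟨⟨a, b⟩, hc, hc'⟩
    obtain ⟨h1, h2⟩ := (hmem _).1 hc
    simp only at hc' h2
    obtain rfl : a = i := by omega
    obtain rfl : b = j := by omega
    exact h1

theorem eq_of_sum_contents_eq {lam lam' : YoungDiagram}
    (h : ∀ m : ℕ, ∑ c ∈ lam.cells, ((c.2 : ℚ) - c.1) ^ m =
      ∑ c ∈ lam'.cells, ((c.2 : ℚ) - c.1) ^ m) : lam = lam' := by
  apply YoungDiagram.ext
  ext ⟨i, j⟩
  rw [YoungDiagram.mem_cells, YoungDiagram.mem_cells, mem_iff_min_lt, mem_iff_min_lt,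
    card_filter_eq_of_sum_pow_eq (g := fun c : ℕ × ℕ => (c.2 : ℚ) - c.1) h]

end ContentsSeparate

/-! ### Injectivity of the Fourier transform -/

section Injective

theorem classSumAux_eq_partialClassSum {d : ℕ} {η : YoungDiagram} (h : η.card = d) :
    classSumAux d η = partialClassSum d η := by
  classical
  rw [partialClassSum, pairSum, Finset.sum_eq_single_of_mem Finset.univ (by simp), classSumAux]
  · have h1 : ∀ σ : Perm (Fin d), typeIndicator η Finset.univ σ = if HasType σ η then 1 else 0 := by
      intro σ
      rw [typeIndicator]
      congr 1
      exact propext (hasType_iff σ η).symm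
    have h2 : permsIn (Finset.univ : Finset (Fin d)) = Finset.univ := by
      ext σ
      simp [mem_permsIn, mem_supportedIn_univ]
    rw [h2, conjClass, Finset.sum_filter]
    refine Finset.sum_congr rfl fun σ _ => ?_
    rw [h1]
    split_ifs
    · rfl
    · rw [MonoidAlgebra.single_zero]
  · intro A _ hA
    refine Finset.sum_eq_zero fun σ hσ => ?_
    rw [typeIndicator, if_neg, MonoidAlgebra.single_zero]
    intro h1
    have h2 := sum_cycleLengths (mem_permsIn.1 hσ)
    rw [h1, Multiset.sum_coe, rowLens_sum, h] at h2
    exact hA (Finset.eq_univ_of_card A (by rw [← h2, Fintype.card_fin]))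

/-- The central character of the class algebra `Z(d)` attached to a diagram with `d` cells. -/
def charHom (lam : YoungDiagram) : ∀ {d : ℕ}, lam.card = d → (ClassAlg d →ₐ[ℚ] ℚ)
  | _, rfl => AlgHom.ofLinearMap (centralChar lam ∘ₗ (ClassAlg lam.card).val.toLinearMap)
      (centralChar_one lam) fun z w => centralChar_mul z.2 w.2

theorem charHom_classSum {d : ℕ} {lam : YoungDiagram} (h : lam.card = d) {η : YoungDiagram}
    (hη : η.card = d) : charHom lam h (classSum d η) = f η lam := by
  subst h
  rw [f_eq_centralChar, ← classSumAux_eq_partialClassSum hη]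
  rfl

/-- The power sum of the Jucys–Murphy elements as an element of the class algebra. -/
def jmClass (m d : ℕ) : ClassAlg d :=
  ⟨jmPowerSum m Finset.univ, (weight_conjInvariant m).pairSum_mem⟩

theorem charHom_jmClass {d : ℕ} {lam : YoungDiagram} (h : lam.card = d) (m : ℕ) :
    charHom lam h (jmClass m d) = ∑ c ∈ lam.cells, ((c.2 : ℚ) - c.1) ^ m := by
  subst h
  exact centralChar_jmPowerSum lam m

/-- The diagrams with `d` cells. -/
abbrev DiagramsOf (d : ℕ) : Type := {μ : YoungDiagram // μ.card = d}

instance fintypeDiagramsOf (d : ℕ) : Fintype (DiagramsOf d) := (finite_card_eq d).fintype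

theorem mem_span_classSum {d : ℕ} (z : ClassAlg d) :
    z ∈ Submodule.span ℚ (Set.range fun η : DiagramsOf d => classSum d η.1) := by
  classical
  choose ty hty using fun σ : Perm (Fin d) => exists_type σ
  have hz := (mem_classAlg_iff (z : GroupAlg d)).1 z.2
  have hex : ∀ η : DiagramsOf d, ∃ σ : Perm (Fin d), HasType σ η.1 := by
    rintro ⟨η, rfl⟩
    exact ⟨rep η, rep_hasType η⟩
  choose r hr using hex
  have hsum : z = ∑ η : DiagramsOf d, (z : GroupAlg d).coeff (r η) • classSum d η.1 := by
    apply Subtype.ext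
    ext σ
    simp only [AddSubmonoidClass.coe_finsetSum, Subalgebra.coe_smul, MonoidAlgebra.coeff_sum,
      MonoidAlgebra.coeff_smul, Finsupp.finsetSum_apply, Finsupp.smul_apply]
    have h1 : ∀ η : DiagramsOf d, ((classSum d η.1 : ClassAlg d) : GroupAlg d).coeff σ =
        if HasType σ η.1 then 1 else 0 := fun η => coeff_classSumAux d η.1 σ
    rw [Finset.sum_eq_single ⟨ty σ, (hty σ).card_eq⟩]
    · rw [h1, if_pos (hty σ), smul_eq_mul, mul_one]
      obtain ⟨τ, hτ⟩ := isConj_iff.1 ((hty σ).isConj (hr ⟨ty σ, (hty σ).card_eq⟩))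
      rw [← hτ, hz]
    · intro η _ hη
      rw [h1, if_neg, smul_zero]
      exact fun h => hη (Subtype.ext (h.unique (hty σ)))
    · intro h
      exact absurd (Finset.mem_univ _) h
  rw [hsum]
  exact Submodule.sum_mem _ fun η _ => Submodule.smul_mem _ _ (Submodule.subset_span ⟨η, rfl⟩)

/-- The central characters of the class algebra, taken together. -/
def charMap (d : ℕ) : ClassAlg d →ₐ[ℚ] (DiagramsOf d → ℚ) :=
  AlgHom.pi fun lam => charHom lam.1 lam.2

/-- The central characters separate the diagrams, so the subalgebra of functions they define is
the algebra of all functions. -/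
theorem charMap_surjective (d : ℕ) : Function.Surjective (charMap d) := by
  classical
  have hsep : ∀ lam lam' : DiagramsOf d, lam ≠ lam' →
      ∃ z, charMap d z lam = 1 ∧ charMap d z lam' = 0 := by
    intro lam lam' hne
    obtain ⟨m, hm⟩ : ∃ m : ℕ, charHom lam.1 lam.2 (jmClass m d) ≠
        charHom lam'.1 lam'.2 (jmClass m d) := by
      by_contra h
      push Not at h
      refine hne (Subtype.ext (eq_of_sum_contents_eq fun m => ?_))
      rw [← charHom_jmClass lam.2, ← charHom_jmClass lam'.2, h]
    set u := charHom lam.1 lam.2 (jmClass m d)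
    set v := charHom lam'.1 lam'.2 (jmClass m d)
    refine ⟨(u - v)⁻¹ • (jmClass m d - algebraMap ℚ _ v), ?_, ?_⟩
    · change charHom lam.1 lam.2 _ = 1
      rw [map_smul, map_sub, AlgHom.commutes, smul_eq_mul]
      exact inv_mul_cancel₀ (sub_ne_zero.2 hm)
    · change charHom lam'.1 lam'.2 _ = 0
      rw [map_smul, map_sub, AlgHom.commutes, smul_eq_mul]
      exact mul_eq_zero_of_right _ (sub_self v)
  choose! sep hsep1 hsep0 using hsep
  have hsingle : ∀ lam : DiagramsOf d, ∃ z, charMap d z = Pi.single lam 1 := by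
    intro lam
    refine ⟨∏ lam' ∈ Finset.univ.erase lam, sep lam lam', ?_⟩
    rw [map_prod]
    ext ν
    rw [Finset.prod_apply]
    rcases eq_or_ne ν lam with rfl | hν
    · rw [Pi.single_eq_same]
      exact Finset.prod_eq_one fun lam' h => hsep1 _ _ (Finset.mem_erase.1 h).1.symm
    · rw [Pi.single_eq_of_ne hν]
      exact Finset.prod_eq_zero (Finset.mem_erase.2 ⟨hν, Finset.mem_univ _⟩) (hsep0 _ _ hν.symm)
  choose z hz using hsingle
  intro g
  refine ⟨∑ lam, g lam • z lam, ?_⟩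
  rw [map_sum]
  ext ν
  simp [map_smul, hz, Finset.sum_apply, Pi.single_apply]

/-- The square matrix of the normalized characters `f_η(lam)`, `|η| = |lam| = d`, is
invertible. -/
theorem linearIndependent_f (d : ℕ) :
    LinearIndependent ℚ fun (η : DiagramsOf d) (lam : DiagramsOf d) => f η.1 lam.1 := by
  apply linearIndependent_of_top_le_span_of_card_eq_finrank
  · intro g _
    obtain ⟨z, rfl⟩ := charMap_surjective d g
    have h1 := Submodule.mem_map_of_mem (f := (charMap d).toLinearMap) (mem_span_classSum z)
    rw [Submodule.map_span, ← Set.range_comp] at h1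
    have h2 : (fun (η : DiagramsOf d) (lam : DiagramsOf d) => f η.1 lam.1) =
        (charMap d).toLinearMap ∘ fun η : DiagramsOf d => classSum d η.1 := by
      funext η lam
      exact (charHom_classSum lam.2 η.2).symm
    rw [h2]
    exact h1
  · rw [Module.finrank_fintype_fun_eq_card]

theorem phi_injective : Function.Injective phi := by
  rw [injective_iff_map_eq_zero]
  intro x hx
  by_contra hne
  have hsupp : (classBasis.repr x).support.Nonempty := by
    rw [Finsupp.support_nonempty_iff]
    exact fun h => hne (classBasis.repr.map_eq_zero_iff.1 h)
  -- the components of smallest degree already have a nonzero transform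
  obtain ⟨μ, hμ, hmin⟩ := Finset.exists_min_image _ YoungDiagram.card hsupp
  have h1 : ∑ η : DiagramsOf μ.card, classBasis.repr x η.1 •
      (fun lam : DiagramsOf μ.card => f η.1 lam.1) = 0 := by
    funext lam
    have h2 := congrFun hx lam.1
    rw [phi_apply, Finsupp.sum, Pi.zero_apply] at h2
    rw [Finset.sum_apply, Pi.zero_apply, ← h2]
    simp only [Pi.smul_apply, smul_eq_mul]
    refine Finset.sum_bij_ne_zero (fun η _ _ => η.1) (fun η _ h => ?_)
      (fun _ _ _ _ _ _ h => Subtype.ext h) (fun ν hν h => ?_) fun _ _ _ => rfl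
    · exact Finsupp.mem_support_iff.2 (left_ne_zero_of_mul h)
    · refine ⟨⟨ν, le_antisymm ?_ (hmin ν hν)⟩, Finset.mem_univ _, h, rfl⟩
      by_contra hlt
      refine right_ne_zero_of_mul h ?_
      rw [f, Nat.choose_eq_zero_of_lt (lam.2.trans_lt (not_le.1 hlt))]
      simp
  have h3 := Fintype.linearIndependent_iff.1 (linearIndependent_f μ.card) _ h1 ⟨μ, rfl⟩
  exact (Finsupp.mem_support_iff.1 hμ) h3

end Injective

end CompletedCycles

end

theorem mainTheorem3 (k : ℕ) (hk : 1 ≤ k) :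
    ∃ c : CompletedCycles.TotalClassAlg,
      (∀ x : CompletedCycles.TotalClassAlg,
        CompletedCycles.phi x = (1 / (k : ℚ)) • CompletedCycles.p k ↔ x = c) ∧
      (∀ (μ : YoungDiagram) (g : ℕ), k + 1 = μ.card + μ.colLen 0 + 2 * g →
        CompletedCycles.classBasis.repr c μ =
          ((k - 1).factorial : ℚ) * ((μ.rowLens.prod : ℚ) / (μ.card.factorial : ℚ)) *
            PowerSeries.coeff (2 * g) (CompletedCycles.rhoSeries μ)) ∧
      (∀ μ : YoungDiagram, (¬ ∃ g : ℕ, k + 1 = μ.card + μ.colLen 0 + 2 * g) →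
        CompletedCycles.classBasis.repr c μ = 0) := by
  refine ⟨CompletedCycles.completedCycle k, fun x => ?_, fun μ g h => ?_, fun μ h => ?_⟩
  · rw [← CompletedCycles.phi_completedCycle hk, CompletedCycles.phi_injective.eq_iff]
  · rw [CompletedCycles.repr_completedCycle, CompletedCycles.rho_of_eq h]
  · rw [CompletedCycles.repr_completedCycle, CompletedCycles.rho_of_not_exists h]
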